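/- For a finite graph $G=(V,E)$, the bandwidth of $G$ is $\min_\sigma\max_{u\sim v}|\sigma(u)-\sigma(v)|$ over all labelings $\sigma$ of $V$ by $1,\dots,|V|$. A set of vertices is contiguous if it is empty or induces a connected subgraph. Two Markov chains are considered. Color chain. The states are the colorings $\omega:V\to\{1,2\}$ with both color classes contiguous. In one step, a vertex $v$ and a color $i$ are chosen independently and uniformly at random, and $v$ is recolored with $i$ if the result is again a state; otherwise nothing changes. Partition chain. The states are the unordered partitions $\{A,V\setminus A\}$ with $A$ and $V\setminus A$ contiguous. In one step, a vertex $v$ and one of the two pieces are chosen independently and uniformly at random, and $v$ is moved to the chosen piece if the result is again a state; otherwise nothing changes. For a transition matrix $P$ with stationary distribution $\pi$ write $t_{\mathrm{mix}}(\delta)=\min\{t:\max_x\|P^t(x,\cdot)-\pi\|_{TV}\le\delta\}$. Let $G_{3\times\ell}$ be the $3\times \ell$ grid graph, and for odd $\ell$ let $G^4_{3\times\ell}$ be the subgraph of the $\ell\times\ell$ grid graph induced by the vertices at graph distance at most $1$ from the middle row or the middle column. (1) For $\ell\ge3$ the graph $G_{3\times\ell}$ has bandwidth $3$. For every $\ell\ge1$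 the color chain on $G_{3\times\ell}$ is ergodic with uniform stationary distribution. Its mixing time is exponential in $|V|=3\ell$: there is $c>0$ such that for every $\delta\in(0,\frac12)$ and all sufficiently large $\ell$, $t_{\mathrm{mix}}(\delta)\ge e^{c|V|}$. Moreover, for all sufficiently large $\ell$ there is a set of $\mathrm{poly}(\ell)$ states that separates a set of $\Omega(2^\ell)$ states from the remaining states, of which there are also $\Omega(2^\ell)$ (that is, there are no transitions between the two sets). (2) For every odd $\ell\geq 1$ the graph $G^4_{3\times\ell}$ has bandwidth at most $12$, and the partition chain on $G^4_{3\times\ell}$ is ergodic with uniform stationary distribution. Its mixing time is exponential in $|V|$ (hence in $\ell$, since $|V|=6\ell-9$ for $\ell\ge3$): there is $c>0$ such that for every $\delta\in(0,\frac12)$ and all sufficiently large odd $\ell$, $t_{\mathrm{mix}}(\delta)\ge e^{c|V|}$. Moreover, for all sufficiently large odd $\ell$ there is a set of at most $\mathrm{poly}(\ell)\,2^{\ell/2}$ states that separates a set of $\Omega(2^\ell)$ states from the remaining states, of which there are also $\Omega(2^\ell)$. -/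

import Mathlib

open scoped ENNReal

noncomputable section

namespace ConnPart

/-! ### Finite Markov chains -/

section Chain

variable {Ω : Type*} [Fintype Ω] [DecidableEq Ω]

/-- The uniform distribution on a finite state space. -/
def uniformDist (Ω : Type*) [Fintype Ω] : Ω → ℝ := fun _ => 1 / (Fintype.card Ω : ℝ)

/-- The total variation distance between two distributions on a finite set. -/
def tvDist (μ ν : Ω → ℝ) : ℝ := (1 / 2) * ∑ x, |μ x - ν x|

/-- `d(t)`: the largest distance from `π`, over all starting states `x`, of the law
`P ^ t (x, ·)` of the chain after `t` steps. -/
def worstDist (P : Matrix Ω Ω ℝ) (π : Ω → ℝ) (t : ℕ) : ℝ :=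
  ⨆ x : Ω, tvDist ((P ^ t) x) π

/-- The mixing time: the least `t` with `d(t) ≤ δ` (and `⊤` if there is no such `t`). -/
def mixingTime (P : Matrix Ω Ω ℝ) (π : Ω → ℝ) (δ : ℝ) : ℕ∞ :=
  sInf ((fun t : ℕ => (t : ℕ∞)) '' {t : ℕ | worstDist P π t ≤ δ})

/-- `P` is the transition matrix of an ergodic (irreducible and aperiodic) Markov chain whose
stationary distribution is `π`. For a finite chain, irreducibility together with aperiodicity
says that some power of `P` is entrywise positive, which is `Matrix.IsPrimitive`. -/
structure IsErgodicChain (P : Matrix Ω Ω ℝ) (π : Ω → ℝ) : Prop where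
  stochastic : P ∈ Matrix.rowStochastic ℝ Ω
  ergodic : P.IsPrimitive
  stationary : Matrix.vecMul π P = π

/-- A cut set of at most `b` states separates (for the transitions of `P`) a region of at least
`s` states from the remaining states, of which there are also at least `s`. -/
def HasBottleneck (P : Matrix Ω Ω ℝ) (s b : ℝ) : Prop :=
  ∃ S C : Finset Ω, Disjoint S C ∧
    (∀ x ∈ S, ∀ y ∈ (S ∪ C)ᶜ, P x y = 0 ∧ P y x = 0) ∧
    s ≤ (S.card : ℝ) ∧ s ≤ (((S ∪ C)ᶜ).card : ℝ) ∧ (C.card : ℝ) ≤ b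

end Chain

/-! ### Graphs -/

/-- The `k × ℓ` grid graph. -/
def gridGraph (k ℓ : ℕ) : SimpleGraph (Fin k × Fin ℓ) :=
  (SimpleGraph.pathGraph k).boxProd (SimpleGraph.pathGraph ℓ)

/-- The vertices of the `ℓ × ℓ` grid (`ℓ` odd) at graph distance at most `1` from the middle
horizontal or from the middle vertical line. -/
def plusSet (ℓ : ℕ) : Set (Fin ℓ × Fin ℓ) :=
  {v | ∃ w : Fin ℓ × Fin ℓ, ((w.1 : ℕ) = ℓ / 2 ∨ (w.2 : ℕ) = ℓ / 2) ∧
    (gridGraph ℓ ℓ).dist v w ≤ 1}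

instance (ℓ : ℕ) : Fintype (plusSet ℓ) := Fintype.ofFinite _

/-- The plus-shaped graph: the subgraph of the `ℓ × ℓ` grid induced by `plusSet ℓ`. -/
def plusGraph (ℓ : ℕ) : SimpleGraph (plusSet ℓ) := (gridGraph ℓ ℓ).induce (plusSet ℓ)

section Graph

variable {V : Type*} [Fintype V]

/-- The bandwidth of `G`: the minimum over all labelings of the vertices by `n = |V|` consecutive
integers of the maximum difference of the labels of adjacent vertices. -/
def bandwidth (G : SimpleGraph V) : ℕ :=
  sInf {b : ℕ | ∃ σ : V ≃ Fin (Fintype.card V),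
    ∀ u v, G.Adj u v → |((σ u : ℕ) : ℤ) - ((σ v : ℕ) : ℤ)| ≤ (b : ℤ)}

/-- The set `A` of vertices is empty or induces a connected subgraph of `G`. -/
def IsContiguous (G : SimpleGraph V) (A : Set V) : Prop := (G.induce A).Preconnected

/-! ### Glauber dynamics on connected colorings -/

/-- Connected `q`-colorings: every color class is empty or induces a connected subgraph. -/
def ConnColoring (G : SimpleGraph V) (q : ℕ) : Type _ :=
  {ω : V → Fin q // ∀ i, IsContiguous G {v | ω v = i}}

instance (G : SimpleGraph V) (q : ℕ) : Fintype (ConnColoring G q) :=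
  @Fintype.ofFinite _ Subtype.finite

instance (G : SimpleGraph V) (q : ℕ) : DecidableEq (ConnColoring G q) := Classical.decEq _

open Classical in
/-- Recolor `v` with color `i` if this gives a connected coloring; otherwise do nothing. -/
def colorStep (G : SimpleGraph V) {q : ℕ} (ω : ConnColoring G q) (v : V) (i : Fin q) :
    ConnColoring G q :=
  if h : ∀ j, IsContiguous G {u | Function.update ω.1 v i u = j} then
    ⟨Function.update ω.1 v i, h⟩ else ω

/-- Glauber dynamics on connected `q`-colorings: `v` and `i` are chosen uniformly at random. -/
def colorChain (G : SimpleGraph V) (q : ℕ) :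
    Matrix (ConnColoring G q) (ConnColoring G q) ℝ :=
  fun ω ω' => ∑ v : V, ∑ i : Fin q,
    (1 / (Fintype.card V : ℝ)) * (1 / (q : ℝ)) * if colorStep G ω v i = ω' then 1 else 0

/-! ### Glauber dynamics on contiguous 2-partitions -/

open Classical in
/-- `p` is an (unordered) partition of the vertex set into two contiguous pieces, one of which may
be empty. -/
def IsContigTwoPartition (G : SimpleGraph V) (p : Finset (Finset V)) : Prop :=
  ∃ A : Finset V, p = {A, Aᶜ} ∧ ∀ D ∈ p, IsContiguous G (D : Set V)

/-- The state space of contiguous 2-partitions of `G`. -/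
def ContigTwoPartition (G : SimpleGraph V) : Type _ :=
  {p : Finset (Finset V) // IsContigTwoPartition G p}

instance (G : SimpleGraph V) : Fintype (ContigTwoPartition G) :=
  @Fintype.ofFinite _ Subtype.finite

instance (G : SimpleGraph V) : DecidableEq (ContigTwoPartition G) := Classical.decEq _

open Classical in
/-- Remove `v` from its current piece and make it a member of the piece `D`. -/
def moveTo (p : Finset (Finset V)) (v : V) (D : Finset V) : Finset (Finset V) :=
  p.image fun A => if A = D then insert v A else A.erase v

open Classical in
/-- Move `v` to the piece `D` if this gives a contiguous 2-partition; otherwise do nothing. -/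
def partitionStep (G : SimpleGraph V) (p : ContigTwoPartition G) (v : V) (D : Finset V) :
    ContigTwoPartition G :=
  if h : IsContigTwoPartition G (moveTo p.1 v D) then ⟨moveTo p.1 v D, h⟩ else p

/-- Glauber dynamics on contiguous 2-partitions: a vertex `v` and a piece `D` of the current
partition are chosen uniformly at random. -/
def partitionChain (G : SimpleGraph V) :
    Matrix (ContigTwoPartition G) (ContigTwoPartition G) ℝ :=
  fun p p' => ∑ v : V, ∑ D ∈ p.1,
    (1 / (Fintype.card V : ℝ)) * (1 / (p.1.card : ℝ)) *
      if partitionStep G p v D = p' then 1 else 0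

end Graph

end ConnPart

end

noncomputable section

namespace ConnPart

/-! ### Symmetric finite chains -/

section SymmChain

variable {Ω : Type*} [Fintype Ω] [DecidableEq Ω]

/-! Both chains are symmetric and lazy, so the uniform law is stationary and ergodicity amounts to
reaching one fixed state. In a connected graph without cut vertices one can always remove a vertex
from a nonempty contiguous set with contiguous complement and keep both sides contiguous
(`isPeelable_of_forall_compl_singleton`). Peeling one side away leads every state to the trivial
one. The path `3 × 1` and the one-vertex plus are treated separately.

Slow mixing is a bottleneck argument. A symmetric stochastic matrix has column sums `1`, so unit
masses placed on a region `S` lose at most `|C|` per step through a cut set `C` (`sum_exit_le`).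
Hence the mixing time is at least of order `|S| / |C|`, where `S` is the side of the cut with at
most half of the states.

The geometric input is planar duality. In a simply connected piece of the square lattice whose two
color classes are connected, the bichromatic edges form a single domain wall, for otherwise the
indicator of one wall component would be a mod 2 cocycle that is not a coboundary
(`wallGraph_preconnected`). The wall graph is connected with degrees at most two, and at most one at
outer edges. Counting edges shows that at most two outer edges are bichromatic
(`card_outer_cutEdges_le`).

On the `3 × ℓ` grid, columns whose ends carry the colors in opposite orders would force three
changes along the boundary (`IsStrip.not_opposite`). So the two orders define disjoint regions, and
to pass from one to the other the chain must visit a state in which every column has equal ends. In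
such a state the outer rows have at most two changes each, and the middle row has few changes
because a monochromatic column separates the strip. These states are polynomially many, while two
constant outer rows of different colors leave the middle row free and give `2 ^ ℓ` states on each
side.

On the plus, an arm with a column of unequal ends uses up a boundary change, so at most two arms are
split. A move affects only one arm, so the pair of split arms cannot be exchanged for another pair
without visiting a state with at most one split arm (`pair_subset_of_forall_mem_iff`). There only
the middle row of one arm is unrestricted, which gives about `2 ^ (ℓ / 2)` states up to a
polynomial, against `2 ^ ℓ` on either side. -/

theorem pow_nonneg_apply {P : Matrix Ω Ω ℝ} (h : P ∈ Matrix.rowStochastic ℝ Ω) (t : ℕ) (x y : Ω) :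
    0 ≤ (P ^ t) x y :=
  Matrix.nonneg_of_mem_rowStochastic (pow_mem h t)

theorem pow_sum_row {P : Matrix Ω Ω ℝ} (h : P ∈ Matrix.rowStochastic ℝ Ω) (t : ℕ) (x : Ω) :
    ∑ y, (P ^ t) x y = 1 :=
  Matrix.sum_row_of_mem_rowStochastic (pow_mem h t) x

theorem pow_sum_col {P : Matrix Ω Ω ℝ} (h : P ∈ Matrix.rowStochastic ℝ Ω) (hs : P.IsSymm)
    (t : ℕ) (y : Ω) : ∑ x, (P ^ t) x y = 1 := by
  rw [← pow_sum_row h t y]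
  exact Finset.sum_congr rfl fun x _ => (hs.pow t).apply y x

theorem exists_pow_pos_of_reflTransGen {P : Matrix Ω Ω ℝ} (h : P ∈ Matrix.rowStochastic ℝ Ω)
    {x y : Ω} (hxy : Relation.ReflTransGen (fun a b => 0 < P a b) x y) :
    ∃ t, 0 < (P ^ t) x y := by
  induction hxy with
  | refl => exact ⟨0, by simp⟩
  | @tail b c _ hbc ih =>
    obtain ⟨t, ht⟩ := ih
    refine ⟨t + 1, ?_⟩
    rw [pow_succ, Matrix.mul_apply]
    exact lt_of_lt_of_le (mul_pos ht hbc)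
      (Finset.single_le_sum (f := fun z => (P ^ t) x z * P z c)
        (fun z _ => mul_nonneg (pow_nonneg_apply h t x z)
          (Matrix.nonneg_of_mem_rowStochastic h)) (Finset.mem_univ b))

/-- Laziness allows waiting at the endpoint, so one exponent can serve all pairs of states at once.
-/
theorem pow_pos_mono {P : Matrix Ω Ω ℝ} (h : P ∈ Matrix.rowStochastic ℝ Ω)
    (hd : ∀ x, 0 < P x x) {x y : Ω} {s t : ℕ} (hst : s ≤ t) (hs : 0 < (P ^ s) x y) :
    0 < (P ^ t) x y := by
  induction t, hst using Nat.le_induction with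
  | base => exact hs
  | succ t _ ih =>
    rw [pow_succ, Matrix.mul_apply]
    exact lt_of_lt_of_le (mul_pos ih (hd y))
      (Finset.single_le_sum (f := fun z => (P ^ t) x z * P z y)
        (fun z _ => mul_nonneg (pow_nonneg_apply h t x z)
          (Matrix.nonneg_of_mem_rowStochastic h)) (Finset.mem_univ y))

/-- A symmetric stochastic matrix with positive diagonal, all of whose states can reach a common
state, is ergodic with uniform stationary distribution. -/
theorem isErgodicChain_of_isSymm {P : Matrix Ω Ω ℝ} (h : P ∈ Matrix.rowStochastic ℝ Ω)
    (hs : P.IsSymm) (hd : ∀ x, 0 < P x x) (o : Ω)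
    (ho : ∀ x, Relation.ReflTransGen (fun a b => 0 < P a b) x o) :
    IsErgodicChain P (uniformDist Ω) := by
  refine ⟨h, ⟨fun i j => Matrix.nonneg_of_mem_rowStochastic h, ?_⟩, ?_⟩
  · have key : ∀ q : Ω × Ω, ∃ t, 0 < (P ^ t) q.1 q.2 := by
      rintro ⟨x, y⟩
      refine exists_pow_pos_of_reflTransGen h ((ho x).trans ?_)
      -- By symmetry of `P`, the path from `y` to `o` can be traversed backwards.
      refine Relation.ReflTransGen.mono (fun a b hab => ?_) _ _ (ho y).swap
      have hab' : 0 < P b a := hab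
      exact hab'.trans_eq (hs.apply a b)
    choose T hT using key
    -- The successor makes the exponent positive, as primitivity requires.
    refine ⟨(Finset.univ.sup T) + 1, Nat.succ_pos _, fun i j => ?_⟩
    exact pow_pos_mono h hd ((Finset.le_sup (f := T) (Finset.mem_univ (i, j))).trans
      (Nat.le_succ _)) (hT (i, j))
  · funext y
    have := pow_sum_col h hs 1 y
    simp only [pow_one] at this
    simp only [Matrix.vecMul, dotProduct, uniformDist]
    rw [← Finset.mul_sum, this, mul_one]

/-- Over `t` steps, at most `t * |C|` of the mass started in `S` (unit mass at each state of `S`)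
has left `S`, if every exit from `S` leads into `C`. -/
theorem sum_exit_le {P : Matrix Ω Ω ℝ} (h : P ∈ Matrix.rowStochastic ℝ Ω) (hs : P.IsSymm)
    (S C : Finset Ω) (hSC : ∀ x ∈ S, ∀ y ∈ (S ∪ C)ᶜ, P x y = 0) (t : ℕ) :
    ∑ x ∈ S, ∑ y ∈ Sᶜ, (P ^ t) x y ≤ t * C.card := by
  have hP : ∀ x y, 0 ≤ P x y := fun x y => Matrix.nonneg_of_mem_rowStochastic h
  induction t with
  | zero =>
    refine le_of_eq ?_
    simp only [pow_zero, Nat.cast_zero, zero_mul]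
    refine Finset.sum_eq_zero fun x hx => Finset.sum_eq_zero fun y hy => ?_
    rw [Matrix.one_apply_ne]
    rintro rfl
    exact (Finset.mem_compl.1 hy) hx
  | succ t ih =>
    have e1 : ∀ x, ∑ y ∈ Sᶜ, (P ^ (t + 1)) x y
        = ∑ z, (P ^ t) x z * ∑ y ∈ Sᶜ, P z y := by
      intro x
      simp only [pow_succ, Matrix.mul_apply, Finset.mul_sum]
      exact Finset.sum_comm
    have e2 : ∀ z, ∑ y ∈ Sᶜ, P z y ≤ 1 := fun z => by
      rw [← Matrix.sum_row_of_mem_rowStochastic h z]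
      exact Finset.sum_le_sum_of_subset_of_nonneg (Finset.subset_univ _) fun y _ _ => hP z y
    have e3 : ∀ z ∈ S, ∑ y ∈ Sᶜ, P z y ≤ ∑ y ∈ C, P z y := by
      intro z hz
      calc ∑ y ∈ Sᶜ, P z y = ∑ y ∈ Sᶜ ∩ C, P z y := by
            symm
            refine Finset.sum_subset Finset.inter_subset_left fun y hy hy' => hSC z hz y ?_
            simp only [Finset.mem_inter, Finset.mem_compl, Finset.mem_union] at *
            tauto
        _ ≤ _ := Finset.sum_le_sum_of_subset_of_nonneg Finset.inter_subset_right
            fun y _ _ => hP z y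
    -- Split according to the position at time `t`: mass already outside is bounded by induction,
    -- and mass still in `S` can only leave into `C`.
    have e4 : ∑ x ∈ S, ∑ y ∈ Sᶜ, (P ^ (t + 1)) x y
        = (∑ x ∈ S, ∑ z ∈ Sᶜ, (P ^ t) x z * ∑ y ∈ Sᶜ, P z y)
          + ∑ x ∈ S, ∑ z ∈ S, (P ^ t) x z * ∑ y ∈ Sᶜ, P z y := by
      rw [← Finset.sum_add_distrib]
      refine Finset.sum_congr rfl fun x _ => ?_
      rw [e1, add_comm, Finset.sum_add_sum_compl]
    have e5 : (∑ x ∈ S, ∑ z ∈ Sᶜ, (P ^ t) x z * ∑ y ∈ Sᶜ, P z y)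
        ≤ ∑ x ∈ S, ∑ z ∈ Sᶜ, (P ^ t) x z :=
      Finset.sum_le_sum fun x _ => Finset.sum_le_sum fun z _ =>
        mul_le_of_le_one_right (pow_nonneg_apply h t x z) (e2 z)
    have e6 : (∑ x ∈ S, ∑ z ∈ S, (P ^ t) x z * ∑ y ∈ Sᶜ, P z y) ≤ C.card := by
      rw [Finset.sum_comm]
      calc _ ≤ ∑ z ∈ S, ∑ y ∈ C, P z y := by
            refine Finset.sum_le_sum fun z hz => ?_
            rw [← Finset.sum_mul]
            refine le_trans (mul_le_of_le_one_left (Finset.sum_nonneg fun y _ => hP z y) ?_)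
              (e3 z hz)
            -- Double stochasticity: unit masses started on `S` put at most mass one on any state at
            -- any time. The same bound for one step limits the inflow to each state of `C`.
            rw [← pow_sum_col h hs t z]
            exact Finset.sum_le_sum_of_subset_of_nonneg (Finset.subset_univ _)
              fun x _ _ => pow_nonneg_apply h t x z
        _ = ∑ y ∈ C, ∑ z ∈ S, P z y := Finset.sum_comm
        _ ≤ ∑ y ∈ C, 1 := by
            refine Finset.sum_le_sum fun y _ => ?_
            have := pow_sum_col h hs 1 y
            rw [pow_one] at this
            rw [← this]
            exact Finset.sum_le_sum_of_subset_of_nonneg (Finset.subset_univ _)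
              fun x _ _ => hP x y
        _ = C.card := by simp
    rw [e4]
    push_cast
    linarith

/-- Since both masses are `1`, the deficit of `μ` on `T` equals its excess on the complement. Each
is bounded by its share of the `ℓ¹` norm, which absorbs the factor `1 / 2`. -/
theorem sub_le_tvDist (μ ν : Ω → ℝ) (hμ : ∑ x, μ x = 1) (hν : ∑ x, ν x = 1) (T : Finset Ω) :
    ∑ x ∈ T, ν x - ∑ x ∈ T, μ x ≤ tvDist μ ν := by
  have h1 : ∑ x ∈ T, ν x - ∑ x ∈ T, μ x ≤ ∑ x ∈ T, |μ x - ν x| := by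
    rw [← Finset.sum_sub_distrib]
    exact Finset.sum_le_sum fun x _ => by rw [abs_sub_comm]; exact le_abs_self _
  have h2 : ∑ x ∈ Tᶜ, μ x - ∑ x ∈ Tᶜ, ν x ≤ ∑ x ∈ Tᶜ, |μ x - ν x| := by
    rw [← Finset.sum_sub_distrib]
    exact Finset.sum_le_sum fun x _ => le_abs_self _
  have h3 := Finset.sum_add_sum_compl T μ
  have h4 := Finset.sum_add_sum_compl T ν
  have h5 := Finset.sum_add_sum_compl T fun x => |μ x - ν x|
  unfold tvDist
  linarith

/-- If a set `S` of at most half of the states can only be left through `C`, then the chain has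
not mixed before time of order `|S| / |C|`. -/
theorem le_worstDist {P : Matrix Ω Ω ℝ} (h : P ∈ Matrix.rowStochastic ℝ Ω) (hs : P.IsSymm)
    (S C : Finset Ω) (hSC : ∀ x ∈ S, ∀ y ∈ (S ∪ C)ᶜ, P x y = 0) (hS : 0 < S.card)
    (hhalf : 2 * S.card ≤ Fintype.card Ω) (t : ℕ) :
    1 / 2 - t * C.card / S.card ≤ worstDist P (uniformDist Ω) t := by
  have hS' : (0 : ℝ) < S.card := by exact_mod_cast hS
  have hN : (0 : ℝ) < Fintype.card Ω := by
    have : 0 < Fintype.card Ω := by omega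
    exact_mod_cast this
  obtain ⟨x, hx, hle⟩ : ∃ x ∈ S, ∑ y ∈ Sᶜ, (P ^ t) x y ≤ t * C.card / S.card := by
    -- Averaging over the starting states in `S` produces one from which little mass escapes.
    by_contra! hcon
    have := Finset.sum_lt_sum_of_nonempty (Finset.card_pos.1 hS) hcon
    rw [Finset.sum_const, nsmul_eq_mul, mul_div_cancel₀ _ hS'.ne'] at this
    exact absurd (sum_exit_le h hs S C hSC t) (not_le.2 this)
  have hu : ∑ y, uniformDist Ω y = 1 := by
    simp only [uniformDist, Finset.sum_const, Finset.card_univ, nsmul_eq_mul]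
    field_simp
  have huc : (1 : ℝ) / 2 ≤ ∑ y ∈ Sᶜ, uniformDist Ω y := by
    simp only [uniformDist, Finset.sum_const, nsmul_eq_mul]
    rw [mul_one_div, le_div_iff₀ hN]
    have h1 := Finset.card_add_card_compl S
    have h2 : (Fintype.card Ω : ℝ) ≤ 2 * (Sᶜ.card : ℝ) := by
      have : Fintype.card Ω ≤ 2 * Sᶜ.card := by omega
      exact_mod_cast this
    linarith
  have h3 := sub_le_tvDist ((P ^ t) x) (uniformDist Ω) (pow_sum_row h t x) hu Sᶜ
  have h4 : tvDist ((P ^ t) x) (uniformDist Ω) ≤ worstDist P (uniformDist Ω) t :=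
    le_ciSup (f := fun x => tvDist ((P ^ t) x) (uniformDist Ω)) (Set.finite_range _).bddAbove x
  linarith

/-- The separation is symmetric and `S` and the remaining states are disjoint, so one of the two has
at most half of all states. `le_worstDist` applies to that one. -/
theorem HasBottleneck.mul_le {P : Matrix Ω Ω ℝ} {s b : ℝ} (hB : HasBottleneck P s b)
    (h : P ∈ Matrix.rowStochastic ℝ Ω) (hs : P.IsSymm) (hs0 : 0 < s) {δ : ℝ} {t : ℕ}
    (ht : worstDist P (uniformDist Ω) t ≤ δ) : (1 / 2 - δ) * s ≤ t * b := by
  obtain ⟨S, C, hd, hSC, hS, hR, hC⟩ := hB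
  have key : ∀ S' : Finset Ω, (∀ x ∈ S', ∀ y ∈ (S' ∪ C)ᶜ, P x y = 0) → s ≤ S'.card →
      2 * S'.card ≤ Fintype.card Ω → (1 / 2 - δ) * s ≤ t * b := by
    intro S' h1 h2 h3
    have hpos : (0 : ℝ) < S'.card := hs0.trans_le h2
    have h4 := le_worstDist h hs S' C h1 (by exact_mod_cast hpos) h3 t
    have h5 : 1 / 2 - δ ≤ t * C.card / S'.card := by linarith
    rw [le_div_iff₀ hpos] at h5
    have h6 : (t : ℝ) * C.card ≤ t * b := mul_le_mul_of_nonneg_left hC (Nat.cast_nonneg t)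
    rcases le_total (1 / 2 - δ) 0 with h7 | h7
    · exact (mul_nonpos_of_nonpos_of_nonneg h7 hs0.le).trans
        (le_trans (by positivity) h6)
    · exact (mul_le_mul_of_nonneg_left h2 h7).trans (h5.trans h6)
  have hcard := Finset.card_add_card_compl (S ∪ C)
  have hun := Finset.card_union_of_disjoint hd
  rcases le_total (2 * S.card) (Fintype.card Ω) with h1 | h1
  · exact key S (fun x hx y hy => (hSC x hx y hy).1) hS h1
  · refine key (S ∪ C)ᶜ (fun x hx y hy => ?_) hR (by omega)
    simp only [Finset.mem_compl, Finset.mem_union, not_or] at hx hy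
    refine (hSC y ?_ x ?_).2
    · tauto
    · simpa using hx

theorem HasBottleneck.le_mixingTime {P : Matrix Ω Ω ℝ} {s b : ℝ} (hB : HasBottleneck P s b)
    (h : P ∈ Matrix.rowStochastic ℝ Ω) (hs : P.IsSymm) (hs0 : 0 < s) (hb : 0 < b) {δ T : ℝ}
    (hT : T * b ≤ (1 / 2 - δ) * s) :
    ENNReal.ofReal T ≤ ((mixingTime P (uniformDist Ω) δ : ℕ∞) : ℝ≥0∞) := by
  have h1 : ((⌈T⌉₊ : ℕ) : ℕ∞) ≤ mixingTime P (uniformDist Ω) δ := by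
    refine le_sInf ?_
    rintro _ ⟨t, ht, rfl⟩
    have h2 := hB.mul_le h hs hs0 ht
    have h3 : T ≤ t := le_of_mul_le_mul_right (hT.trans h2) hb
    exact Nat.cast_le.2 (Nat.ceil_le.2 h3)
  calc ENNReal.ofReal T ≤ ENNReal.ofReal (⌈T⌉₊ : ℝ) := ENNReal.ofReal_le_ofReal (Nat.le_ceil T)
    _ = (((⌈T⌉₊ : ℕ) : ℕ∞) : ℝ≥0∞) := by simp
    _ ≤ _ := ENat.toENNReal_le.2 h1

end SymmChain

/-- An exponential eventually dominates a polynomial times a smaller exponential. -/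
theorem exists_forall_mul_pow_mul_exp_le (K ε a b : ℝ) (k : ℕ) (hε : 0 < ε) (hab : a < b) :
    ∃ n₀ : ℕ, ∀ n : ℕ, n₀ ≤ n →
      K * (n : ℝ) ^ k * Real.exp (a * n) ≤ ε * Real.exp (b * n) := by
  have h1 : Filter.Tendsto (fun x : ℝ => x ^ k * Real.exp (-(b - a) * x)) Filter.atTop (nhds 0) := by
    have := Real.tendsto_pow_mul_exp_neg_atTop_nhds_zero k
    have h2 : Filter.Tendsto (fun x : ℝ => (b - a) * x) Filter.atTop Filter.atTop :=
      Filter.tendsto_id.const_mul_atTop (sub_pos.2 hab)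
    have h3 := (this.comp h2).const_mul ((b - a) ^ k)⁻¹
    rw [mul_zero] at h3
    refine h3.congr fun x => ?_
    have : (b - a) ^ k ≠ 0 := pow_ne_zero _ (sub_pos.2 hab).ne'
    simp only [Function.comp, mul_pow]
    rw [neg_mul]
    field_simp
  have h2 := (h1.const_mul K).comp tendsto_natCast_atTop_atTop
  rw [mul_zero] at h2
  obtain ⟨n₀, hn⟩ := Filter.eventually_atTop.1 (h2.eventually_lt_const hε)
  refine ⟨n₀, fun n hnn => ?_⟩
  have h3 := hn n hnn
  simp only [Function.comp] at h3
  have h4 : Real.exp (a * n) = Real.exp (-(b - a) * n) * Real.exp (b * n) := by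
    rw [← Real.exp_add]; ring_nf
  rw [h4]
  calc _ = (K * ((n : ℝ) ^ k * Real.exp (-(b - a) * n))) * Real.exp (b * n) := by ring
    _ ≤ _ := mul_le_mul_of_nonneg_right h3.le (Real.exp_pos _).le

/-! ### Contiguous sets -/

section Contiguous

variable {V : Type*} {G : SimpleGraph V}

/-- A set is contiguous iff it has no proper nonempty subset closed under adjacency. -/
theorem isContiguous_iff {A : Set V} : IsContiguous G A ↔
    ∀ X : Set V, X ⊆ A → X.Nonempty → (∀ u ∈ X, ∀ w ∈ A, G.Adj u w → w ∈ X) → A ⊆ X := by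
  constructor
  · rintro h X hXA ⟨x, hx⟩ hcl a ha
    obtain ⟨p⟩ := h ⟨x, hXA hx⟩ ⟨a, ha⟩
    have : ∀ (u w : A), (G.induce A).Walk u w → u.1 ∈ X → w.1 ∈ X := by
      intro u w p
      induction p with
      | nil => exact id
      | @cons u v w huv _ ih => exact fun hu => ih (hcl _ hu _ v.2 huv)
    exact this _ _ p hx
  · rintro h ⟨x, hx⟩ ⟨y, hy⟩
    have := h {w | ∃ hw : w ∈ A, (G.induce A).Reachable ⟨x, hx⟩ ⟨w, hw⟩}
      (fun w hw => hw.1) ⟨x, hx, SimpleGraph.Reachable.refl _⟩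
      (fun u hu w hw huw => ⟨hw, hu.2.trans (SimpleGraph.Adj.reachable (by simpa using huw))⟩) hy
    exact this.2

theorem IsContiguous.eq_of_forall_adj {A : Set V} (h : IsContiguous G A) {α : Type*} {f : V → α}
    (hf : ∀ u ∈ A, ∀ w ∈ A, G.Adj u w → f u = f w) {u w : V} (hu : u ∈ A) (hw : w ∈ A) :
    f u = f w :=
  (isContiguous_iff.1 h {z | z ∈ A ∧ f u = f z} (fun _ hz => hz.1) ⟨u, hu, rfl⟩
    (fun x hx y hy hxy => ⟨hy, hx.2.trans (hf x hx.1 y hy hxy)⟩) hw).2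

/-- Connectivity is tested on locally constant functions. This is the form in which it is exchanged
with `HasConnClasses` and with functions on lattice points. -/
theorem isContiguous_of_forall {A : Set V}
    (h : ∀ f : V → Prop, (∀ u ∈ A, ∀ w ∈ A, G.Adj u w → f u = f w) →
      ∀ u ∈ A, ∀ w ∈ A, f u = f w) : IsContiguous G A := by
  refine isContiguous_iff.2 fun X hXA ⟨x, hx⟩ hcl a ha => ?_
  have := h (· ∈ X) (fun u hu w hw huw => propext
    ⟨fun h => hcl u h w hw huw, fun h => hcl w h u hu huw.symm⟩) x (hXA hx) a ha
  exact this.mp hx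

theorem isContiguous_of_subsingleton {A : Set V} (h : A.Subsingleton) : IsContiguous G A :=
  isContiguous_iff.2 fun _ hXA ⟨_, hx⟩ _ _ ha => by rwa [h ha (hXA hx)]

/-- A set in which every vertex other than `o` has a neighbor of smaller rank is contiguous. -/
theorem isContiguous_of_rank {A : Set V} (o : V) (ρ : V → ℕ)
    (h : ∀ u ∈ A, u = o ∨ ∃ w ∈ A, G.Adj u w ∧ ρ w < ρ u) : IsContiguous G A := by
  refine isContiguous_of_forall fun f hf => ?_
  have key : ∀ n, ∀ u ∈ A, ρ u = n → f u = f o := by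
    intro n
    induction n using Nat.strong_induction_on with
    | _ n ih =>
      intro u hu hn
      rcases h u hu with rfl | ⟨w, hw, huw, hlt⟩
      · rfl
      · rw [hf u hu w hw huw]
        exact ih _ (hn ▸ hlt) w hw rfl
  intro u hu w hw
  rw [key _ u hu rfl, key _ w hw rfl]

theorem IsContiguous.insert {B : Set V} (h : IsContiguous G B) {v z : V} (hz : z ∈ B)
    (hvz : G.Adj v z) : IsContiguous G (insert v B) := by
  refine isContiguous_of_forall fun f hf => ?_
  have h1 : ∀ u ∈ B, f u = f z := fun u hu =>
    h.eq_of_forall_adj (fun a ha b hb => hf a (Or.inr ha) b (Or.inr hb)) hu hz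
  have h2 : ∀ u ∈ Insert.insert v B, f u = f z := by
    rintro u (rfl | hu)
    · exact hf _ (Or.inl rfl) _ (Or.inr hz) hvz
    · exact h1 u hu
  intro u hu w hw
  rw [h2 u hu, h2 w hw]

/-- `A` and its complement are contiguous. -/
def IsSplit (G : SimpleGraph V) (A : Set V) : Prop := IsContiguous G A ∧ IsContiguous G Aᶜ

/-- From every contiguous set with contiguous complement one can remove a vertex, keeping both
sides contiguous. -/
def IsPeelable (G : SimpleGraph V) : Prop :=
  ∀ A : Set V, IsSplit G A → A.Nonempty → ∃ v ∈ A, IsSplit G (A \ {v})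

theorem compl_sdiff_singleton (A : Set V) {v : V} : (A \ {v})ᶜ = insert v Aᶜ := by
  ext u; simp only [Set.mem_compl_iff, Set.mem_sdiff, Set.mem_singleton_iff, Set.mem_insert_iff]
  tauto

theorem isSplit_empty (h1 : IsContiguous G Set.univ) : IsSplit G ∅ :=
  ⟨isContiguous_of_subsingleton Set.subsingleton_empty, by simpa using h1⟩

variable [Finite V]

/-- A connected graph without cut vertices is peelable. -/
theorem isPeelable_of_forall_compl_singleton (h1 : IsContiguous G Set.univ)
    (h2 : ∀ v : V, IsContiguous G {v}ᶜ) : IsPeelable G := by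
  rintro A ⟨hA, hB⟩ ⟨a, ha⟩
  by_cases hne : (Aᶜ : Set V).Nonempty
  swap
  · have hAu : A = Set.univ := by
      rw [Set.not_nonempty_iff_eq_empty, Set.compl_empty_iff] at hne; exact hne
    refine ⟨a, ha, ?_, ?_⟩
    · rw [hAu, ← Set.compl_eq_univ_sdiff]; exact h2 a
    · rw [compl_sdiff_singleton]
      refine isContiguous_of_subsingleton ?_
      rw [hAu]; simp
  have good : ∀ v ∈ A, ∀ z ∈ (Aᶜ : Set V), G.Adj v z → IsContiguous G (A \ {v}) →
      IsSplit G (A \ {v}) := fun v _ z hz hvz h =>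
    ⟨h, by rw [compl_sdiff_singleton]; exact hB.insert hz hvz⟩
  -- Descent on a union `C` of some, but not all, components of `A \ {v}`. As `v` is no cut vertex
  -- of `G`, some `w ∈ C` is adjacent to the complement of `A`. If removing `w` disconnects `A`,
  -- then a part of `A \ {w}` missing `v` is strictly smaller than `C` and takes its place.
  have key : ∀ n, ∀ v ∈ A, ∀ C : Set V, C.ncard = n → C ⊆ A \ {v} → C.Nonempty →
      (∀ u ∈ C, ∀ w ∈ A \ {v}, G.Adj u w → w ∈ C) → ¬ A \ {v} ⊆ C →
      ∃ w ∈ A, IsSplit G (A \ {w}) := by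
    intro n
    induction n using Nat.strong_induction_on with
    | _ n ih =>
      intro v hv C hn hCA hCne hcl hproper
      obtain ⟨w, hwC, z, hz, hwz, hzC⟩ : ∃ w ∈ C, ∃ z ∈ ({v}ᶜ : Set V), G.Adj w z ∧ z ∉ C := by
        by_contra! hcon
        exact hproper fun u hu => isContiguous_iff.1 (h2 v) C (fun u hu => (hCA hu).2) hCne
          (fun u hu w hw huw => hcon u hu w hw huw) hu.2
      have hwA : w ∈ A := (hCA hwC).1
      have hzA : z ∉ A := fun h => hzC (hcl w hwC z ⟨h, hz⟩ hwz)
      by_cases hcon : IsContiguous G (A \ {w})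
      · exact ⟨w, hwA, good w hwA z hzA hwz hcon⟩
      rw [isContiguous_iff] at hcon
      push Not at hcon
      obtain ⟨X, hXA, hXne, hXcl, hX⟩ := hcon
      -- Of the two sides of `A \ {w}`, take the one that does not contain `v`.
      obtain ⟨Y, hYA, hYne, hYcl, hY, hvY⟩ : ∃ Y ⊆ A \ {w}, Y.Nonempty ∧
          (∀ u ∈ Y, ∀ x ∈ A \ {w}, G.Adj u x → x ∈ Y) ∧ ¬ A \ {w} ⊆ Y ∧ v ∉ Y := by
        by_cases hvX : v ∈ X
        · refine ⟨(A \ {w}) \ X, Set.sdiff_subset, ?_, ?_, ?_, fun h => h.2 hvX⟩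
          · obtain ⟨u, hu, hu'⟩ := Set.not_subset.1 hX
            exact ⟨u, hu, hu'⟩
          · exact fun u hu x hx hux => ⟨hx, fun hxX => hu.2 (hXcl x hxX u hu.1 hux.symm)⟩
          · obtain ⟨u, hu⟩ := hXne
            exact fun h => (h (hXA hu)).2 hu
        · exact ⟨X, hXA, hXne, hXcl, hX, hvX⟩
      -- Otherwise `Y \ C` would be nonempty and closed under adjacency in `A`, although it misses
      -- `w`.
      have hYC : Y ⊆ C := by
        by_contra hYC
        obtain ⟨y, hy, hyC⟩ := Set.not_subset.1 hYC
        have := isContiguous_iff.1 hA (Y \ C) (fun u hu => (hYA hu.1).1) ⟨y, hy, hyC⟩ ?_ hwA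
        · exact this.2 hwC
        · rintro u ⟨huY, huC⟩ x hx hux
          have huv : u ∈ A \ {v} := ⟨(hYA huY).1, fun h => hvY (h ▸ huY)⟩
          have hxC : x ∉ C := fun h => huC (hcl x h u huv hux.symm)
          exact ⟨hYcl u huY x ⟨hx, fun h => hxC (h ▸ hwC)⟩ hux, hxC⟩
      have hlt : Y.ncard < C.ncard :=
        Set.ncard_lt_ncard ⟨hYC, fun h => (hYA (h hwC)).2 rfl⟩ (Set.toFinite C)
      exact ih _ (hn ▸ hlt) w hwA Y rfl hYA hYne hYcl hY
  obtain ⟨v, hv, z, hz, hvz⟩ : ∃ v ∈ A, ∃ z ∈ (Aᶜ : Set V), G.Adj v z := by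
    by_contra! hcon
    obtain ⟨b, hb⟩ := hne
    exact hb (isContiguous_iff.1 h1 A (Set.subset_univ _) ⟨a, ha⟩
      (fun u hu w _ huw => by_contra fun hw => hcon u hu w hw huw) (Set.mem_univ b))
  by_cases hcon : IsContiguous G (A \ {v})
  · exact ⟨v, hv, good v hv z hz hvz hcon⟩
  rw [isContiguous_iff] at hcon
  push Not at hcon
  obtain ⟨X, hXA, hXne, hXcl, hX⟩ := hcon
  exact key _ v hv X rfl hXA hXne hXcl hX

theorem IsPeelable.induction (h : IsPeelable G) {Q : Set V → Prop} (h0 : Q ∅)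
    (hstep : ∀ A : Set V, ∀ v ∈ A, IsSplit G A → IsSplit G (A \ {v}) → Q (A \ {v}) → Q A) :
    ∀ A : Set V, IsSplit G A → Q A := by
  have key : ∀ n, ∀ A : Set V, A.ncard = n → IsSplit G A → Q A := by
    intro n
    induction n using Nat.strong_induction_on with
    | _ n ih =>
      intro A hn hA
      rcases A.eq_empty_or_nonempty with rfl | hne
      · exact h0
      · obtain ⟨v, hv, hs⟩ := h A hA hne
        exact hstep A v hv hA hs (ih _ (hn ▸ Set.ncard_sdiff_singleton_lt_of_mem hv) _ rfl hs)
  exact fun A => key _ A rfl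

end Contiguous

/-! ### The color chain -/

section ColorChain

variable {V : Type*} {G : SimpleGraph V}

theorem ConnColoring.ext {ω ω' : ConnColoring G 2} (h : ∀ v, ω.1 v = ω'.1 v) : ω = ω' :=
  Subtype.ext (funext h)

theorem ConnColoring.isSplit (ω : ConnColoring G 2) : IsSplit G {v | ω.1 v = 0} := by
  refine ⟨ω.2 0, ?_⟩
  have : ({v | ω.1 v = 0}ᶜ : Set V) = {v | ω.1 v = 1} := by
    ext v
    simp only [Set.mem_compl_iff, Set.mem_ofPred_eq]
    omega
  rw [this]
  exact ω.2 1

open Classical in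
/-- The coloring with color class `A` for the color `0`. -/
def coloringOf (G : SimpleGraph V) (A : Set V) (h : IsSplit G A) : ConnColoring G 2 :=
  ⟨fun v => if v ∈ A then 0 else 1, by
    intro i
    fin_cases i
    · simpa using h.1
    · simpa [← Set.compl_def] using h.2⟩

theorem coloringOf_eq_zero {A : Set V} (h : IsSplit G A) (v : V) :
    (coloringOf G A h).1 v = 0 ↔ v ∈ A := by
  simp [coloringOf]

theorem coloringOf_class (ω : ConnColoring G 2) : coloringOf G _ ω.isSplit = ω := by
  refine ConnColoring.ext fun v => ?_
  have := coloringOf_eq_zero ω.isSplit v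
  simp only [Set.mem_ofPred_eq] at this
  omega

open Classical in
theorem colorStep_of_forall {ω : ConnColoring G 2} {v : V} {i : Fin 2}
    (h : ∀ j, IsContiguous G {u | Function.update ω.1 v i u = j}) :
    colorStep G ω v i = ⟨Function.update ω.1 v i, h⟩ := dif_pos h

open Classical in
theorem colorStep_of_not_forall {ω : ConnColoring G 2} {v : V} {i : Fin 2}
    (h : ¬ ∀ j, IsContiguous G {u | Function.update ω.1 v i u = j}) :
    colorStep G ω v i = ω := dif_neg h

/-- Between distinct states the rejected proposals play no role, so a transition becomes a relation
between two colorings. -/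
theorem colorStep_eq_iff {ω ω' : ConnColoring G 2} (hne : ω ≠ ω') (v : V) (i : Fin 2) :
    colorStep G ω v i = ω' ↔ ω'.1 v = i ∧ ∀ u, u ≠ v → ω.1 u = ω'.1 u := by
  classical
  constructor
  · intro h
    by_cases h1 : ∀ j, IsContiguous G {u | Function.update ω.1 v i u = j}
    · have h2 := h.symm.trans (colorStep_of_forall h1)
      rw [h2]
      exact ⟨Function.update_self v i ω.1, fun u hu => (Function.update_of_ne hu i ω.1).symm⟩
    · exact absurd ((colorStep_of_not_forall h1).symm.trans h) hne
  · rintro ⟨h1, h2⟩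
    have h3 : Function.update ω.1 v i = ω'.1 := by
      funext u
      rcases eq_or_ne u v with rfl | hu
      · rw [Function.update_self, h1]
      · rw [Function.update_of_ne hu, h2 u hu]
    have h4 : ∀ j, IsContiguous G {u | Function.update ω.1 v i u = j} := by
      rw [h3]; exact ω'.2
    exact (colorStep_of_forall h4).trans (Subtype.ext h3)

variable [Fintype V]

theorem colorChain_mem_rowStochastic [Nonempty V] :
    colorChain G 2 ∈ Matrix.rowStochastic ℝ (ConnColoring G 2) := by
  refine Matrix.mem_rowStochastic_iff_sum.2 ⟨fun ω ω' => ?_, fun ω => ?_⟩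
  · exact Finset.sum_nonneg fun v _ => Finset.sum_nonneg fun i _ => by split_ifs <;> positivity
  · simp only [colorChain]
    rw [Finset.sum_comm]
    have : ∀ v : V, ∑ ω' : ConnColoring G 2, ∑ i : Fin 2, (1 / (Fintype.card V : ℝ)) *
        (1 / ((2 : ℕ) : ℝ)) * (if colorStep G ω v i = ω' then (1 : ℝ) else 0)
        = 1 / (Fintype.card V : ℝ) := by
      intro v
      rw [Finset.sum_comm]
      simp only [← Finset.mul_sum, Finset.sum_ite_eq, Finset.mem_univ, if_true]
      simp
    rw [Finset.sum_congr rfl fun v _ => this v]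
    simp

-- Summing over the proposed color removes the only condition that is not symmetric in the two
-- states. Symmetry of the chain follows at once.
open Classical in
theorem sum_colorStep {ω ω' : ConnColoring G 2} (hne : ω ≠ ω') (v : V) :
    ∑ i : Fin 2, (if colorStep G ω v i = ω' then (1 : ℝ) else 0)
      = if ∀ u, u ≠ v → ω.1 u = ω'.1 u then 1 else 0 := by
  rw [Finset.sum_congr rfl fun i _ => if_congr (colorStep_eq_iff hne v i) rfl rfl]
  by_cases h : ∀ u, u ≠ v → ω.1 u = ω'.1 u
  · simp only [if_pos h, and_iff_left h]
    exact (Finset.sum_ite_eq Finset.univ (ω'.1 v) fun _ => (1 : ℝ)).trans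
      (if_pos (Finset.mem_univ _))
  · simp only [h, and_false, if_false, Finset.sum_const_zero]

theorem colorChain_isSymm : (colorChain G 2).IsSymm := by
  classical
  refine Matrix.IsSymm.ext fun ω ω' => ?_
  rcases eq_or_ne ω ω' with rfl | hne
  · rfl
  unfold colorChain
  refine Finset.sum_congr rfl fun v _ => ?_
  rw [← Finset.mul_sum, ← Finset.mul_sum, sum_colorStep hne, sum_colorStep hne.symm]
  congr 1
  exact if_congr (forall₂_congr fun _ _ => eq_comm) rfl rfl

theorem colorChain_pos [Nonempty V] {ω ω' : ConnColoring G 2} {v : V} {i : Fin 2}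
    (h : colorStep G ω v i = ω') : 0 < colorChain G 2 ω ω' := by
  have hnn : ∀ (v : V) (i : Fin 2), 0 ≤ (1 / (Fintype.card V : ℝ)) * (1 / ((2 : ℕ) : ℝ)) *
      (if colorStep G ω v i = ω' then (1 : ℝ) else 0) := fun v i => by split_ifs <;> positivity
  refine Finset.sum_pos' (fun v _ => Finset.sum_nonneg fun i _ => hnn v i)
    ⟨v, Finset.mem_univ v, Finset.sum_pos' (fun i _ => hnn v i) ⟨i, Finset.mem_univ i, ?_⟩⟩
  rw [if_pos h]
  positivity

theorem exists_of_colorChain_ne_zero {ω ω' : ConnColoring G 2} (h : colorChain G 2 ω ω' ≠ 0) :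
    ω = ω' ∨ ∃ v, ∀ u, u ≠ v → ω.1 u = ω'.1 u := by
  rcases eq_or_ne ω ω' with rfl | hne
  · exact Or.inl rfl
  obtain ⟨v, _, hv⟩ := Finset.exists_ne_zero_of_sum_ne_zero h
  obtain ⟨i, _, hi⟩ := Finset.exists_ne_zero_of_sum_ne_zero hv
  have : colorStep G ω v i = ω' := by
    by_contra hcon
    simp [hcon] at hi
  exact Or.inr ⟨v, ((colorStep_eq_iff hne v i).1 this).2⟩

/-- Peeling the class of color `0` vertex by vertex leads to the constant coloring. Proposing the
present color of a vertex supplies the positive diagonal. -/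
theorem isErgodicChain_colorChain [Nonempty V] (h1 : IsContiguous G Set.univ)
    (hG : IsPeelable G) : IsErgodicChain (colorChain G 2) (uniformDist _) := by
  have hstay : ∀ ω : ConnColoring G 2, 0 < colorChain G 2 ω ω := fun ω => by
    obtain ⟨v⟩ := ‹Nonempty V›
    refine colorChain_pos (v := v) (i := ω.1 v) ?_
    classical
    by_cases h : ∀ j, IsContiguous G {u | Function.update ω.1 v (ω.1 v) u = j}
    · exact (colorStep_of_forall h).trans (Subtype.ext (Function.update_eq_self v ω.1))
    · exact colorStep_of_not_forall h
  refine isErgodicChain_of_isSymm colorChain_mem_rowStochastic colorChain_isSymm hstay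
    (coloringOf G ∅ (isSplit_empty h1)) fun ω => ?_
  rw [← coloringOf_class ω]
  have key : ∀ A, IsSplit G A → ∀ h : IsSplit G A,
      Relation.ReflTransGen (fun a b => 0 < colorChain G 2 a b) (coloringOf G A h)
        (coloringOf G ∅ (isSplit_empty h1)) := by
    refine hG.induction (fun _ => Relation.ReflTransGen.refl) fun A v hv _ hs ih h => ?_
    refine Relation.ReflTransGen.head (colorChain_pos (v := v) (i := 1) ?_) (ih hs)
    have hv0 := (coloringOf_eq_zero h v).2 hv
    have hv1 := mt (coloringOf_eq_zero hs v).1 (by simp)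
    refine (colorStep_eq_iff ?_ v 1).2 ⟨?_, fun u hu => ?_⟩
    · intro heq
      rw [heq] at hv0
      exact hv1 hv0
    · exact Fin.eq_one_of_ne_zero _ hv1
    · have h3 := coloringOf_eq_zero h u
      have h4 := coloringOf_eq_zero hs u
      have h5 : u ∈ A \ {v} ↔ u ∈ A := by simp [hu]
      rw [h5, ← h3] at h4
      omega
  exact key _ ω.isSplit ω.isSplit

end ColorChain

/-! ### The partition chain -/

section PartitionChain

variable {V : Type*} {G : SimpleGraph V}

open Classical in
/-- Switch the piece that contains `v`. -/
def flipAt (p : Finset (Finset V)) (v : V) : Finset (Finset V) := p.image fun A => symmDiff A {v}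

open Classical in
theorem flipAt_flipAt (p : Finset (Finset V)) (v : V) : flipAt (flipAt p v) v = p := by
  simp [flipAt, Finset.image_image, Function.comp_def]

variable [Fintype V]

open Classical in
/-- The partition into `A` and its complement. -/
def partitionOf (G : SimpleGraph V) (A : Set V) (h : IsSplit G A) : ContigTwoPartition G :=
  ⟨{A.toFinset, A.toFinsetᶜ}, A.toFinset, rfl, by
    intro D hD
    simp only [Finset.mem_insert, Finset.mem_singleton] at hD
    rcases hD with rfl | rfl
    · simpa using h.1
    · simpa using h.2⟩

open Classical in
theorem ContigTwoPartition.exists_eq (p : ContigTwoPartition G) :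
    ∃ (A : Set V) (h : IsSplit G A), p = partitionOf G A h := by
  obtain ⟨p, A, rfl, hA⟩ := p
  refine ⟨A, ⟨hA A (by simp), ?_⟩, Subtype.ext ?_⟩
  · have := hA Aᶜ (by simp)
    rwa [Finset.coe_compl] at this
  · simp [partitionOf]

/-- One of the two pieces of a partition. -/
def ContigTwoPartition.piece (p : ContigTwoPartition G) : Set V := p.exists_eq.choose

theorem ContigTwoPartition.isSplit_piece (p : ContigTwoPartition G) : IsSplit G p.piece :=
  p.exists_eq.choose_spec.choose

theorem ContigTwoPartition.partitionOf_piece (p : ContigTwoPartition G) :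
    partitionOf G p.piece p.isSplit_piece = p :=
  p.exists_eq.choose_spec.choose_spec.symm

open Classical in
theorem pair_compl_eq_iff {A B : Finset V} :
    ({A, Aᶜ} : Finset (Finset V)) = {B, Bᶜ} ↔ A = B ∨ A = Bᶜ := by
  constructor
  · intro h
    have : A ∈ ({B, Bᶜ} : Finset (Finset V)) := h ▸ Finset.mem_insert_self A _
    simpa using this
  · rintro (rfl | rfl)
    · rfl
    · rw [compl_compl, Finset.pair_comm]

theorem partitionOf_eq_iff {A B : Set V} (hA : IsSplit G A) (hB : IsSplit G B) :
    partitionOf G A hA = partitionOf G B hB ↔ A = B ∨ A = Bᶜ := by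
  classical
  refine Subtype.ext_iff.trans (pair_compl_eq_iff.trans ?_)
  rw [← Set.toFinset_compl, Set.toFinset_inj, Set.toFinset_inj]

open Classical in
theorem flipAt_pair (A : Finset V) (v : V) :
    flipAt {A, Aᶜ} v = {symmDiff A {v}, (symmDiff A {v})ᶜ} := by
  have : symmDiff Aᶜ {v} = (symmDiff A {v})ᶜ := by
    ext u; simp only [Finset.mem_symmDiff, Finset.mem_compl]; tauto
  rw [flipAt, Finset.image_insert, Finset.image_singleton, this]

open Classical in
theorem ne_compl_of_mem [Nonempty V] (A : Finset V) : A ≠ Aᶜ := by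
  obtain ⟨v⟩ := ‹Nonempty V›
  intro h
  have : v ∈ A ↔ v ∈ Aᶜ := by rw [← h]
  simp at this

open Classical in
theorem moveTo_of_mem [Nonempty V] {A : Finset V} {v : V} (hv : v ∈ A) :
    moveTo {A, Aᶜ} v A = {A, Aᶜ} := by
  have h1 : Aᶜ ≠ A := (ne_compl_of_mem A).symm
  have h2 : Aᶜ.erase v = Aᶜ := Finset.erase_eq_of_notMem (by simpa using hv)
  simp [moveTo, Finset.image_insert, h1, h2, Finset.insert_eq_of_mem hv]

open Classical in
theorem moveTo_of_notMem [Nonempty V] {A : Finset V} {v : V} (hv : v ∉ A) :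
    moveTo {A, Aᶜ} v A = flipAt {A, Aᶜ} v := by
  have h1 : Aᶜ ≠ A := (ne_compl_of_mem A).symm
  have h2 : symmDiff A {v} = insert v A := by
    ext u; simp only [Finset.mem_symmDiff, Finset.mem_singleton, Finset.mem_insert]
    by_cases hu : u = v
    · subst hu; simp [hv]
    · simp [hu]
  have h3 : Aᶜ.erase v = (insert v A)ᶜ := by
    rw [Finset.compl_insert]
  rw [flipAt_pair, h2, moveTo, Finset.image_insert, Finset.image_singleton, if_pos rfl,
    if_neg h1, h3]

open Classical in
theorem ContigTwoPartition.exists_pair (p : ContigTwoPartition G) (v : V) :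
    ∃ A : Finset V, p.1 = {A, Aᶜ} ∧ v ∉ A := by
  obtain ⟨A, hp, hA⟩ := p.2
  by_cases hv : v ∈ A
  · exact ⟨Aᶜ, by rw [compl_compl, Finset.pair_comm, hp], by simpa using hv⟩
  · exact ⟨A, hp, hv⟩

/-- This also covers the state with an empty piece, so the weight of a proposed piece is the same in
all states and does not spoil symmetry. -/
theorem ContigTwoPartition.card_eq_two [Nonempty V] (p : ContigTwoPartition G) :
    p.1.card = 2 := by
  classical
  obtain ⟨p, A, rfl, hA⟩ := p
  exact Finset.card_pair (ne_compl_of_mem A)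

theorem partitionStep_of_isContig {p : ContigTwoPartition G} {v : V} {D : Finset V}
    (h : IsContigTwoPartition G (moveTo p.1 v D)) :
    partitionStep G p v D = ⟨moveTo p.1 v D, h⟩ := dif_pos h

theorem partitionStep_of_not_isContig {p : ContigTwoPartition G} {v : V} {D : Finset V}
    (h : ¬ IsContigTwoPartition G (moveTo p.1 v D)) : partitionStep G p v D = p := dif_neg h

theorem partitionStep_eq_iff {p p' : ContigTwoPartition G} (hne : p ≠ p') (v : V) (D : Finset V) :
    partitionStep G p v D = p' ↔ moveTo p.1 v D = p'.1 := by
  constructor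
  · intro h
    by_cases h1 : IsContigTwoPartition G (moveTo p.1 v D)
    · rw [h.symm.trans (partitionStep_of_isContig h1)]
    · exact absurd ((partitionStep_of_not_isContig h1).symm.trans h) hne
  · intro h
    have h1 : IsContigTwoPartition G (moveTo p.1 v D) := by rw [h]; exact p'.2
    exact (partitionStep_of_isContig h1).trans (Subtype.ext h)

-- One of the two pieces already contains `v` and gives no move, while the other makes `v` change
-- sides. What remains is an involution on partitions, hence a symmetric condition.
open Classical in
theorem sum_partitionStep [Nonempty V] {p p' : ContigTwoPartition G} (hne : p ≠ p') (v : V) :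
    ∑ D ∈ p.1, (if partitionStep G p v D = p' then (1 : ℝ) else 0)
      = if flipAt p.1 v = p'.1 then 1 else 0 := by
  simp only [partitionStep_eq_iff hne]
  obtain ⟨A, hp, hv⟩ := p.exists_pair v
  have hne' : ({A, Aᶜ} : Finset (Finset V)) ≠ p'.1 := fun h => hne (Subtype.ext (hp.trans h))
  have h2 : moveTo {A, Aᶜ} v Aᶜ = {A, Aᶜ} := by
    have := moveTo_of_mem (A := Aᶜ) (v := v) (by simpa using hv)
    rwa [compl_compl, Finset.pair_comm] at this
  rw [hp, Finset.sum_pair (ne_compl_of_mem A), moveTo_of_notMem hv, h2, if_neg hne', add_zero]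

theorem partitionChain_mem_rowStochastic [Nonempty V] :
    partitionChain G ∈ Matrix.rowStochastic ℝ (ContigTwoPartition G) := by
  refine Matrix.mem_rowStochastic_iff_sum.2 ⟨fun p p' => ?_, fun p => ?_⟩
  · exact Finset.sum_nonneg fun v _ => Finset.sum_nonneg fun i _ => by split_ifs <;> positivity
  · simp only [partitionChain]
    rw [Finset.sum_comm]
    have : ∀ v : V, ∑ p' : ContigTwoPartition G, ∑ D ∈ p.1, (1 / (Fintype.card V : ℝ)) *
        (1 / (p.1.card : ℝ)) * (if partitionStep G p v D = p' then (1 : ℝ) else 0)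
        = 1 / (Fintype.card V : ℝ) := by
      intro v
      rw [Finset.sum_comm]
      simp only [← Finset.mul_sum, Finset.sum_ite_eq, Finset.mem_univ, if_true]
      simp [p.card_eq_two]
    rw [Finset.sum_congr rfl fun v _ => this v]
    simp

theorem partitionChain_isSymm [Nonempty V] : (partitionChain G).IsSymm := by
  classical
  refine Matrix.IsSymm.ext fun p p' => ?_
  rcases eq_or_ne p p' with rfl | hne
  · rfl
  unfold partitionChain
  refine Finset.sum_congr rfl fun v _ => ?_
  rw [← Finset.mul_sum, ← Finset.mul_sum, sum_partitionStep hne, sum_partitionStep hne.symm,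
    p.card_eq_two, p'.card_eq_two]
  congr 1
  refine if_congr ⟨?_, ?_⟩ rfl rfl <;>
  · intro h
    rw [← h, flipAt_flipAt]

theorem partitionChain_pos [Nonempty V] {p p' : ContigTwoPartition G} {v : V} {D : Finset V}
    (hD : D ∈ p.1) (h : partitionStep G p v D = p') : 0 < partitionChain G p p' := by
  have hnn : ∀ (v : V) (D : Finset V), 0 ≤ (1 / (Fintype.card V : ℝ)) * (1 / (p.1.card : ℝ)) *
      (if partitionStep G p v D = p' then (1 : ℝ) else 0) := fun v D => by
    split_ifs <;> positivity
  refine Finset.sum_pos' (fun v _ => Finset.sum_nonneg fun D _ => hnn v D)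
    ⟨v, Finset.mem_univ v, Finset.sum_pos' (fun D _ => hnn v D) ⟨D, hD, ?_⟩⟩
  rw [if_pos h, p.card_eq_two]
  positivity

/-- The piece representing a partition is an arbitrary choice, so a move may appear as a one-vertex
change relative to the complement. This is the reason for the second alternative. -/
theorem exists_of_partitionChain_ne_zero [Nonempty V] {p p' : ContigTwoPartition G}
    (h : partitionChain G p p' ≠ 0) : p = p' ∨ ∃ v, (∀ u, u ≠ v → (u ∈ p.piece ↔ u ∈ p'.piece)) ∨
      (∀ u, u ≠ v → (u ∈ p.piece ↔ u ∉ p'.piece)) := by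
  classical
  rcases eq_or_ne p p' with rfl | hne
  · exact Or.inl rfl
  refine Or.inr ?_
  obtain ⟨v, _, hv⟩ := Finset.exists_ne_zero_of_sum_ne_zero h
  rw [← Finset.mul_sum, sum_partitionStep hne] at hv
  have hf : flipAt p.1 v = p'.1 := by
    by_contra hcon
    simp [hcon] at hv
  rw [← p.partitionOf_piece, ← p'.partitionOf_piece] at hf
  simp only [partitionOf, flipAt_pair, pair_compl_eq_iff] at hf
  refine ⟨v, hf.imp ?_ ?_⟩ <;>
  · intro h u hu
    have := congrArg (u ∈ ·) h
    simpa [Finset.mem_symmDiff, hu] using this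

theorem isErgodicChain_partitionChain [Nonempty V] (h1 : IsContiguous G Set.univ)
    (hG : IsPeelable G) : IsErgodicChain (partitionChain G) (uniformDist _) := by
  classical
  have hstay : ∀ p : ContigTwoPartition G, 0 < partitionChain G p p := fun p => by
    obtain ⟨v⟩ := ‹Nonempty V›
    obtain ⟨A, hp, hv⟩ := p.exists_pair v
    refine partitionChain_pos (v := v) (D := Aᶜ) (by simp [hp]) ?_
    have h2 : moveTo p.1 v Aᶜ = p.1 := by
      have := moveTo_of_mem (A := Aᶜ) (v := v) (by simpa using hv)
      rwa [compl_compl, Finset.pair_comm, ← hp] at this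
    have h3 : IsContigTwoPartition G (moveTo p.1 v Aᶜ) := by rw [h2]; exact p.2
    exact (partitionStep_of_isContig h3).trans (Subtype.ext h2)
  refine isErgodicChain_of_isSymm partitionChain_mem_rowStochastic partitionChain_isSymm hstay
    (partitionOf G ∅ (isSplit_empty h1)) fun p => ?_
  rw [← p.partitionOf_piece]
  have key : ∀ A, IsSplit G A → ∀ h : IsSplit G A,
      Relation.ReflTransGen (fun a b => 0 < partitionChain G a b) (partitionOf G A h)
        (partitionOf G ∅ (isSplit_empty h1)) := by
    refine hG.induction (fun _ => Relation.ReflTransGen.refl) fun A v hv _ hs ih h => ?_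
    -- The two partitions coincide only if `v` is the sole vertex of the graph, and then no move is
    -- needed.
    by_cases heq : partitionOf G A h = partitionOf G (A \ {v}) hs
    · rw [heq]; exact ih hs
    refine Relation.ReflTransGen.head (partitionChain_pos (v := v) (D := A.toFinsetᶜ)
      (by simp [partitionOf]) ?_) (ih hs)
    refine (partitionStep_eq_iff heq v _).2 ?_
    have h3 := moveTo_of_notMem (A := A.toFinsetᶜ) (v := v) (by simpa using hv)
    rw [compl_compl, Finset.pair_comm, flipAt_pair] at h3
    refine h3.trans ?_
    have h4 : symmDiff A.toFinset {v} = (A \ {v}).toFinset := by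
      ext u
      simp only [Finset.mem_symmDiff, Set.mem_toFinset, Finset.mem_singleton, Set.mem_sdiff,
        Set.mem_singleton_iff]
      constructor
      · rintro (h | ⟨rfl, h⟩)
        · exact h
        · exact absurd hv h
      · exact Or.inl
    rw [h4]
    simp [partitionOf]
  exact key _ p.isSplit_piece p.isSplit_piece

end PartitionChain

/-! ### Domain walls in the planar square lattice -/

section Planar

/-- An edge of the square lattice `ℕ × ℕ`: `(x, y, false)` joins `(x, y)` to `(x + 1, y)`, and
`(x, y, true)` joins `(x, y)` to `(x, y + 1)`. -/
abbrev LatEdge := ℕ × ℕ × Bool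

/-- The lower or left end of an edge. -/
def LatEdge.src (e : LatEdge) : ℕ × ℕ := (e.1, e.2.1)

/-- The upper or right end of an edge. -/
def LatEdge.tgt (e : LatEdge) : ℕ × ℕ := bif e.2.2 then (e.1, e.2.1 + 1) else (e.1 + 1, e.2.1)

/-- The four sides of the unit square with lower left corner `s`. -/
def sqBot (s : ℕ × ℕ) : LatEdge := (s.1, s.2, false)
/-- The left edge of the unit square. -/
def sqLeft (s : ℕ × ℕ) : LatEdge := (s.1, s.2, true)
/-- The top edge of the unit square. -/
def sqTop (s : ℕ × ℕ) : LatEdge := (s.1, s.2 + 1, false)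
/-- The right edge of the unit square. -/
def sqRight (s : ℕ × ℕ) : LatEdge := (s.1 + 1, s.2, true)

/-- All corners of the unit square with lower left corner `s` lie in `W`. -/
def IsSquare (W : Finset (ℕ × ℕ)) (s : ℕ × ℕ) : Prop :=
  s ∈ W ∧ (s.1 + 1, s.2) ∈ W ∧ (s.1, s.2 + 1) ∈ W ∧ (s.1 + 1, s.2 + 1) ∈ W

/-- The edge `e` is a side of the square `s`. -/
def IsSide (e : LatEdge) (s : ℕ × ℕ) : Prop :=
  e = sqBot s ∨ e = sqLeft s ∨ e = sqTop s ∨ e = sqRight s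

/-- Every mod 2 cochain on the edges of `W` that vanishes around all unit squares is a
coboundary. -/
def IsSimplyConn (W : Finset (ℕ × ℕ)) : Prop :=
  ∀ f : LatEdge → ZMod 2,
    (∀ s, IsSquare W s → f (sqBot s) + f (sqRight s) = f (sqLeft s) + f (sqTop s)) →
    ∃ φ : ℕ × ℕ → ZMod 2, ∀ e : LatEdge, e.src ∈ W → e.tgt ∈ W → φ e.tgt = φ e.src + f e

/-- The edge `e` of `W` joins vertices of different colors. -/
def IsCut (W : Finset (ℕ × ℕ)) (χ : ℕ × ℕ → Bool) (e : LatEdge) : Prop :=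
  e.src ∈ W ∧ e.tgt ∈ W ∧ χ e.src ≠ χ e.tgt

/-- The two color classes are connected in the sense that functions constant along monochromatic
edges are constant on color classes. -/
def HasConnClasses (W : Finset (ℕ × ℕ)) (χ : ℕ × ℕ → Bool) : Prop :=
  ∀ φ : ℕ × ℕ → ZMod 2,
    (∀ e : LatEdge, e.src ∈ W → e.tgt ∈ W → χ e.src = χ e.tgt → φ e.src = φ e.tgt) →
    ∀ u ∈ W, ∀ v ∈ W, χ u = χ v → φ u = φ v

/-- The cut edges `e` and `e'` are consecutive in the domain wall running through the square `s`;
if all sides of `s` are cut, then the wall is split into a lower left and an upper right part. -/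
def IsPaired (W : Finset (ℕ × ℕ)) (χ : ℕ × ℕ → Bool) (s : ℕ × ℕ) (e e' : LatEdge) : Prop :=
  e ≠ e' ∧ IsSide e s ∧ IsSide e' s ∧
    ((∀ d, IsSide d s → IsCut W χ d) →
      ((e = sqBot s ∨ e = sqLeft s) ↔ (e' = sqBot s ∨ e' = sqLeft s)))

variable {W : Finset (ℕ × ℕ)} {χ : ℕ × ℕ → Bool}

theorem IsPaired.symm {s : ℕ × ℕ} {e e' : LatEdge} (h : IsPaired W χ s e e') :
    IsPaired W χ s e' e :=
  ⟨h.1.symm, h.2.2.1, h.2.1, fun hd => (h.2.2.2 hd).symm⟩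

theorem IsSquare.isCut_iff {s : ℕ × ℕ} (hs : IsSquare W s) :
    (IsCut W χ (sqBot s) ↔ χ s ≠ χ (s.1 + 1, s.2)) ∧
    (IsCut W χ (sqLeft s) ↔ χ s ≠ χ (s.1, s.2 + 1)) ∧
    (IsCut W χ (sqTop s) ↔ χ (s.1, s.2 + 1) ≠ χ (s.1 + 1, s.2 + 1)) ∧
    (IsCut W χ (sqRight s) ↔ χ (s.1 + 1, s.2) ≠ χ (s.1 + 1, s.2 + 1)) := by
  obtain ⟨h1, h2, h3, h4⟩ := hs
  refine ⟨?_, ?_, ?_, ?_⟩ <;>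
    simp [IsCut, LatEdge.src, LatEdge.tgt, sqBot, sqLeft, sqTop, sqRight, h1, h2, h3, h4]

theorem sq_ne (s : ℕ × ℕ) : sqBot s ≠ sqLeft s ∧ sqBot s ≠ sqTop s ∧ sqBot s ≠ sqRight s ∧
    sqLeft s ≠ sqTop s ∧ sqLeft s ≠ sqRight s ∧ sqTop s ≠ sqRight s := by
  simp [sqBot, sqLeft, sqTop, sqRight]

theorem forall_isSide {s : ℕ × ℕ} {p : LatEdge → Prop} : (∀ d, IsSide d s → p d) ↔
    p (sqBot s) ∧ p (sqLeft s) ∧ p (sqTop s) ∧ p (sqRight s) := by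
  simp only [IsSide]
  constructor
  · intro h; exact ⟨h _ (by tauto), h _ (by tauto), h _ (by tauto), h _ (by tauto)⟩
  · rintro ⟨h1, h2, h3, h4⟩ d (rfl | rfl | rfl | rfl) <;> assumption

-- Going around a square, the color changes an even number of times. With two cut sides the partner
-- is the other one, and with four the corner rule selects it. So each square contributes at most
-- one wall neighbor to a cut edge.
set_option linter.unusedSimpArgs false in
theorem IsPaired.eq_of_isPaired {s : ℕ × ℕ} (hs : IsSquare W s) {e e₁ e₂ : LatEdge}
    (he : IsCut W χ e) (hc₁ : IsCut W χ e₁) (hc₂ : IsCut W χ e₂)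
    (h₁ : IsPaired W χ s e e₁) (h₂ : IsPaired W χ s e e₂) : e₁ = e₂ := by
  obtain ⟨a1, a2, a3, a4⟩ := hs.isCut_iff (χ := χ)
  obtain ⟨n1, n2, n3, n4, n5, n6⟩ := sq_ne s
  obtain ⟨k1, h3, h4, h5⟩ := h₁
  obtain ⟨k2, -, h6, h7⟩ := h₂
  rw [forall_isSide, a1, a2, a3, a4] at h5 h7
  generalize χ s = c1 at *
  generalize χ (s.1 + 1, s.2) = c2 at *
  generalize χ (s.1, s.2 + 1) = c3 at *
  generalize χ (s.1 + 1, s.2 + 1) = c4 at *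
  by_contra hne
  rcases h3 with rfl | rfl | rfl | rfl <;> rcases h4 with rfl | rfl | rfl | rfl <;>
    first
    | exact k1 rfl
    | (rcases h6 with rfl | rfl | rfl | rfl <;>
        first
        | exact k2 rfl
        | exact hne rfl
        | (simp only [a1, a2, a3, a4] at he hc₁ hc₂
           clear a1 a2 a3 a4
           simp only [n1, n2, n3, n4, n5, n6, n1.symm, n2.symm, n3.symm, n4.symm, n5.symm,
            n6.symm, or_true, true_or, or_false, iff_true, iff_false, true_iff, not_true] at h5 h7
           clear n1 n2 n3 n4 n5 n6
           clear hne k1 k2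
           cases c1 <;> cases c2 <;> cases c3 <;> cases c4 <;> simp at he hc₁ hc₂ h5 h7))

/-- The cut sides of a square come in pairs on which `f` agrees, so their contributions cancel mod
2. -/
theorem flat_of_isPaired {s : ℕ × ℕ} (hs : IsSquare W s) {f : LatEdge → ZMod 2}
    (hz : ∀ e, ¬ IsCut W χ e → f e = 0)
    (hp : ∀ e e', IsCut W χ e → IsCut W χ e' → IsPaired W χ s e e' → f e = f e') :
    f (sqBot s) + f (sqRight s) = f (sqLeft s) + f (sqTop s) := by
  obtain ⟨a1, a2, a3, a4⟩ := hs.isCut_iff (χ := χ)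
  obtain ⟨n1, n2, n3, n4, n5, n6⟩ := sq_ne s
  have zb := hz (sqBot s)
  have zl := hz (sqLeft s)
  have zt := hz (sqTop s)
  have zr := hz (sqRight s)
  have bl := fun h h' => hp (sqBot s) (sqLeft s) h h'
    ⟨n1, Or.inl rfl, Or.inr (Or.inl rfl), fun _ => by simp⟩
  have tr := fun h h' => hp (sqTop s) (sqRight s) h h'
    ⟨n6, by simp [IsSide], by simp [IsSide], fun _ => by
      simp [n2.symm, n3.symm, n4.symm, n5.symm]⟩
  have hq : ∀ e e', IsSide e s → IsSide e' s → e ≠ e' →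
      ¬ (IsCut W χ (sqBot s) ∧ IsCut W χ (sqLeft s) ∧ IsCut W χ (sqTop s) ∧
        IsCut W χ (sqRight s)) → IsCut W χ e → IsCut W χ e' → f e = f e' :=
    fun e e' h1 h2 h3 h4 h5 h6 => hp e e' h5 h6 ⟨h3, h1, h2, fun h => absurd (forall_isSide.1 h) h4⟩
  have bt := hq (sqBot s) (sqTop s) (by simp [IsSide]) (by simp [IsSide]) n2
  have br := hq (sqBot s) (sqRight s) (by simp [IsSide]) (by simp [IsSide]) n3
  have lt := hq (sqLeft s) (sqTop s) (by simp [IsSide]) (by simp [IsSide]) n4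
  have lr := hq (sqLeft s) (sqRight s) (by simp [IsSide]) (by simp [IsSide]) n5
  clear hq hp hz n1 n2 n3 n4 n5 n6
  rw [a1] at zb
  rw [a2] at zl
  rw [a3] at zt
  rw [a4] at zr
  rw [a1, a2] at bl
  rw [a3, a4] at tr
  rw [a1, a2, a3, a4] at bt br lt lr
  clear a1 a2 a3 a4
  generalize f (sqBot s) = b at *
  generalize f (sqLeft s) = l at *
  generalize f (sqTop s) = t at *
  generalize f (sqRight s) = r at *
  generalize χ s = c1 at *
  generalize χ (s.1 + 1, s.2) = c2 at *
  generalize χ (s.1, s.2 + 1) = c3 at *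
  generalize χ (s.1 + 1, s.2 + 1) = c4 at *
  clear hs
  cases c1 <;> cases c2 <;> cases c3 <;> cases c4 <;> simp_all [CharTwo.add_self_eq_zero]

/-- The cut edges of a coloring of `W`. -/
def cutEdges (W : Finset (ℕ × ℕ)) (χ : ℕ × ℕ → Bool) : Finset LatEdge :=
  open Classical in
  ((W ×ˢ (Finset.univ : Finset Bool)).image fun q => (q.1.1, q.1.2, q.2)).filter (IsCut W χ)

theorem mem_cutEdges {e : LatEdge} : e ∈ cutEdges W χ ↔ IsCut W χ e := by
  classical
  simp only [cutEdges, Finset.mem_filter, and_iff_right_iff_imp, Finset.mem_image]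
  intro h
  exact ⟨(e.src, e.2.2), by simpa using h.1, rfl⟩

/-- The domain wall graph on the cut edges: consecutive cut edges are adjacent. -/
def wallGraph (W : Finset (ℕ × ℕ)) (χ : ℕ × ℕ → Bool) : SimpleGraph (cutEdges W χ) where
  Adj e e' := ∃ s, IsSquare W s ∧ IsPaired W χ s e.1 e'.1
  symm := ⟨fun _ _ ⟨s, hs, h⟩ => ⟨s, hs, h.symm⟩⟩
  loopless := ⟨fun _ ⟨_, _, h⟩ => h.1 rfl⟩

/-- If both color classes are connected, then there is only one domain wall. -/
theorem wallGraph_preconnected (hW : IsSimplyConn W) (hχ : HasConnClasses W χ) :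
    (wallGraph W χ).Preconnected := by
  classical
  intro e₀ e₁
  -- The indicator of the wall component of `e₀` is closed around every square, hence a coboundary
  -- of some `φ`. It vanishes on monochromatic edges, so `φ` is constant on each color class and `f`
  -- takes one value on all cut edges.
  let f : LatEdge → ZMod 2 := fun e =>
    if ∃ he : e ∈ cutEdges W χ, (wallGraph W χ).Reachable e₀ ⟨e, he⟩ then 1 else 0
  have hz : ∀ e, ¬ IsCut W χ e → f e = 0 := fun e he =>
    if_neg fun h => he (mem_cutEdges.1 h.1)
  obtain ⟨φ, hφ⟩ := hW f fun s hs => by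
    refine flat_of_isPaired hs hz fun e e' he he' hp => if_congr ⟨?_, ?_⟩ rfl rfl
    · rintro ⟨h, h'⟩
      exact ⟨mem_cutEdges.2 he', h'.trans (SimpleGraph.Adj.reachable ⟨s, hs, hp⟩)⟩
    · rintro ⟨h, h'⟩
      exact ⟨mem_cutEdges.2 he, h'.trans (SimpleGraph.Adj.reachable ⟨s, hs, hp.symm⟩)⟩
  have hconst := hχ φ fun e h1 h2 h3 => by
    rw [hφ e h1 h2, hz e fun h => h.2.2 h3, add_zero]
  obtain ⟨e₀, he₀⟩ := e₀
  obtain ⟨e₁, he₁⟩ := e₁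
  obtain ⟨s0, t0, c0⟩ := mem_cutEdges.1 he₀
  obtain ⟨s1, t1, c1⟩ := mem_cutEdges.1 he₁
  have f0 : f e₀ = 1 := if_pos ⟨he₀, SimpleGraph.Reachable.refl _⟩
  have g0 := hφ e₀ s0 t0
  have g1 := hφ e₁ s1 t1
  have f1 : f e₁ = f e₀ := by
    -- Both edges join the same two classes. If their orientations are opposite, the sign of the
    -- difference does not matter mod 2.
    by_cases h : χ e₁.src = χ e₀.src
    · have h' : χ e₁.tgt = χ e₀.tgt := by
        revert h c0 c1; cases χ e₁.src <;> cases χ e₀.src <;> cases χ e₁.tgt <;>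
          cases χ e₀.tgt <;> decide
      rw [hconst _ s1 _ s0 h, hconst _ t1 _ t0 h', g0] at g1
      exact (add_left_cancel g1).symm
    · have h1 : χ e₁.src = χ e₀.tgt := by
        revert h c0 c1; cases χ e₁.src <;> cases χ e₀.src <;> cases χ e₁.tgt <;>
          cases χ e₀.tgt <;> decide
      have h2 : χ e₁.tgt = χ e₀.src := by
        revert h c0 c1; cases χ e₁.src <;> cases χ e₀.src <;> cases χ e₁.tgt <;>
          cases χ e₀.tgt <;> decide
      rw [hconst _ s1 _ t0 h1, hconst _ t1 _ s0 h2, g0] at g1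
      generalize φ e₀.src = a at g1
      generalize f e₀ = b at g1 ⊢
      generalize f e₁ = c at g1 ⊢
      revert a b c
      decide
  rw [f0] at f1
  by_contra hcon
  have : f e₁ = 0 := if_neg fun ⟨_, h⟩ => hcon h
  rw [this] at f1
  exact zero_ne_one f1

/-- The edge `e` lies on the outer boundary of `W`: it is a side of at most one square. -/
def IsOuter (W : Finset (ℕ × ℕ)) (e : LatEdge) : Prop :=
  ∀ s s', IsSquare W s → IsSquare W s' → IsSide e s → IsSide e s' → s = s'

/-- The squares that may have the side `e`. -/
def sideCandidates (e : LatEdge) : Finset (ℕ × ℕ) :=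
  bif e.2.2 then {(e.1, e.2.1), (e.1 - 1, e.2.1)} else {(e.1, e.2.1), (e.1, e.2.1 - 1)}

theorem mem_sideCandidates {e : LatEdge} {s : ℕ × ℕ} (h : IsSide e s) :
    s ∈ sideCandidates e := by
  obtain ⟨x, y⟩ := s
  rcases h with rfl | rfl | rfl | rfl <;>
    simp [sideCandidates, sqBot, sqLeft, sqTop, sqRight]

theorem card_sideCandidates_le (e : LatEdge) : (sideCandidates e).card ≤ 2 := by
  obtain ⟨x, y, b⟩ := e
  cases b
  · exact Finset.card_le_two
  · exact Finset.card_le_two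

open Classical in
/-- If both color classes of a simply connected region are connected, then the color changes at
most twice along the outer boundary. -/
theorem card_outer_cutEdges_le (hW : IsSimplyConn W) (hχ : HasConnClasses W χ) :
    ((cutEdges W χ).filter (IsOuter W)).card ≤ 2 := by
  rcases (cutEdges W χ).eq_empty_or_nonempty with h0 | ⟨e₀, he₀⟩
  · simp [h0]
  have hconn : (wallGraph W χ).Connected :=
    { preconnected := wallGraph_preconnected hW hχ, nonempty := ⟨⟨e₀, he₀⟩⟩ }
  -- With `n` cut edges, connectivity forces degree sum at least `2 n - 2`, while the degree bounds
  -- below give at most `2 n` minus the number of outer cut edges.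
  have hcard := hconn.card_vert_le_card_edgeSet_add_one
  have hface : ∀ e e' : cutEdges W χ, (wallGraph W χ).Adj e e' →
      ∃ s, IsSquare W s ∧ IsPaired W χ s e.1 e'.1 := fun _ _ h => h
  have huniq : ∀ (e a b : cutEdges W χ) (s : ℕ × ℕ), IsSquare W s → IsPaired W χ s e.1 a.1 →
      IsPaired W χ s e.1 b.1 → a = b := fun e a b s hs ha hb =>
    Subtype.ext (ha.eq_of_isPaired hs (mem_cutEdges.1 e.2) (mem_cutEdges.1 a.2)
      (mem_cutEdges.1 b.2) hb)
  have hdeg : ∀ e : cutEdges W χ,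
      (wallGraph W χ).degree e + (if IsOuter W e.1 then 1 else 0) ≤ 2 := by
    intro e
    rw [← SimpleGraph.card_neighborFinset_eq_degree]
    split_ifs with ho
    · have : ((wallGraph W χ).neighborFinset e).card ≤ 1 := by
        refine Finset.card_le_one.2 fun a ha b hb => ?_
        rw [SimpleGraph.mem_neighborFinset] at ha hb
        obtain ⟨s, hs, ps⟩ := hface e a ha
        obtain ⟨s', hs', ps'⟩ := hface e b hb
        obtain rfl := ho s s' hs hs' ps.2.1 ps'.2.1
        exact huniq e a b s hs ps ps'
      omega
    · choose! F hF1 hF2 using hface e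
      have h1 : ((wallGraph W χ).neighborFinset e).card ≤ (sideCandidates e.1).card := by
        refine Finset.card_le_card_of_injOn F (fun a ha => ?_) fun a ha b hb hab => ?_
        · rw [Finset.mem_coe, SimpleGraph.mem_neighborFinset] at ha
          exact mem_sideCandidates (hF2 a ha).2.1
        · rw [Finset.mem_coe, SimpleGraph.mem_neighborFinset] at ha hb
          exact huniq e a b (F a) (hF1 a ha) (hF2 a ha) (hab ▸ hF2 b hb)
      exact h1.trans (card_sideCandidates_le e.1)
  have hsum : ∑ e : cutEdges W χ, ((wallGraph W χ).degree e + (if IsOuter W e.1 then 1 else 0))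
      ≤ ∑ _e : cutEdges W χ, 2 := Finset.sum_le_sum fun e _ => hdeg e
  rw [Finset.sum_add_distrib, SimpleGraph.sum_degrees_eq_twice_card_edges] at hsum
  have hout : ((cutEdges W χ).filter (IsOuter W)).card
      = ∑ e : cutEdges W χ, (if IsOuter W e.1 then 1 else 0) := by
    rw [Finset.card_filter, ← Finset.sum_coe_sort]
  rw [Nat.card_eq_fintype_card, Nat.card_eq_fintype_card, ← SimpleGraph.edgeFinset_card] at hcard
  rw [← hout] at hsum
  simp only [Finset.sum_const, Finset.card_univ, smul_eq_mul] at hsum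
  omega

end Planar

/-! ### Rectangles -/

section Rectangle

/-- The rectangle `[a, b) × [c, d)`. -/
def rect (a b c d : ℕ) : Finset (ℕ × ℕ) := Finset.Ico a b ×ˢ Finset.Ico c d

theorem mem_rect {a b c d : ℕ} {p : ℕ × ℕ} :
    p ∈ rect a b c d ↔ (a ≤ p.1 ∧ p.1 < b) ∧ c ≤ p.2 ∧ p.2 < d := by
  simp [rect, Finset.mem_product]

theorem forall_latEdge {p : LatEdge → Prop} :
    (∀ e, p e) ↔ (∀ x y, p (x, y, false)) ∧ ∀ x y, p (x, y, true) := by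
  constructor
  · exact fun h => ⟨fun x y => h _, fun x y => h _⟩
  · rintro ⟨h1, h2⟩ ⟨x, y, b⟩
    cases b
    · exact h1 x y
    · exact h2 x y

/-- The primitive integrates `f` along the bottom row and then upwards. Vertical edges are correct
by construction, and horizontal ones by induction on the height, crossing one square at a time. -/
theorem isSimplyConn_rect (a b c d : ℕ) : IsSimplyConn (rect a b c d) := by
  intro f hf
  refine ⟨fun p => ∑ i ∈ Finset.Ico a p.1, f (i, c, false) + ∑ j ∈ Finset.Ico c p.2, f (p.1, j, true),
    forall_latEdge.2 ⟨fun x y h1 h2 => ?_, fun x y h1 h2 => ?_⟩⟩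
  · simp only [LatEdge.src, LatEdge.tgt, cond_false, mem_rect] at h1 h2 ⊢
    obtain ⟨⟨h3, h4⟩, h5, h6⟩ := h1
    rw [Finset.sum_Ico_succ_top h3]
    have hx := h2.1.2
    clear h2
    induction y, h5 using Nat.le_induction with
    | base => simp
    | succ y hy ih =>
      have ih' := ih (by omega)
      have hsq := hf (x, y) (by simp only [IsSquare, mem_rect]; omega)
      simp only [sqBot, sqRight, sqLeft, sqTop] at hsq
      rw [Finset.sum_Ico_succ_top hy, Finset.sum_Ico_succ_top hy]
      linear_combination ih' + hsq
  · simp only [LatEdge.src, LatEdge.tgt, cond_true, mem_rect] at h1 h2 ⊢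
    rw [Finset.sum_Ico_succ_top h1.2.1, add_assoc]

/-- A function on a rectangle that is constant along all edges avoiding `v` is constant on the
complement of `v`. -/
theorem rect_punctured {α : Type*} {a b c d : ℕ} (hab : a + 2 ≤ b) (hcd : c + 2 ≤ d) (v : ℕ × ℕ)
    {f : ℕ × ℕ → α} (h : ∀ e : LatEdge, e.src ∈ rect a b c d → e.tgt ∈ rect a b c d →
      e.src ≠ v → e.tgt ≠ v → f e.src = f e.tgt)
    {u w : ℕ × ℕ} (hu : u ∈ rect a b c d) (hw : w ∈ rect a b c d) (huv : u ≠ v) (hwv : w ≠ v) :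
    f u = f w := by
  obtain ⟨hh, hv⟩ := forall_latEdge.1 h
  simp only [LatEdge.src, LatEdge.tgt, cond_true, cond_false, mem_rect] at hh hv
  obtain ⟨x₀, y₀⟩ := v
  have row : ∀ y, c ≤ y → y < d → y ≠ y₀ → ∀ x x', a ≤ x → x ≤ x' → x' < b →
      f (x, y) = f (x', y) := by
    intro y h1 h2 h3 x x' h4 h5
    induction x', h5 using Nat.le_induction with
    | base => exact fun _ => rfl
    | succ x' hx ih =>
      intro h6
      rw [ih (by omega)]
      exact hh x' y (by omega) (by omega) (by simp [h3]) (by simp [h3])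
  have col : ∀ x, a ≤ x → x < b → x ≠ x₀ → ∀ y y', c ≤ y → y ≤ y' → y' < d →
      f (x, y) = f (x, y') := by
    intro x h1 h2 h3 y y' h4 h5
    induction y', h5 using Nat.le_induction with
    | base => exact fun _ => rfl
    | succ y' hx ih =>
      intro h6
      rw [ih (by omega)]
      exact hv x y' (by omega) (by omega) (by simp [h3]) (by simp [h3])
  have row' : ∀ y, c ≤ y → y < d → y ≠ y₀ → ∀ x x', a ≤ x → x < b → a ≤ x' → x' < b →
      f (x, y) = f (x', y) := by
    intro y h1 h2 h3 x x' h4 h5 h6 h7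
    rcases le_total x x' with h8 | h8
    · exact row y h1 h2 h3 x x' h4 h8 h7
    · exact (row y h1 h2 h3 x' x h6 h8 h5).symm
  have col' : ∀ x, a ≤ x → x < b → x ≠ x₀ → ∀ y y', c ≤ y → y < d → c ≤ y' → y' < d →
      f (x, y) = f (x, y') := by
    intro x h1 h2 h3 y y' h4 h5 h6 h7
    rcases le_total y y' with h8 | h8
    · exact col x h1 h2 h3 y y' h4 h8 h7
    · exact (col x h1 h2 h3 y' y h6 h8 h5).symm
  obtain ⟨x, y⟩ := u
  obtain ⟨x', y'⟩ := w
  simp only [mem_rect] at hu hw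
  obtain ⟨⟨u1, u2⟩, u3, u4⟩ := hu
  obtain ⟨⟨w1, w2⟩, w3, w4⟩ := hw
  -- Either an L-shaped route along one row and one column avoids `v`, or both points lie on the
  -- same line through `v`. In the latter case the route detours along a parallel line, which exists
  -- because the sides have length at least two.
  by_cases c1 : x ≠ x₀ ∧ y' ≠ y₀
  · rw [col' x u1 u2 c1.1 y y' u3 u4 w3 w4, row' y' w3 w4 c1.2 x x' u1 u2 w1 w2]
  by_cases c2 : y ≠ y₀ ∧ x' ≠ x₀
  · rw [row' y u3 u4 c2.1 x x' u1 u2 w1 w2, col' x' w1 w2 c2.2 y y' u3 u4 w3 w4]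
  simp only [ne_eq, Prod.mk.injEq] at huv hwv
  by_cases hx : x = x₀
  · have hx' : x' = x₀ := by tauto
    have hy : y ≠ y₀ := by tauto
    have hy' : y' ≠ y₀ := by tauto
    obtain ⟨z, z1, z2, z3⟩ : ∃ z, a ≤ z ∧ z < b ∧ z ≠ x₀ := by
      by_cases hz : a = x₀
      · exact ⟨a + 1, by omega, by omega, by omega⟩
      · exact ⟨a, le_rfl, by omega, hz⟩
    rw [row' y u3 u4 hy x z u1 u2 z1 z2, col' z z1 z2 z3 y y' u3 u4 w3 w4,
      row' y' w3 w4 hy' z x' z1 z2 w1 w2]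
  · have hx' : x' ≠ x₀ := by tauto
    have hy : y = y₀ := by tauto
    have hy' : y' = y₀ := by tauto
    obtain ⟨z, z1, z2, z3⟩ : ∃ z, c ≤ z ∧ z < d ∧ z ≠ y₀ := by
      by_cases hz : c = y₀
      · exact ⟨c + 1, by omega, by omega, by omega⟩
      · exact ⟨c, le_rfl, by omega, hz⟩
    rw [col' x u1 u2 hx y z u3 u4 z1 z2, row' z z1 z2 z3 x x' u1 u2 w1 w2,
      col' x' w1 w2 hx' z y' z1 z2 w3 w4]

/-- The union of two simply connected regions with connected intersection is simply connected. -/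
theorem IsSimplyConn.union {W₁ W₂ : Finset (ℕ × ℕ)} (h₁ : IsSimplyConn W₁) (h₂ : IsSimplyConn W₂)
    (hedge : ∀ e : LatEdge, e.src ∈ W₁ ∪ W₂ → e.tgt ∈ W₁ ∪ W₂ →
      (e.src ∈ W₁ ∧ e.tgt ∈ W₁) ∨ (e.src ∈ W₂ ∧ e.tgt ∈ W₂))
    (hinter : ∀ ψ : ℕ × ℕ → ZMod 2, (∀ e : LatEdge, e.src ∈ W₁ ∩ W₂ → e.tgt ∈ W₁ ∩ W₂ →
      ψ e.src = ψ e.tgt) → ∃ k, ∀ u ∈ W₁ ∩ W₂, ψ u = k) : IsSimplyConn (W₁ ∪ W₂) := by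
  intro f hf
  have hsq : ∀ W ⊆ W₁ ∪ W₂, ∀ s, IsSquare W s → IsSquare (W₁ ∪ W₂) s := fun W hW s hs =>
    ⟨hW hs.1, hW hs.2.1, hW hs.2.2.1, hW hs.2.2.2⟩
  obtain ⟨φ₁, g₁⟩ := h₁ f fun s hs => hf s (hsq _ Finset.subset_union_left s hs)
  obtain ⟨φ₂, g₂⟩ := h₂ f fun s hs => hf s (hsq _ Finset.subset_union_right s hs)
  -- The two primitives differ by a constant on the connected overlap, and adding it to one of them
  -- allows gluing.
  obtain ⟨k, hk⟩ := hinter (fun u => φ₁ u - φ₂ u) fun e hs ht => by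
    rw [Finset.mem_inter] at hs ht
    simp only [g₁ e hs.1 ht.1, g₂ e hs.2 ht.2]
    ring
  refine ⟨fun u => if u ∈ W₁ then φ₁ u else φ₂ u + k, fun e hs ht => ?_⟩
  have e2 : ∀ u ∈ W₂, (if u ∈ W₁ then φ₁ u else φ₂ u + k) = φ₂ u + k := by
    intro u hu
    split_ifs with h
    · rw [← hk u (Finset.mem_inter.2 ⟨h, hu⟩)]; ring
    · rfl
  beta_reduce
  rcases hedge e hs ht with ⟨a, b⟩ | ⟨a, b⟩
  · rw [if_pos a, if_pos b, g₁ e a b]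
  · rw [e2 _ a, e2 _ b, g₂ e a b]
    ring

end Rectangle

/-! ### Graphs embedded in the square lattice -/

section LatticeGraph

/-- `pos` identifies `G` with the subgraph of the square lattice induced by `W`. -/
structure IsLatticeGraph {V : Type*} (G : SimpleGraph V) (W : Finset (ℕ × ℕ)) (pos : V → ℕ × ℕ) :
    Prop where
  inj : Function.Injective pos
  mem : ∀ v, pos v ∈ W
  surj : ∀ p ∈ W, ∃ v, pos v = p
  adj_iff : ∀ u v, G.Adj u v ↔ ∃ e : LatEdge,
    (pos u = e.src ∧ pos v = e.tgt) ∨ (pos v = e.src ∧ pos u = e.tgt)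

variable {V : Type*} {G : SimpleGraph V} {W : Finset (ℕ × ℕ)} {pos : V → ℕ × ℕ}

/-- The coloring of lattice points that marks the set `A` of vertices. -/
def markSet (pos : V → ℕ × ℕ) (A : Set V) : ℕ × ℕ → Bool :=
  open Classical in fun p => decide (∃ v ∈ A, pos v = p)

theorem IsLatticeGraph.markSet_pos (h : IsLatticeGraph G W pos) (A : Set V) (v : V) :
    markSet pos A (pos v) = true ↔ v ∈ A := by
  simp only [markSet, decide_eq_true_eq]
  exact ⟨fun ⟨u, hu, huv⟩ => h.inj huv ▸ hu, fun hv => ⟨v, hv, rfl⟩⟩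

theorem IsLatticeGraph.hasConnClasses (h : IsLatticeGraph G W pos) {A : Set V}
    (hA : IsSplit G A) : HasConnClasses W (markSet pos A) := by
  intro φ hφ u hu v hv huv
  obtain ⟨u, rfl⟩ := h.surj u hu
  obtain ⟨v, rfl⟩ := h.surj v hv
  have hstep : ∀ a b, G.Adj a b → (a ∈ A ↔ b ∈ A) → φ (pos a) = φ (pos b) := by
    intro a b hab hAB
    have hc : markSet pos A (pos a) = markSet pos A (pos b) := by
      rw [Bool.eq_iff_iff, h.markSet_pos, h.markSet_pos, hAB]
    obtain ⟨e, ⟨h1, h2⟩ | ⟨h1, h2⟩⟩ := (h.adj_iff a b).1 hab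
    · rw [h1, h2] at hc ⊢
      exact hφ e (h1 ▸ h.mem a) (h2 ▸ h.mem b) hc
    · rw [h1, h2] at hc ⊢
      exact (hφ e (h1 ▸ h.mem b) (h2 ▸ h.mem a) hc.symm).symm
  rw [Bool.eq_iff_iff, h.markSet_pos, h.markSet_pos] at huv
  by_cases hu : u ∈ A
  · exact hA.1.eq_of_forall_adj (f := fun v => φ (pos v))
      (fun a ha b hb hab => hstep a b hab (iff_of_true ha hb)) hu (huv.1 hu)
  · exact hA.2.eq_of_forall_adj (f := fun v => φ (pos v))
      (fun a ha b hb hab => hstep a b hab (iff_of_false ha hb)) hu (mt huv.2 hu)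

theorem IsLatticeGraph.isContiguous (h : IsLatticeGraph G W pos) {A : Set V}
    (hA : ∀ f : ℕ × ℕ → Prop, (∀ e : LatEdge, e.src ∈ W → e.tgt ∈ W → e.src ∈ pos '' A →
      e.tgt ∈ pos '' A → f e.src = f e.tgt) → ∀ u ∈ A, ∀ w ∈ A, f (pos u) = f (pos w)) :
    IsContiguous G A := by
  refine isContiguous_of_forall fun f hf u hu w hw => ?_
  have key : ∀ v, (∃ z, pos z = pos v ∧ f z) = f v := fun v =>
    propext ⟨fun ⟨z, hz, hfz⟩ => h.inj hz ▸ hfz, fun hv => ⟨v, rfl, hv⟩⟩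
  have := hA (fun p => ∃ z, pos z = p ∧ f z) ?_ u hu w hw
  · rwa [key, key] at this
  · rintro e - - ⟨a, ha, hsrc⟩ ⟨b, hb, htgt⟩
    rw [← hsrc, ← htgt, key, key]
    exact hf a ha b hb ((h.adj_iff a b).2 ⟨e, Or.inl ⟨hsrc, htgt⟩⟩)

/-- A region in which functions constant along edges avoiding a point are constant off that point
gives a connected graph without cut vertices. -/
theorem IsLatticeGraph.isContiguous_compl_singleton (h : IsLatticeGraph G W pos)
    (hW : ∀ (p : ℕ × ℕ) (f : ℕ × ℕ → Prop), (∀ e : LatEdge, e.src ∈ W → e.tgt ∈ W →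
      e.src ≠ p → e.tgt ≠ p → f e.src = f e.tgt) →
      ∀ u ∈ W, ∀ w ∈ W, u ≠ p → w ≠ p → f u = f w) :
    IsContiguous G Set.univ ∧ ∀ v, IsContiguous G ({v}ᶜ : Set V) := by
  constructor
  · refine h.isContiguous fun f hf u _ w _ => ?_
    -- With the puncture placed outside `W`, the hypothesis gives connectivity of the whole region.
    obtain ⟨p, hp⟩ := Infinite.exists_notMem_finset W
    refine hW p f (fun e h1 h2 _ _ => hf e h1 h2 ?_ ?_) _ (h.mem u) _ (h.mem w)
      (fun hh => hp (hh ▸ h.mem u)) (fun hh => hp (hh ▸ h.mem w))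
    · obtain ⟨a, ha⟩ := h.surj _ h1
      exact ⟨a, trivial, ha⟩
    · obtain ⟨a, ha⟩ := h.surj _ h2
      exact ⟨a, trivial, ha⟩
  · intro v
    refine h.isContiguous fun f hf u hu w hw => ?_
    refine hW (pos v) f (fun e h1 h2 h3 h4 => hf e h1 h2 ?_ ?_) _ (h.mem u) _ (h.mem w)
      (fun hh => hu (h.inj hh)) (fun hh => hw (h.inj hh))
    · obtain ⟨a, ha⟩ := h.surj _ h1
      exact ⟨a, fun hav => h3 (by rw [← ha, Set.mem_singleton_iff.1 hav]), ha⟩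
    · obtain ⟨a, ha⟩ := h.surj _ h2
      exact ⟨a, fun hav => h4 (by rw [← ha, Set.mem_singleton_iff.1 hav]), ha⟩

end LatticeGraph

/-! ### Rows with few color changes -/

section Rows

/-- The positions `i` with `i + 1 < m` at which the row `f` changes its color. -/
def changes (f : ℕ → Bool) (m : ℕ) : Finset ℕ :=
  (Finset.range (m - 1)).filter fun i => f i ≠ f (i + 1)

theorem mem_changes {f : ℕ → Bool} {m i : ℕ} : i ∈ changes f m ↔ i + 1 < m ∧ f i ≠ f (i + 1) := by
  simp only [changes, Finset.mem_filter, Finset.mem_range]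
  have : i < m - 1 ↔ i + 1 < m := by omega
  rw [this]

theorem exists_mem_changes {f : ℕ → Bool} {m i j : ℕ} (hij : i ≤ j) (hj : j < m)
    (h : f i ≠ f j) : ∃ k ∈ changes f m, i ≤ k ∧ k < j := by
  by_contra! hcon
  refine h ?_
  clear h
  induction j, hij using Nat.le_induction with
  | base => rfl
  | succ j hj' ih =>
    rw [ih (by omega) fun k hk hik => (Nat.le_succ j).trans (hcon k hk hik)]
    by_contra hne
    exact absurd (hcon j (mem_changes.2 ⟨hj, hne⟩) hj') (by omega)

/-- A row is determined by its first entry and its changes. -/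
def rowCode (f : ℕ → Bool) (m : ℕ) : Bool × Finset ℕ := (f 0, changes f m)

theorem eq_of_rowCode_eq {f g : ℕ → Bool} {m : ℕ} (h : rowCode f m = rowCode g m) :
    ∀ i < m, f i = g i := by
  simp only [rowCode, Prod.mk.injEq] at h
  intro i
  induction i with
  | zero => exact fun _ => h.1
  | succ i ih =>
    intro hi
    have h1 := ih (by omega)
    have h2 : i ∈ changes f m ↔ i ∈ changes g m := by rw [h.2]
    rw [mem_changes, mem_changes] at h2
    simp only [hi, true_and] at h2
    rw [h1] at h2
    revert h2
    cases g i <;> cases f (i + 1) <;> cases g (i + 1) <;> simp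

/-- The codes of rows of length `m` with at most `k` changes. -/
def rowCodes (m k : ℕ) : Finset (Bool × Finset ℕ) :=
  Finset.univ ×ˢ (Finset.range m).powerset.filter fun s => s.card ≤ k

theorem changes_subset_range (f : ℕ → Bool) (m : ℕ) : changes f m ⊆ Finset.range m := by
  intro i hi
  rw [mem_changes] at hi
  exact Finset.mem_range.2 (by omega)

theorem rowCode_mem_rowCodes {f : ℕ → Bool} {m k : ℕ} (h : (changes f m).card ≤ k) :
    rowCode f m ∈ rowCodes m k := by
  simp only [rowCodes, rowCode, Finset.mem_product, Finset.mem_univ, true_and, Finset.mem_filter,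
    Finset.mem_powerset]
  exact ⟨changes_subset_range f m, h⟩

theorem rowCode_mem_rowCodes_self (f : ℕ → Bool) (m : ℕ) : rowCode f m ∈ rowCodes m m :=
  rowCode_mem_rowCodes ((Finset.card_le_card (changes_subset_range f m)).trans
    (Finset.card_range m).le)

/-- Allowing one more element costs a factor `m + 1`: an element of the range to insert, or the
dummy value `m` for inserting nothing. -/
theorem card_filter_card_le (m k : ℕ) :
    ((Finset.range m).powerset.filter fun s => s.card ≤ k).card ≤ (m + 1) ^ k := by
  induction k with
  | zero =>
    have : ((Finset.range m).powerset.filter fun s => s.card ≤ 0) ⊆ {∅} := by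
      intro s hs
      simp only [Finset.mem_filter, Nat.le_zero, Finset.card_eq_zero] at hs
      simp [hs.2]
    simpa using Finset.card_le_card this
  | succ k ih =>
    have hsub : ((Finset.range m).powerset.filter fun s => s.card ≤ k + 1) ⊆
        (((Finset.range m).powerset.filter fun s => s.card ≤ k) ×ˢ Finset.range (m + 1)).image
          fun q => if q.2 < m then insert q.2 q.1 else q.1 := by
      intro s hs
      simp only [Finset.mem_filter, Finset.mem_powerset] at hs
      simp only [Finset.mem_image, Finset.mem_product, Finset.mem_filter, Finset.mem_powerset,
        Finset.mem_range, Prod.exists]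
      rcases s.eq_empty_or_nonempty with rfl | ⟨a, ha⟩
      · exact ⟨∅, m, by simp, by simp⟩
      · have ham := Finset.mem_range.1 (hs.1 ha)
        refine ⟨s.erase a, a, ⟨⟨(Finset.erase_subset a s).trans hs.1, ?_⟩, by omega⟩, ?_⟩
        · rw [Finset.card_erase_of_mem ha]; omega
        · rw [if_pos ham, Finset.insert_erase ha]
    refine (Finset.card_le_card hsub).trans (Finset.card_image_le.trans ?_)
    rw [Finset.card_product, Finset.card_range, pow_succ]
    exact Nat.mul_le_mul_right _ ih

theorem card_rowCodes_le (m k : ℕ) : (rowCodes m k).card ≤ 2 * (m + 1) ^ k := by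
  rw [rowCodes, Finset.card_product, Finset.card_univ, Fintype.card_bool]
  exact Nat.mul_le_mul_left _ (card_filter_card_le m k)

theorem card_rowCodes_self_le (m : ℕ) : (rowCodes m m).card ≤ 2 * 2 ^ m := by
  rw [rowCodes, Finset.card_product, Finset.card_univ, Fintype.card_bool]
  refine Nat.mul_le_mul_left _ ((Finset.card_filter_le _ _).trans ?_)
  rw [Finset.card_powerset, Finset.card_range]

/-- In a strip of three rows with equal outer rows, in which no monochromatic column separates
two points of the other color, the middle row has few changes. -/
theorem card_changes_middle_le {f g : ℕ → Bool} {m k : ℕ} (hf : (changes f m).card ≤ k)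
    (hsep : ∀ i j l, i < j → j < l → l < m → f j = g j → g i ≠ g j → g l ≠ g j → False) :
    (changes g m).card ≤ k + 2 * (k + 1) := by
  have h1 : (changes g m) ⊆ changes f m ∪ (changes g m \ changes f m) := by
    intro i hi
    by_cases h : i ∈ changes f m <;> simp [hi, h]
  have h2 : (changes g m \ changes f m).card ≤
      ((Finset.univ : Finset Bool) ×ˢ Finset.range (k + 1)).card := by
    refine Finset.card_le_card_of_injOn
      (fun i => (decide (f i = g i), ((changes f m).filter (· < i)).card)) ?_ ?_
    · intro i _
      simp only [Finset.mem_coe, Finset.mem_product, Finset.mem_univ, true_and, Finset.mem_range]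
      exact Nat.lt_succ_of_le ((Finset.card_filter_le _ _).trans hf)
    · have key : ∀ i ∈ changes g m \ changes f m, ∀ j ∈ changes g m \ changes f m, i < j →
          decide (f i = g i) = decide (f j = g j) →
          ((changes f m).filter (· < i)).card = ((changes f m).filter (· < j)).card → False := by
        intro i hi j hj hij hb hc
        simp only [Finset.mem_sdiff, mem_changes, not_and, not_not] at hi hj
        obtain ⟨⟨i1, i2⟩, i3⟩ := hi
        obtain ⟨⟨j1, j2⟩, j3⟩ := hj
        replace i3 := i3 i1
        replace j3 := j3 j1
        have hfij : f i = f j := by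
          by_contra hne
          obtain ⟨t, ht, hit, htj⟩ := exists_mem_changes (m := m) hij.le (by omega) hne
          refine absurd hc (Finset.card_lt_card ⟨fun a ha => ?_, fun hsub => ?_⟩).ne
          · simp only [Finset.mem_filter] at ha ⊢
            exact ⟨ha.1, by omega⟩
          · have := hsub (Finset.mem_filter.2 ⟨ht, htj⟩)
            simp only [Finset.mem_filter] at this
            omega
        -- If `g` leaves `f` at both places, column `j` is monochromatic and lies between `i + 1`
        -- and `j + 1`. If `g` joins `f` at both, column `i + 1` does so between `i` and `j`.
        by_cases hfg : f i = g i
        · have hfg' : f j = g j := by simpa [hfg] using hb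
          have hne : i + 1 ≠ j := by
            intro h
            rw [h] at i2
            exact i2 (by rw [← hfg, ← hfg', hfij])
          refine hsep (i + 1) j (j + 1) (by omega) (by omega) (by omega) hfg' ?_ j2.symm
          rw [← hfg', ← hfij, hfg]
          exact i2.symm
        · have hfg' : ¬ f j = g j := by simpa [hfg] using hb
          have a1 : f (i + 1) = g (i + 1) := by
            rw [← i3]
            revert hfg i2; cases f i <;> cases g i <;> cases g (i + 1) <;> simp
          have hne : i + 1 ≠ j := by
            intro h
            rw [← h] at hfg'
            exact hfg' a1
          refine hsep i (i + 1) j (by omega) (by omega) (by omega) a1 i2 ?_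
          rw [← a1, ← i3, hfij]
          exact fun h => hfg' h.symm
      intro i hi j hj hij
      simp only [Prod.mk.injEq] at hij
      rcases lt_trichotomy i j with h | h | h
      · exact (key i hi j hj h hij.1 hij.2).elim
      · exact h
      · exact (key j hj i hi h hij.1.symm hij.2.symm).elim
  rw [Finset.card_product, Finset.card_univ, Fintype.card_bool, Finset.card_range] at h2
  exact (Finset.card_le_card h1).trans ((Finset.card_union_le _ _).trans (by omega))

end Rows

/-! ### Strips -/

section Strip

/-- `p` and `q` are the ends of the edge `e`. -/
def LatEdge.Joins (e : LatEdge) (p q : ℕ × ℕ) : Prop :=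
  (e.src = p ∧ e.tgt = q) ∨ (e.src = q ∧ e.tgt = p)

theorem LatEdge.Joins.symm {e : LatEdge} {p q : ℕ × ℕ} (h : e.Joins p q) : e.Joins q p := Or.symm h

open Classical in
/-- The pairs of ends of the outer edges at which the color changes. -/
def outerCuts (W : Finset (ℕ × ℕ)) (χ : ℕ × ℕ → Bool) : Finset (Sym2 (ℕ × ℕ)) :=
  ((cutEdges W χ).filter (IsOuter W)).image fun e => s(e.src, e.tgt)

variable {W : Finset (ℕ × ℕ)} {χ : ℕ × ℕ → Bool}

theorem card_outerCuts_le (hW : IsSimplyConn W) (hχ : HasConnClasses W χ) :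
    (outerCuts W χ).card ≤ 2 :=
  Finset.card_image_le.trans (card_outer_cutEdges_le hW hχ)

theorem mem_outerCuts {p q : ℕ × ℕ} (hp : p ∈ W) (hq : q ∈ W) (hχ : χ p ≠ χ q)
    (h : ∃ e : LatEdge, e.Joins p q ∧ IsOuter W e) : s(p, q) ∈ outerCuts W χ := by
  classical
  obtain ⟨e, hj, ho⟩ := h
  refine Finset.mem_image.2 ⟨e, Finset.mem_filter.2 ⟨mem_cutEdges.2 ?_, ho⟩, ?_⟩
  · rcases hj with ⟨h1, h2⟩ | ⟨h1, h2⟩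
    · exact ⟨h1 ▸ hp, h2 ▸ hq, by rwa [h1, h2]⟩
    · exact ⟨h1 ▸ hq, h2 ▸ hp, by rw [h1, h2]; exact hχ.symm⟩
  · rcases hj with ⟨h1, h2⟩ | ⟨h1, h2⟩
    · rw [h1, h2]
    · rw [h1, h2, Sym2.eq_swap]

/-- The points `cell r i` with `r < 3` and `i < m` form a strip of width three in `W` that is
attached to the rest of `W` only along its column `0`. -/
structure IsStrip (W : Finset (ℕ × ℕ)) (m : ℕ) (cell : ℕ → ℕ → ℕ × ℕ) : Prop where
  mem : ∀ r i, r < 3 → i < m → cell r i ∈ W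
  inj : ∀ r i r' i', r < 3 → i < m → r' < 3 → i' < m → cell r i = cell r' i' → r = r' ∧ i = i'
  side : ∀ r i, r = 0 ∨ r = 2 → i + 1 < m →
    ∃ e : LatEdge, e.Joins (cell r i) (cell r (i + 1)) ∧ IsOuter W e
  tip : ∀ r, r < 2 → 0 < m →
    ∃ e : LatEdge, e.Joins (cell r (m - 1)) (cell (r + 1) (m - 1)) ∧ IsOuter W e
  sep : ∀ (e : LatEdge) (r i : ℕ) (q : ℕ × ℕ), r < 3 → i < m → 0 < i → q ∈ W →
    e.Joins (cell r i) q → ∃ r' i', r' < 3 ∧ i' < m ∧ i ≤ i' + 1 ∧ q = cell r' i'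

/-- The row `r` of a coloring of a strip. -/
def stripRow (χ : ℕ × ℕ → Bool) (cell : ℕ → ℕ → ℕ × ℕ) (r : ℕ) : ℕ → Bool := fun i => χ (cell r i)

variable {m : ℕ} {cell : ℕ → ℕ → ℕ × ℕ}

theorem IsStrip.mk_mem_outerCuts (h : IsStrip W m cell) {r k : ℕ} (hr : r = 0 ∨ r = 2)
    (hk : k ∈ changes (stripRow χ cell r) m) :
    s(cell r k, cell r (k + 1)) ∈ outerCuts W χ := by
  rw [mem_changes] at hk
  exact mem_outerCuts (h.mem _ _ (by omega) (by omega)) (h.mem _ _ (by omega) hk.1) hk.2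
    (h.side r k hr hk.1)

theorem IsStrip.card_changes_outer_le (h : IsStrip W m cell) (hW : IsSimplyConn W)
    (hχ : HasConnClasses W χ) {r : ℕ} (hr : r = 0 ∨ r = 2) :
    (changes (stripRow χ cell r) m).card ≤ 2 := by
  refine le_trans ?_ (card_outerCuts_le hW hχ)
  refine Finset.card_le_card_of_injOn (fun k => s(cell r k, cell r (k + 1)))
    (fun k hk => h.mk_mem_outerCuts hr hk) fun k hk k' hk' heq => ?_
  rw [Finset.mem_coe, mem_changes] at hk hk'
  simp only [Sym2.eq_iff] at heq
  have hr3 : r < 3 := by omega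
  rcases heq with ⟨h1, -⟩ | ⟨h1, h2⟩
  · exact (h.inj _ _ _ _ hr3 (by omega) hr3 (by omega) h1).2
  · have e1 := (h.inj _ _ _ _ hr3 (by omega) hr3 (by omega) h1).2
    have e2 := (h.inj _ _ _ _ hr3 (by omega) hr3 (by omega) h2).2
    omega

/-- With equal outer rows, agreement of the middle row with an outer one makes a column
monochromatic. As the strip is attached only along column `0`, such a column cuts off everything of
the other color beyond it. The bound is `2 + 2 * (2 + 1)`. -/
theorem IsStrip.card_changes_middle_le (h : IsStrip W m cell) (hW : IsSimplyConn W)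
    (hχ : HasConnClasses W χ) (heq : ∀ i < m, χ (cell 0 i) = χ (cell 2 i)) :
    (changes (stripRow χ cell 1) m).card ≤ 8 := by
  classical
  refine ConnPart.card_changes_middle_le (h.card_changes_outer_le hW hχ (Or.inl rfl))
    fun i j l hij hjl hl h1 h2 h3 => ?_
  simp only [stripRow] at h1 h2 h3
  have hcol : ∀ r < 3, χ (cell r j) = χ (cell 1 j) := by
    intro r hr
    have := heq j (by omega)
    interval_cases r
    · exact h1
    · rfl
    · rw [← this, h1]
  -- The indicator of the cells beyond column `j` of the color not used in that column: no
  -- monochromatic edge leaves this set.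
  let φ : ℕ × ℕ → ZMod 2 := fun p =>
    if χ p ≠ χ (cell 1 j) ∧ ∃ r k, r < 3 ∧ j < k ∧ k < m ∧ p = cell r k then 1 else 0
  have hstep : ∀ (e : LatEdge) (p q : ℕ × ℕ), e.Joins p q → q ∈ W → χ p = χ q →
      (χ p ≠ χ (cell 1 j) ∧ ∃ r k, r < 3 ∧ j < k ∧ k < m ∧ p = cell r k) →
      (χ q ≠ χ (cell 1 j) ∧ ∃ r k, r < 3 ∧ j < k ∧ k < m ∧ q = cell r k) := by
    rintro e p q he hq hpq ⟨hp, r, k, hr, hjk, hk, rfl⟩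
    rw [hpq] at hp
    obtain ⟨r', k', hr', hk', hkk, rfl⟩ := h.sep e r k q hr hk (by omega) hq he
    refine ⟨hp, r', k', hr', ?_, hk', rfl⟩
    rcases (show j ≤ k' by omega).lt_or_eq with hlt | heq'
    · exact hlt
    · subst heq'
      exact absurd (hcol r' hr') hp
  have := hχ φ (fun e hs ht hc => if_congr
    ⟨hstep e _ _ (Or.inl ⟨rfl, rfl⟩) ht hc, hstep e _ _ (Or.inr ⟨rfl, rfl⟩) hs hc.symm⟩ rfl rfl)
    (cell 1 i) (h.mem _ _ (by omega) (by omega)) (cell 1 l) (h.mem _ _ (by omega) hl) (by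
      revert h2 h3
      cases χ (cell 1 i) <;> cases χ (cell 1 l) <;> cases χ (cell 1 j) <;> simp)
  have e1 : φ (cell 1 l) = 1 := if_pos ⟨h3, 1, l, by omega, hjl, hl, rfl⟩
  have e2 : φ (cell 1 i) = 0 := if_neg (by
    rintro ⟨-, r, k, hr, hjk, hk, hik⟩
    have := (h.inj _ _ _ _ (by omega) (by omega) hr hk hik).2
    omega)
  rw [e1, e2] at this
  exact zero_ne_one this

/-- If the ends of column `i` have different colors, then the color changes along the outer
boundary beyond column `i`. -/
theorem IsStrip.exists_mem_outerCuts (h : IsStrip W m cell) {i : ℕ} (hi : i < m)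
    (hne : χ (cell 0 i) ≠ χ (cell 2 i)) :
    ∃ r k r' k', r < 3 ∧ r' < 3 ∧ i ≤ k ∧ i ≤ k' ∧ k < m ∧ k' < m ∧
      s(cell r k, cell r' k') ∈ outerCuts W χ := by
  -- The boundary beyond column `i` runs along row `0`, across the tip and back along row `2`. Its
  -- two ends differ in color, so one of these three parts contains a change.
  have hrow : ∀ r, r = 0 ∨ r = 2 → χ (cell r i) ≠ χ (cell r (m - 1)) →
      ∃ r k r' k', r < 3 ∧ r' < 3 ∧ i ≤ k ∧ i ≤ k' ∧ k < m ∧ k' < m ∧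
        s(cell r k, cell r' k') ∈ outerCuts W χ := by
    intro r hr hc
    obtain ⟨k, hk, h1, h2⟩ := exists_mem_changes (f := stripRow χ cell r) (m := m)
      (show i ≤ m - 1 by omega) (by omega) hc
    exact ⟨r, k, r, k + 1, by omega, by omega, h1, by omega, by omega, by omega,
      h.mk_mem_outerCuts hr hk⟩
  by_cases h0 : χ (cell 0 i) = χ (cell 0 (m - 1))
  swap
  · exact hrow 0 (Or.inl rfl) h0
  by_cases h2 : χ (cell 2 i) = χ (cell 2 (m - 1))
  swap
  · exact hrow 2 (Or.inr rfl) h2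
  rw [h0, h2] at hne
  have htip : ∀ r < 2, χ (cell r (m - 1)) ≠ χ (cell (r + 1) (m - 1)) →
      s(cell r (m - 1), cell (r + 1) (m - 1)) ∈ outerCuts W χ := fun r hr hc =>
    mem_outerCuts (h.mem _ _ (by omega) (by omega)) (h.mem _ _ (by omega) (by omega)) hc
      (h.tip r hr (by omega))
  by_cases h1 : χ (cell 0 (m - 1)) = χ (cell 1 (m - 1))
  · rw [h1] at hne
    exact ⟨1, m - 1, 2, m - 1, by omega, by omega, by omega, by omega, by omega, by omega,
      htip 1 (by omega) hne⟩
  · exact ⟨0, m - 1, 1, m - 1, by omega, by omega, by omega, by omega, by omega, by omega,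
      htip 0 (by omega) h1⟩

/-- In a strip, the ends of two columns cannot be colored in opposite ways. -/
theorem IsStrip.not_opposite (h : IsStrip W m cell) (hW : IsSimplyConn W)
    (hχ : HasConnClasses W χ) {i j : ℕ} (hij : i < j) (hj : j < m)
    (hi0 : χ (cell 0 i) ≠ χ (cell 2 i)) (h0 : χ (cell 0 i) ≠ χ (cell 0 j))
    (h2 : χ (cell 2 i) ≠ χ (cell 2 j)) : False := by
  classical
  obtain ⟨k, hk, hk1, hk2⟩ := exists_mem_changes (f := stripRow χ cell 0) (m := m) hij.le hj h0
  obtain ⟨l, hl, hl1, hl2⟩ := exists_mem_changes (f := stripRow χ cell 2) (m := m) hij.le hj h2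
  -- Both outer rows change between columns `i` and `j`. The ends of column `j` differ as well,
  -- which forces a third change beyond it.
  obtain ⟨r, a, r', a', hr, hr', ha, ha', ham, ham', hmem⟩ :=
    h.exists_mem_outerCuts (χ := χ) hj (by
      revert hi0 h0 h2
      cases χ (cell 0 i) <;> cases χ (cell 2 i) <;> cases χ (cell 0 j) <;>
        cases χ (cell 2 j) <;> simp)
  have m1 := h.mk_mem_outerCuts (Or.inl rfl) hk
  have m2 := h.mk_mem_outerCuts (Or.inr rfl) hl
  rw [mem_changes] at hk hl
  have ne1 : s(cell 0 k, cell 0 (k + 1)) ≠ s(cell 2 l, cell 2 (l + 1)) := by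
    intro heq
    rw [Sym2.eq_iff] at heq
    rcases heq with ⟨h1, -⟩ | ⟨h1, -⟩ <;>
    · have := (h.inj _ _ _ _ (by omega) (by omega) (by omega) (by omega) h1).1
      omega
  have ne2 : ∀ t b, t < 3 → b < j → ∀ q, s(cell t b, q) ≠ s(cell r a, cell r' a') := by
    intro t b ht hb q heq
    rw [Sym2.eq_iff] at heq
    rcases heq with ⟨h1, -⟩ | ⟨h1, -⟩ <;>
    · have := (h.inj _ _ _ _ (by omega) (by omega) (by omega) (by omega) h1).2
      omega
  have hle := card_outerCuts_le hW hχ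
  have : 2 < (outerCuts W χ).card := Finset.two_lt_card.2
    ⟨_, m1, _, m2, _, hmem, ne1, ne2 _ _ (by omega) hk2 _, ne2 _ _ (by omega) hl2 _⟩
  omega

end Strip

theorem IsSplit.compl {V : Type*} {G : SimpleGraph V} {A : Set V} (h : IsSplit G A) :
    IsSplit G Aᶜ := ⟨h.2, by rw [compl_compl]; exact h.1⟩

/-! ### The grid of width three -/

section Grid

/-- The coordinates of a vertex of a grid. -/
def gridPos {k ℓ : ℕ} (v : Fin k × Fin ℓ) : ℕ × ℕ := (v.1, v.2)

theorem gridPos_injective {k ℓ : ℕ} : Function.Injective (gridPos (k := k) (ℓ := ℓ)) := by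
  rintro ⟨a, b⟩ ⟨c, d⟩ h
  simp only [gridPos, Prod.mk.injEq] at h
  exact Prod.ext (Fin.ext h.1) (Fin.ext h.2)

theorem exists_latEdge_iff {p q : ℕ × ℕ} : (∃ e : LatEdge, p = e.src ∧ q = e.tgt) ↔
    (p.1 = q.1 ∧ p.2 + 1 = q.2) ∨ (p.1 + 1 = q.1 ∧ p.2 = q.2) := by
  obtain ⟨x, y⟩ := p
  obtain ⟨x', y'⟩ := q
  constructor
  · rintro ⟨⟨a, b, d⟩, h1, h2⟩
    cases d <;> simp [LatEdge.src, LatEdge.tgt] at h1 h2 <;> simp <;> omega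
  · rintro (⟨h1, h2⟩ | ⟨h1, h2⟩)
    · exact ⟨(x, y, true), by simp [LatEdge.src], by simp at h1 h2; simp [LatEdge.tgt, h1, h2]⟩
    · exact ⟨(x, y, false), by simp [LatEdge.src], by simp at h1 h2; simp [LatEdge.tgt, h1, h2]⟩

theorem gridGraph_adj_iff {k ℓ : ℕ} {u v : Fin k × Fin ℓ} : (gridGraph k ℓ).Adj u v ↔
    (u.1.1 = v.1.1 ∧ (u.2.1 + 1 = v.2.1 ∨ v.2.1 + 1 = u.2.1)) ∨
    (u.2.1 = v.2.1 ∧ (u.1.1 + 1 = v.1.1 ∨ v.1.1 + 1 = u.1.1)) := by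
  rw [gridGraph, SimpleGraph.boxProd_adj, SimpleGraph.pathGraph_adj, SimpleGraph.pathGraph_adj,
    Fin.ext_iff, Fin.ext_iff]
  omega

theorem gridGraph_adj_iff_latEdge {k ℓ : ℕ} {u v : Fin k × Fin ℓ} : (gridGraph k ℓ).Adj u v ↔
    ∃ e : LatEdge, (gridPos u = e.src ∧ gridPos v = e.tgt) ∨
      (gridPos v = e.src ∧ gridPos u = e.tgt) := by
  rw [exists_or, exists_latEdge_iff, exists_latEdge_iff, gridGraph_adj_iff]
  simp only [gridPos]
  omega

theorem isLatticeGraph_gridGraph (k ℓ : ℕ) :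
    IsLatticeGraph (gridGraph k ℓ) (rect 0 k 0 ℓ) gridPos where
  inj := gridPos_injective
  mem v := mem_rect.2 ⟨⟨Nat.zero_le _, v.1.2⟩, Nat.zero_le _, v.2.2⟩
  surj p hp := by
    obtain ⟨⟨-, h1⟩, -, h2⟩ := mem_rect.1 hp
    exact ⟨(⟨p.1, h1⟩, ⟨p.2, h2⟩), rfl⟩
  adj_iff u v := gridGraph_adj_iff_latEdge

theorem LatEdge.Joins.coords {e : LatEdge} {p q : ℕ × ℕ} (h : e.Joins p q) :
    (p.1 = q.1 ∧ (p.2 + 1 = q.2 ∨ q.2 + 1 = p.2)) ∨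
    (p.2 = q.2 ∧ (p.1 + 1 = q.1 ∨ q.1 + 1 = p.1)) := by
  rcases h with ⟨rfl, rfl⟩ | ⟨rfl, rfl⟩
  · have := exists_latEdge_iff.1 ⟨e, rfl, rfl⟩
    omega
  · have := exists_latEdge_iff.1 ⟨e, rfl, rfl⟩
    omega

theorem joins_vertical (x y : ℕ) : LatEdge.Joins (x, y, true) (x, y) (x, y + 1) :=
  Or.inl ⟨rfl, rfl⟩

theorem joins_horizontal (x y : ℕ) : LatEdge.Joins (x, y, false) (x, y) (x + 1, y) :=
  Or.inl ⟨rfl, rfl⟩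

theorem isSide_vertical_iff {x y : ℕ} {s : ℕ × ℕ} :
    IsSide (x, y, true) s ↔ s.2 = y ∧ (s.1 = x ∨ s.1 + 1 = x) := by
  simp only [IsSide, sqBot, sqLeft, sqTop, sqRight, Prod.mk.injEq]
  simp
  omega

theorem isSide_horizontal_iff {x y : ℕ} {s : ℕ × ℕ} :
    IsSide (x, y, false) s ↔ s.1 = x ∧ (s.2 = y ∨ s.2 + 1 = y) := by
  simp only [IsSide, sqBot, sqLeft, sqTop, sqRight, Prod.mk.injEq]
  simp
  omega

/-- Only the squares to the left and to the right can have this edge as a side, so excluding either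
suffices. Writing `x' + 1 = x` avoids truncated subtraction at `x = 0`. -/
theorem isOuter_vertical {W : Finset (ℕ × ℕ)} {x y : ℕ}
    (h : ¬ IsSquare W (x, y) ∨ ∀ x', x' + 1 = x → ¬ IsSquare W (x', y)) :
    IsOuter W (x, y, true) := by
  rintro ⟨a, b⟩ ⟨c, d⟩ hs hs' h1 h2
  rw [isSide_vertical_iff] at h1 h2
  obtain ⟨rfl, h1⟩ := h1
  obtain ⟨h3, h2⟩ := h2
  simp only at h1 h2 h3
  subst h3
  rcases h1 with rfl | h1 <;> rcases h2 with rfl | h2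
  · rfl
  · rcases h with h | h
    · exact absurd hs h
    · exact absurd hs' (h c h2)
  · rcases h with h | h
    · exact absurd hs' h
    · exact absurd hs (h a h1)
  · rw [show a = c by omega]

theorem isOuter_horizontal {W : Finset (ℕ × ℕ)} {x y : ℕ}
    (h : ¬ IsSquare W (x, y) ∨ ∀ y', y' + 1 = y → ¬ IsSquare W (x, y')) :
    IsOuter W (x, y, false) := by
  rintro ⟨a, b⟩ ⟨c, d⟩ hs hs' h1 h2
  rw [isSide_horizontal_iff] at h1 h2
  obtain ⟨rfl, h1⟩ := h1
  obtain ⟨h3, h2⟩ := h2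
  simp only at h1 h2 h3
  subst h3
  rcases h1 with rfl | h1 <;> rcases h2 with rfl | h2
  · rfl
  · rcases h with h | h
    · exact absurd hs h
    · exact absurd hs' (h d h2)
  · rcases h with h | h
    · exact absurd hs' h
    · exact absurd hs (h b h1)
  · rw [show b = d by omega]

theorem isStrip_rect (ℓ : ℕ) : IsStrip (rect 0 3 0 ℓ) ℓ fun r i => (r, i) where
  mem r i hr hi := mem_rect.2 ⟨⟨Nat.zero_le _, hr⟩, Nat.zero_le _, hi⟩
  inj r i r' i' _ _ _ _ h := by simpa using h
  side r i hr hi := by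
    refine ⟨_, joins_vertical r i, isOuter_vertical ?_⟩
    rcases hr with rfl | rfl
    · exact Or.inr fun x' hx' => absurd hx' (Nat.succ_ne_zero x')
    · left
      simp only [IsSquare, mem_rect]
      omega
  tip r hr hm := by
    refine ⟨_, joins_horizontal r (ℓ - 1), isOuter_horizontal (Or.inl ?_)⟩
    simp only [IsSquare, mem_rect]
    omega
  sep e r i q hr hi h0 hq he := by
    have := he.coords
    rw [mem_rect] at hq
    exact ⟨q.1, q.2, by omega, by omega, by simp only at this; omega, rfl⟩

theorem isPeelable_gridGraph_two_le {ℓ : ℕ} (h : 2 ≤ ℓ) :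
    IsContiguous (gridGraph 3 ℓ) Set.univ ∧ IsPeelable (gridGraph 3 ℓ) := by
  have := (isLatticeGraph_gridGraph 3 ℓ).isContiguous_compl_singleton
    fun p f hf u hu w hw hup hwp => rect_punctured (by omega) (by omega) p hf hu hw hup hwp
  exact ⟨this.1, isPeelable_of_forall_compl_singleton this.1 this.2⟩

theorem isContiguous_univ_gridGraph_one : IsContiguous (gridGraph 3 1) Set.univ := by
  refine isContiguous_of_rank (0, 0) (fun v => v.1) ?_
  rintro ⟨a, b⟩ -
  fin_cases b
  fin_cases a
  · exact Or.inl rfl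
  · exact Or.inr ⟨(0, 0), trivial, by simp [gridGraph_adj_iff], by simp⟩
  · exact Or.inr ⟨(1, 0), trivial, by simp [gridGraph_adj_iff], by simp⟩

/-- The path on three vertices has a cut vertex, so the general criterion does not apply. Contiguity
here means that the middle is present whenever both ends are, and all subsets are checked. -/
theorem isPeelable_gridGraph_one : IsPeelable (gridGraph 3 1) := by
  have hcases : ∀ v : Fin 3 × Fin 1, v = (0, 0) ∨ v = (1, 0) ∨ v = (2, 0) := by decide
  have hno : ∀ A : Set (Fin 3 × Fin 1), IsContiguous (gridGraph 3 1) A → (0, 0) ∈ A →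
      (2, 0) ∈ A → (1, 0) ∈ A := by
    intro A hA h0 h2
    by_contra h1
    have := isContiguous_iff.1 hA {(0, 0)} (by simpa using h0) ⟨_, rfl⟩ ?_ h2
    · simp at this
    · rintro u rfl w hw huw
      rcases hcases w with rfl | rfl | rfl
      · rfl
      · exact absurd hw h1
      · simp [gridGraph_adj_iff] at huw
  have hyes : ∀ A : Set (Fin 3 × Fin 1), ((0, 0) ∈ A → (2, 0) ∈ A → (1, 0) ∈ A) →
      IsContiguous (gridGraph 3 1) A := by
    intro A hA
    refine isContiguous_of_forall fun f hf => ?_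
    have e1 : (0, 0) ∈ A → (1, 0) ∈ A → f (0, 0) = f (1, 0) := fun h h' =>
      hf _ h _ h' (by simp [gridGraph_adj_iff])
    have e2 : (1, 0) ∈ A → (2, 0) ∈ A → f (1, 0) = f (2, 0) := fun h h' =>
      hf _ h _ h' (by simp [gridGraph_adj_iff])
    intro u hu w hw
    rcases hcases u with rfl | rfl | rfl <;> rcases hcases w with rfl | rfl | rfl
    · rfl
    · exact e1 hu hw
    · exact (e1 hu (hA hu hw)).trans (e2 (hA hu hw) hw)
    · exact (e1 hw hu).symm
    · rfl
    · exact e2 hu hw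
    · exact ((e1 hw (hA hw hu)).trans (e2 (hA hw hu) hu)).symm
    · exact (e2 hw hu).symm
    · rfl
  rintro A ⟨hA, hB⟩ ⟨a, ha⟩
  have h1 := hno A hA
  have h2 := hno Aᶜ hB
  have hgood : ∀ v, ((0, 0) ∈ A \ {v} → (2, 0) ∈ A \ {v} → (1, 0) ∈ A \ {v}) →
      ((0, 0) ∈ (A \ {v})ᶜ → (2, 0) ∈ (A \ {v})ᶜ → (1, 0) ∈ (A \ {v})ᶜ) →
      IsSplit (gridGraph 3 1) (A \ {v}) := fun v h h' => ⟨hyes _ h, hyes _ h'⟩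
  simp only [Set.mem_compl_iff] at h2
  by_cases m0 : (0, 0) ∈ A <;> by_cases m1 : (1, 0) ∈ A <;> by_cases m2 : (2, 0) ∈ A
  · exact ⟨(0, 0), m0, hgood _ (by simp) (by simp [m2])⟩
  · exact ⟨(1, 0), m1, hgood _ (by simp [m2]) (by simp)⟩
  · exact absurd (h1 m0 m2) m1
  · exact ⟨(0, 0), m0, hgood _ (by simp) (by simp [m1])⟩
  · exact ⟨(1, 0), m1, hgood _ (by simp [m0]) (by simp)⟩
  · exact absurd m1 (h2 m0 m2)
  · exact ⟨(2, 0), m2, hgood _ (by simp) (by simp [m1])⟩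
  · rcases hcases a with rfl | rfl | rfl <;> contradiction

theorem isErgodicChain_colorChain_gridGraph {ℓ : ℕ} (h : 1 ≤ ℓ) :
    IsErgodicChain (colorChain (gridGraph 3 ℓ) 2) (uniformDist _) := by
  have : Nonempty (Fin 3 × Fin ℓ) := ⟨(0, ⟨0, h⟩)⟩
  rcases h.eq_or_lt with rfl | h
  · exact isErgodicChain_colorChain isContiguous_univ_gridGraph_one isPeelable_gridGraph_one
  · exact isErgodicChain_colorChain (isPeelable_gridGraph_two_le h).1
      (isPeelable_gridGraph_two_le h).2

/-- The color classes of a state, as a coloring of lattice points. -/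
def ConnColoring.mark {ℓ : ℕ} (ω : ConnColoring (gridGraph 3 ℓ) 2) : ℕ × ℕ → Bool :=
  markSet gridPos {v | ω.1 v = 0}

theorem ConnColoring.mark_pos {ℓ : ℕ} (ω : ConnColoring (gridGraph 3 ℓ) 2) (v : Fin 3 × Fin ℓ) :
    ω.mark (gridPos v) = true ↔ ω.1 v = 0 :=
  (isLatticeGraph_gridGraph 3 ℓ).markSet_pos _ v

theorem ConnColoring.hasConnClasses_mark {ℓ : ℕ} (ω : ConnColoring (gridGraph 3 ℓ) 2) :
    HasConnClasses (rect 0 3 0 ℓ) ω.mark :=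
  (isLatticeGraph_gridGraph 3 ℓ).hasConnClasses ω.isSplit

/-- One outer row and an arbitrary part of the middle row. -/
def outerRowSet (ℓ : ℕ) (b : Finset (Fin ℓ)) : Set (Fin 3 × Fin ℓ) :=
  {v | v.1 = 0 ∨ (v.1 = 1 ∧ v.2 ∈ b)}

/-- Each side contains a full outer row, and every remaining cell lies in the middle row, attached
to that row directly. -/
theorem isSplit_outerRowSet {ℓ : ℕ} (h : 1 ≤ ℓ) (b : Finset (Fin ℓ)) :
    IsSplit (gridGraph 3 ℓ) (outerRowSet ℓ b) := by
  have hone : ∀ (o : Fin 3), o = 0 ∨ o = 2 → ∀ A : Set (Fin 3 × Fin ℓ),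
      (∀ v ∈ A, v.1 = o ∨ v.1 = 1) → (∀ j, (o, j) ∈ A) → IsContiguous (gridGraph 3 ℓ) A := by
    intro o ho A hA hrow
    refine isContiguous_of_rank (o, ⟨0, h⟩) (fun v => v.2 + if v.1 = o then 0 else 1) ?_
    rintro ⟨x, y⟩ hv
    by_cases hx : x = o
    · subst hx
      rcases Nat.eq_zero_or_pos y with hy | hy
      · exact Or.inl (Prod.ext rfl (Fin.ext hy))
      · refine Or.inr ⟨(x, ⟨y - 1, by omega⟩), hrow _, ?_, ?_⟩
        · exact gridGraph_adj_iff.2 (Or.inl ⟨rfl, Or.inr (Nat.sub_add_cancel hy)⟩)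
        · simp only [if_true, add_zero]
          exact Nat.sub_lt hy Nat.one_pos
    · have hx1 : x = 1 := (hA _ hv).resolve_left hx
      refine Or.inr ⟨(o, y), hrow y, ?_, ?_⟩
      · rw [gridGraph_adj_iff]
        rcases ho with rfl | rfl <;> simp [hx1]
      · simp [hx]
  refine ⟨hone 0 (Or.inl rfl) _ ?_ ?_, hone 2 (Or.inr rfl) _ ?_ ?_⟩
  · rintro ⟨x, y⟩ (hv | hv)
    · exact Or.inl hv
    · exact Or.inr hv.1
  · exact fun j => Or.inl rfl
  · rintro ⟨x, y⟩ hv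
    simp only [outerRowSet, Set.mem_compl_iff, Set.mem_ofPred_eq, not_or] at hv
    obtain ⟨h1, -⟩ := hv
    revert h1
    fin_cases x <;> simp
  · intro j
    simp [outerRowSet]

theorem outerRowSet_injective (ℓ : ℕ) : Function.Injective (outerRowSet ℓ) := by
  intro b b' h
  ext j
  have : ((1 : Fin 3), j) ∈ outerRowSet ℓ b ↔ ((1 : Fin 3), j) ∈ outerRowSet ℓ b' := by rw [h]
  simpa [outerRowSet] using this

theorem coloringOf_inj {V : Type*} {G : SimpleGraph V} {A B : Set V} {hA : IsSplit G A}
    {hB : IsSplit G B} (h : coloringOf G A hA = coloringOf G B hB) : A = B := by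
  ext v
  rw [← coloringOf_eq_zero hA, h, coloringOf_eq_zero hB]

theorem two_pow_le_card_of_injective {Ω : Type*} {n : ℕ} (S : Finset Ω)
    (F : Finset (Fin n) → Ω) (hF : Function.Injective F) (hS : ∀ b, F b ∈ S) :
    2 ^ n ≤ S.card := by
  have := Finset.card_le_card_of_injOn (s := Finset.univ) F (fun b _ => hS b) hF.injOn
  simpa using this

/-- The states for which some column of the grid has the color `0` only at its first end. -/
def tiltedStates (ℓ : ℕ) : Finset (ConnColoring (gridGraph 3 ℓ) 2) :=
  open Classical in Finset.univ.filter fun ω => ∃ i < ℓ, ω.mark (0, i) = true ∧ ω.mark (2, i) = false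

/-- The states for which both ends of each column of the grid have the same color. -/
def levelStates (ℓ : ℕ) : Finset (ConnColoring (gridGraph 3 ℓ) 2) :=
  open Classical in Finset.univ.filter fun ω => ∀ i < ℓ, ω.mark (0, i) = ω.mark (2, i)

/-- Opposite tilts would force three color changes along the boundary. Only the order of the two
columns has to be sorted out. -/
theorem not_tilted_both {ℓ : ℕ} (ω : ConnColoring (gridGraph 3 ℓ) 2) {i j : ℕ} (hi : i < ℓ)
    (hj : j < ℓ) (h1 : ω.mark (0, i) = true) (h2 : ω.mark (2, i) = false)
    (h3 : ω.mark (0, j) = false) (h4 : ω.mark (2, j) = true) : False := by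
  have hs := isStrip_rect ℓ
  have hsc := isSimplyConn_rect 0 3 0 ℓ
  rcases lt_trichotomy i j with h | rfl | h
  · exact hs.not_opposite hsc ω.hasConnClasses_mark h hj (by simp [h1, h2]) (by simp [h1, h3])
      (by simp [h2, h4])
  · simp [h1] at h3
  · exact hs.not_opposite hsc ω.hasConnClasses_mark h hi (by simp [h3, h4]) (by simp [h1, h3])
      (by simp [h2, h4])

theorem mark_eq_of_colorChain_ne_zero {ℓ : ℕ} {ω ω' : ConnColoring (gridGraph 3 ℓ) 2}
    (h : colorChain (gridGraph 3 ℓ) 2 ω ω' ≠ 0) :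
    ∃ p, ∀ x i, x < 3 → i < ℓ → (x, i) ≠ p → ω.mark (x, i) = ω'.mark (x, i) := by
  have key : ∀ x i, ∀ hx : x < 3, ∀ hi : i < ℓ, ω.1 (⟨x, hx⟩, ⟨i, hi⟩) = ω'.1 (⟨x, hx⟩, ⟨i, hi⟩) →
      ω.mark (x, i) = ω'.mark (x, i) := by
    intro x i hx hi h
    have e1 := ω.mark_pos (⟨x, hx⟩, ⟨i, hi⟩)
    have e2 := ω'.mark_pos (⟨x, hx⟩, ⟨i, hi⟩)
    rw [Bool.eq_iff_iff]
    exact e1.trans (by rw [h]; exact e2.symm)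
  rcases exists_of_colorChain_ne_zero h with rfl | ⟨v, hv⟩
  · exact ⟨(0, 0), fun _ _ _ _ _ => rfl⟩
  · refine ⟨gridPos v, fun x i hx hi hne => key x i hx hi (hv _ ?_)⟩
    rintro rfl
    exact hne rfl

theorem ConnColoring.eq_of_mark_eq {ℓ : ℕ} {ω ω' : ConnColoring (gridGraph 3 ℓ) 2}
    (h : ∀ x i, x < 3 → i < ℓ → ω.mark (x, i) = ω'.mark (x, i)) : ω = ω' := by
  refine ConnColoring.ext fun v => ?_
  have e1 := ω.mark_pos v
  have e2 := ω'.mark_pos v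
  rw [show gridPos v = (v.1.1, v.2.1) from rfl] at e1 e2
  rw [h _ _ v.1.2 v.2.2, e2] at e1
  omega

/-- A state is determined by the codes of its three rows, and with equal column ends each row has at
most eight changes. -/
theorem card_levelStates_le (ℓ : ℕ) : (levelStates ℓ).card ≤ (2 * (ℓ + 1) ^ 8) ^ 3 := by
  have h1 : (levelStates ℓ).card ≤ (Fintype.piFinset fun _ : Fin 3 => rowCodes ℓ 8).card := by
    refine Finset.card_le_card_of_injOn
      (fun ω r => rowCode (stripRow ω.mark (fun r i => (r, i)) r) ℓ) ?_ ?_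
    · intro ω hω
      simp only [levelStates, Finset.coe_filter, Finset.mem_univ, true_and, Set.mem_ofPred_eq] at hω
      rw [Finset.mem_coe, Fintype.mem_piFinset]
      have hs := isStrip_rect ℓ
      have hsc := isSimplyConn_rect 0 3 0 ℓ
      intro r
      refine rowCode_mem_rowCodes ?_
      fin_cases r
      · exact (hs.card_changes_outer_le hsc ω.hasConnClasses_mark (Or.inl rfl)).trans (by omega)
      · exact hs.card_changes_middle_le hsc ω.hasConnClasses_mark hω
      · exact (hs.card_changes_outer_le hsc ω.hasConnClasses_mark (Or.inr rfl)).trans (by omega)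
    · intro ω _ ω' _ h
      refine ConnColoring.eq_of_mark_eq fun x i hx hi => ?_
      exact eq_of_rowCode_eq (congrFun h ⟨x, hx⟩) i hi
  rw [Fintype.card_piFinset, Finset.prod_const, Finset.card_univ, Fintype.card_fin] at h1
  exact h1.trans (Nat.pow_le_pow_left (card_rowCodes_le ℓ 8) 3)

/-- Outside the tilted and the level states some column is tilted the other way. The free middle row
between constant outer rows provides `2 ^ ℓ` states on each side. -/
theorem hasBottleneck_colorChain_gridGraph {ℓ : ℕ} (h : 1 ≤ ℓ) :
    HasBottleneck (colorChain (gridGraph 3 ℓ) 2) (1 * 2 ^ ℓ) (2 ^ 27 * (ℓ : ℝ) ^ 24) := by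
  classical
  have hmem : ∀ ω : ConnColoring (gridGraph 3 ℓ) 2, ω ∈ (tiltedStates ℓ ∪ levelStates ℓ)ᶜ →
      ∃ i < ℓ, ω.mark (0, i) = false ∧ ω.mark (2, i) = true := by
    intro ω hω
    simp only [tiltedStates, levelStates, Finset.mem_compl, Finset.mem_union, Finset.mem_filter,
      Finset.mem_univ, true_and, not_or, not_forall] at hω
    obtain ⟨h1, i, hi, h2⟩ := hω
    refine ⟨i, hi, ?_⟩
    by_contra hcon
    refine h1 ⟨i, hi, ?_⟩
    revert h2 hcon
    cases ω.mark (0, i) <;> cases ω.mark (2, i) <;> simp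
  have hmark : ∀ (A : Set (Fin 3 × Fin ℓ)) (hA : IsSplit (gridGraph 3 ℓ) A) (v : Fin 3 × Fin ℓ),
      (coloringOf _ A hA).mark (gridPos v) = true ↔ v ∈ A := fun A hA v =>
    ((coloringOf _ A hA).mark_pos v).trans (coloringOf_eq_zero hA v)
  have hsym : ∀ ω ω', colorChain (gridGraph 3 ℓ) 2 ω' ω ≠ 0 →
      colorChain (gridGraph 3 ℓ) 2 ω ω' ≠ 0 := fun ω ω' h => by
    exact fun h' => h ((colorChain_isSymm.apply ω ω').trans h')
  have hcross : ∀ ω ∈ tiltedStates ℓ, ∀ ω' ∈ (tiltedStates ℓ ∪ levelStates ℓ)ᶜ,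
      colorChain (gridGraph 3 ℓ) 2 ω ω' = 0 := by
    intro ω hω ω' hω'
    by_contra hne
    obtain ⟨p, hp⟩ := mark_eq_of_colorChain_ne_zero hne
    simp only [tiltedStates, Finset.mem_filter, Finset.mem_univ, true_and] at hω
    obtain ⟨i, hi, h1, h2⟩ := hω
    obtain ⟨j, hj, h3, h4⟩ := hmem ω' hω'
    -- Only the cell `p` may change. If it is outside column `i`, the tilt at `i` survives next to
    -- the opposite one at `j`. If it is in column `i ≠ j`, the opposite tilt at `j` was already
    -- present. For `i = j` both ends would have to change.
    by_cases hpi : p.2 = i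
    · have e0 : i ≠ j → ω.mark (0, j) = ω'.mark (0, j) := fun hij => hp 0 j (by omega) hj (by
        rintro rfl; exact hij hpi.symm)
      have e2 : i ≠ j → ω.mark (2, j) = ω'.mark (2, j) := fun hij => hp 2 j (by omega) hj (by
        rintro rfl; exact hij hpi.symm)
      by_cases hij : i = j
      · subst hij
        have f0 := hp 0 i (by omega) hi
        have f2 := hp 2 i (by omega) hi
        rw [h1, h3] at f0
        rw [h2, h4] at f2
        have g0 : (0, i) = p := by by_contra hh; simpa using f0 hh
        have g2 : (2, i) = p := by by_contra hh; simpa using f2 hh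
        rw [← g2] at g0
        simp at g0
      · exact not_tilted_both ω hi hj h1 h2 ((e0 hij).trans h3) ((e2 hij).trans h4)
    · have e0 := hp 0 i (by omega) hi (by rintro rfl; exact hpi rfl)
      have e2 := hp 2 i (by omega) hi (by rintro rfl; exact hpi rfl)
      exact not_tilted_both ω' hi hj (e0 ▸ h1) (e2 ▸ h2) h3 h4
  refine ⟨tiltedStates ℓ, levelStates ℓ, ?_, fun ω hω ω' hω' => ⟨hcross ω hω ω' hω', ?_⟩,
    ?_, ?_, ?_⟩
  · refine Finset.disjoint_left.2 fun ω h1 h2 => ?_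
    simp only [tiltedStates, levelStates, Finset.mem_filter, Finset.mem_univ, true_and] at h1 h2
    obtain ⟨i, hi, h3, h4⟩ := h1
    have := h2 i hi
    rw [h3, h4] at this
    simp at this
  · by_contra hne
    exact hsym ω ω' hne (hcross ω hω ω' hω')
  · rw [one_mul]
    have := two_pow_le_card_of_injective (tiltedStates ℓ)
      (fun b => coloringOf _ _ (isSplit_outerRowSet h b))
      (fun b b' hb => outerRowSet_injective ℓ (coloringOf_inj hb)) fun b => by
        simp only [tiltedStates, Finset.mem_filter, Finset.mem_univ, true_and]
        refine ⟨0, h, ?_, ?_⟩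
        · exact (hmark _ _ (0, ⟨0, h⟩)).2 (Or.inl rfl)
        · rw [← Bool.not_eq_true]
          exact mt (hmark _ _ (2, ⟨0, h⟩)).1 (by simp [outerRowSet])
    exact_mod_cast this
  · rw [one_mul]
    have := two_pow_le_card_of_injective (tiltedStates ℓ ∪ levelStates ℓ)ᶜ
      (fun b => coloringOf _ _ (isSplit_outerRowSet h b).compl)
      (fun b b' hb => outerRowSet_injective ℓ (compl_injective (coloringOf_inj hb))) fun b => by
        set ω := coloringOf _ _ (isSplit_outerRowSet h b).compl with hω
        have e0 : ω.mark (0, 0) = false := by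
          rw [← Bool.not_eq_true]
          exact mt (hmark _ _ (0, ⟨0, h⟩)).1 (by simp [outerRowSet])
        have e2 : ω.mark (2, 0) = true :=
          (hmark _ _ (2, ⟨0, h⟩)).2 (by simp [outerRowSet])
        simp only [tiltedStates, levelStates, Finset.mem_compl, Finset.mem_union, Finset.mem_filter,
          Finset.mem_univ, true_and, not_or, not_forall]
        refine ⟨?_, 0, h, by simp [e0, e2]⟩
        rintro ⟨i, hi, h1, h2⟩
        exact not_tilted_both ω hi h h1 h2 e0 e2
    exact_mod_cast this
  · have h1 : ((levelStates ℓ).card : ℝ) ≤ ((2 * (ℓ + 1) ^ 8) ^ 3 : ℕ) := by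
      exact_mod_cast card_levelStates_le ℓ
    have h2 : (2 * (ℓ + 1) ^ 8) ^ 3 ≤ 2 ^ 27 * ℓ ^ 24 := by
      calc (2 * (ℓ + 1) ^ 8) ^ 3 ≤ (2 * (2 * ℓ) ^ 8) ^ 3 := by gcongr; omega
        _ = 2 ^ 27 * ℓ ^ 24 := by ring
    exact h1.trans (by exact_mod_cast h2)

end Grid

/-! ### The plus-shaped graph -/

section Plus

theorem gridGraph_preconnected (k ℓ : ℕ) : (gridGraph k ℓ).Preconnected :=
  (SimpleGraph.pathGraph_preconnected k).boxProd (SimpleGraph.pathGraph_preconnected ℓ)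

theorem gridGraph_dist_le_one_iff {k ℓ : ℕ} {u v : Fin k × Fin ℓ} :
    (gridGraph k ℓ).dist u v ≤ 1 ↔ u = v ∨ (gridGraph k ℓ).Adj u v := by
  rw [← SimpleGraph.dist_eq_one_iff_adj,
    ← (gridGraph_preconnected k ℓ u v).dist_eq_zero_iff]
  omega

theorem mem_plusSet_iff {h : ℕ} {v : Fin (2 * h + 1) × Fin (2 * h + 1)} :
    v ∈ plusSet (2 * h + 1) ↔ (h ≤ v.1.1 + 1 ∧ v.1.1 ≤ h + 1) ∨ (h ≤ v.2.1 + 1 ∧ v.2.1 ≤ h + 1) := by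
  have hh : (2 * h + 1) / 2 = h := by omega
  simp only [plusSet, Set.mem_ofPred_eq, hh, gridGraph_dist_le_one_iff, gridGraph_adj_iff]
  constructor
  · rintro ⟨w, hw, rfl | h1⟩ <;> omega
  · rintro (h1 | h1)
    · refine ⟨(⟨h, by omega⟩, v.2), Or.inl rfl, ?_⟩
      rcases eq_or_ne v.1.1 h with h2 | h2
      · exact Or.inl (Prod.ext (Fin.ext h2) rfl)
      · exact Or.inr (Or.inr ⟨rfl, show v.1.1 + 1 = h ∨ h + 1 = v.1.1 by omega⟩)
    · refine ⟨(v.1, ⟨h, by omega⟩), Or.inr rfl, ?_⟩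
      rcases eq_or_ne v.2.1 h with h2 | h2
      · exact Or.inl (Prod.ext rfl (Fin.ext h2))
      · exact Or.inr (Or.inl ⟨rfl, show v.2.1 + 1 = h ∨ h + 1 = v.2.1 by omega⟩)

/-- The coordinates of the plus-shaped region of side `2 * h + 1`. -/
def plusRegion (h : ℕ) : Finset (ℕ × ℕ) :=
  rect 0 (2 * h + 1) (h - 1) (h + 2) ∪ rect (h - 1) (h + 2) 0 (2 * h + 1)

theorem mem_plusRegion {h : ℕ} {p : ℕ × ℕ} : p ∈ plusRegion h ↔
    (p.1 < 2 * h + 1 ∧ h - 1 ≤ p.2 ∧ p.2 < h + 2) ∨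
    (p.2 < 2 * h + 1 ∧ h - 1 ≤ p.1 ∧ p.1 < h + 2) := by
  simp only [plusRegion, Finset.mem_union, mem_rect]
  omega

/-- The coordinates of a vertex of the plus-shaped graph. -/
def plusPos {h : ℕ} (v : plusSet (2 * h + 1)) : ℕ × ℕ := gridPos v.1

theorem isLatticeGraph_plusGraph {h : ℕ} (hh : 1 ≤ h) :
    IsLatticeGraph (plusGraph (2 * h + 1)) (plusRegion h) plusPos where
  inj := gridPos_injective.comp Subtype.val_injective
  mem v := by
    have := mem_plusSet_iff.1 v.2
    rw [mem_plusRegion]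
    simp only [plusPos, gridPos]
    omega
  surj p hp := by
    rw [mem_plusRegion] at hp
    exact ⟨⟨(⟨p.1, by omega⟩, ⟨p.2, by omega⟩), mem_plusSet_iff.2 (by simp only; omega)⟩, rfl⟩
  adj_iff u v := by
    rw [plusGraph, SimpleGraph.comap_adj]
    exact gridGraph_adj_iff_latEdge

/-- The plus is the union of two bars that meet in a connected `3 × 3` square. -/
theorem isSimplyConn_plusRegion {h : ℕ} (hh : 1 ≤ h) : IsSimplyConn (plusRegion h) := by
  refine (isSimplyConn_rect _ _ _ _).union (isSimplyConn_rect _ _ _ _) ?_ ?_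
  · refine forall_latEdge.2 ⟨fun x y => ?_, fun x y => ?_⟩ <;>
    · simp only [LatEdge.src, LatEdge.tgt, cond_true, cond_false, Finset.mem_union, mem_rect]
      omega
  · intro ψ hψ
    have hint : ∀ p, p ∈ rect 0 (2 * h + 1) (h - 1) (h + 2) ∩ rect (h - 1) (h + 2) 0 (2 * h + 1) ↔
        p ∈ rect (h - 1) (h + 2) (h - 1) (h + 2) := by
      intro p
      simp only [Finset.mem_inter, mem_rect]
      omega
    simp only [hint] at hψ ⊢
    have hout : ∀ p ∈ rect (h - 1) (h + 2) (h - 1) (h + 2), p ≠ (h + 2, h + 2) := by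
      rintro p hp rfl
      simp only [mem_rect] at hp
      omega
    refine ⟨ψ (h, h), fun u hu => ?_⟩
    have ho : (h, h) ∈ rect (h - 1) (h + 2) (h - 1) (h + 2) := by
      simp only [mem_rect]; omega
    exact rect_punctured (by omega) (by omega) (h + 2, h + 2) (fun e h1 h2 _ _ => hψ e h1 h2) hu ho
      (hout _ hu) (hout _ ho)

/-- Neither bar is disconnected by removing `p`, and the bars share a cell `o` other than `p`
through which they communicate. -/
theorem plusRegion_punctured {h : ℕ} (hh : 1 ≤ h) (p : ℕ × ℕ) (f : ℕ × ℕ → Prop)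
    (hf : ∀ e : LatEdge, e.src ∈ plusRegion h → e.tgt ∈ plusRegion h →
      e.src ≠ p → e.tgt ≠ p → f e.src = f e.tgt) :
    ∀ u ∈ plusRegion h, ∀ w ∈ plusRegion h, u ≠ p → w ≠ p → f u = f w := by
  obtain ⟨o, ho1, ho2, hop⟩ : ∃ o, o ∈ rect 0 (2 * h + 1) (h - 1) (h + 2) ∧
      o ∈ rect (h - 1) (h + 2) 0 (2 * h + 1) ∧ o ≠ p := by
    by_cases hp : p = (h, h)
    · refine ⟨(h - 1, h), ?_, ?_, ?_⟩
      · simp only [mem_rect]; omega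
      · simp only [mem_rect]; omega
      · rw [hp]; simp; omega
    · refine ⟨(h, h), ?_, ?_, fun hh => hp hh.symm⟩
      · simp only [mem_rect]; omega
      · simp only [mem_rect]; omega
  have key : ∀ u ∈ plusRegion h, u ≠ p → f u = f o := by
    intro u hu hup
    rcases Finset.mem_union.1 hu with hu | hu
    · exact rect_punctured (by omega) (by omega) p (fun e h1 h2 => hf e
        (Finset.mem_union_left _ h1) (Finset.mem_union_left _ h2)) hu ho1 hup hop
    · exact rect_punctured (by omega) (by omega) p (fun e h1 h2 => hf e
        (Finset.mem_union_right _ h1) (Finset.mem_union_right _ h2)) hu ho2 hup hop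
  intro u hu w hw hup hwp
  rw [key u hu hup, key w hw hwp]

instance (h : ℕ) : Nonempty (plusSet (2 * h + 1)) :=
  ⟨⟨(⟨h, by omega⟩, ⟨h, by omega⟩), mem_plusSet_iff.2 (by simp)⟩⟩

theorem isPeelable_plusGraph (h : ℕ) : IsContiguous (plusGraph (2 * h + 1)) Set.univ ∧
    IsPeelable (plusGraph (2 * h + 1)) := by
  rcases Nat.eq_zero_or_pos h with rfl | hh
  · have : Subsingleton (plusSet (2 * 0 + 1)) :=
      inferInstanceAs (Subsingleton {x : Fin 1 × Fin 1 // x ∈ plusSet 1})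
    exact ⟨isContiguous_of_subsingleton (Set.subsingleton_of_subsingleton),
      fun A _ ⟨v, hv⟩ => ⟨v, hv, isContiguous_of_subsingleton (Set.subsingleton_of_subsingleton),
        isContiguous_of_subsingleton (Set.subsingleton_of_subsingleton)⟩⟩
  · have := (isLatticeGraph_plusGraph hh).isContiguous_compl_singleton (plusRegion_punctured hh)
    exact ⟨this.1, isPeelable_of_forall_compl_singleton this.1 this.2⟩

theorem isErgodicChain_partitionChain_plusGraph (h : ℕ) :
    IsErgodicChain (partitionChain (plusGraph (2 * h + 1))) (uniformDist _) :=
  isErgodicChain_partitionChain (isPeelable_plusGraph h).1 (isPeelable_plusGraph h).2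

/-! ### The arms of the plus-shaped graph -/

/-- The `i`-th cell of row `r` of the arm `a` (right, left, upper, lower), counted from the
center. -/
def armCell (h : ℕ) (a : Fin 4) (r i : ℕ) : ℕ × ℕ :=
  match a with
  | 0 => (h + 2 + i, h - 1 + r)
  | 1 => (h - 2 - i, h - 1 + r)
  | 2 => (h - 1 + r, h + 2 + i)
  | 3 => (h - 1 + r, h - 2 - i)

theorem joins_vertical_of {p q : ℕ × ℕ} (h1 : p.1 = q.1) (h2 : p.2 + 1 = q.2) :
    LatEdge.Joins (p.1, p.2, true) p q :=
  Or.inl ⟨rfl, Prod.ext h1 h2⟩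

theorem joins_horizontal_of {p q : ℕ × ℕ} (h1 : p.1 + 1 = q.1) (h2 : p.2 = q.2) :
    LatEdge.Joins (p.1, p.2, false) p q :=
  Or.inl ⟨rfl, Prod.ext h1 h2⟩

theorem isStrip_armCell (h : ℕ) (a : Fin 4) :
    IsStrip (plusRegion h) (h - 1) (armCell h a) where
  mem r i hr hi := by
    rw [mem_plusRegion]
    fin_cases a <;> simp only [armCell] <;> omega
  inj r i r' i' _ _ _ _ heq := by
    fin_cases a <;> simp only [armCell, Prod.mk.injEq] at heq <;> omega
  side r i hr hi := by
    fin_cases a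
    · refine ⟨_, joins_horizontal_of (by simp only [armCell]; omega) (by simp only [armCell]),
        isOuter_horizontal ?_⟩
      simp only [armCell, IsSquare, mem_plusRegion]
      rcases hr with rfl | rfl
      · right; intro y' hy'; omega
      · left; omega
    · refine ⟨_, (joins_horizontal_of (by simp only [armCell]; omega)
        (by simp only [armCell])).symm, isOuter_horizontal ?_⟩
      simp only [armCell, IsSquare, mem_plusRegion]
      rcases hr with rfl | rfl
      · right; intro y' hy'; omega
      · left; omega
    · refine ⟨_, joins_vertical_of (by simp only [armCell]) (by simp only [armCell]; omega),
        isOuter_vertical ?_⟩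
      simp only [armCell, IsSquare, mem_plusRegion]
      rcases hr with rfl | rfl
      · right; intro y' hy'; omega
      · left; omega
    · refine ⟨_, (joins_vertical_of (by simp only [armCell])
        (by simp only [armCell]; omega)).symm, isOuter_vertical ?_⟩
      simp only [armCell, IsSquare, mem_plusRegion]
      rcases hr with rfl | rfl
      · right; intro y' hy'; omega
      · left; omega
  tip r hr hm := by
    fin_cases a
    · refine ⟨_, joins_vertical_of (by simp only [armCell]) (by simp only [armCell]; omega),
        isOuter_vertical ?_⟩
      simp only [armCell, IsSquare, mem_plusRegion]
      left; omega
    · refine ⟨_, joins_vertical_of (by simp only [armCell]) (by simp only [armCell]; omega),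
        isOuter_vertical ?_⟩
      simp only [armCell, IsSquare, mem_plusRegion]
      right; intro x' hx'; omega
    · refine ⟨_, joins_horizontal_of (by simp only [armCell]; omega) (by simp only [armCell]),
        isOuter_horizontal ?_⟩
      simp only [armCell, IsSquare, mem_plusRegion]
      left; omega
    · refine ⟨_, joins_horizontal_of (by simp only [armCell]; omega) (by simp only [armCell]),
        isOuter_horizontal ?_⟩
      simp only [armCell, IsSquare, mem_plusRegion]
      right; intro x' hx'; omega
  sep e r i q hr hi h0 hq he := by
    have hc := he.coords
    rw [mem_plusRegion] at hq
    obtain ⟨x, y⟩ := q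
    fin_cases a <;> simp only [armCell, Prod.mk.injEq] at hc hq ⊢
    · exact ⟨y - (h - 1), x - (h + 2), by omega⟩
    · exact ⟨y - (h - 1), h - 2 - x, by omega⟩
    · exact ⟨x - (h - 1), y - (h + 2), by omega⟩
    · exact ⟨x - (h - 1), h - 2 - y, by omega⟩

theorem armCell_arm_eq {h : ℕ} {a a' : Fin 4} {r i r' i' : ℕ} (hr : r < 3) (hi : i < h - 1)
    (hr' : r' < 3) (hi' : i' < h - 1) (heq : armCell h a r i = armCell h a' r' i') : a = a' := by
  fin_cases a <;> fin_cases a' <;> first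
    | rfl
    | (simp only [armCell, Prod.mk.injEq] at heq; omega)

theorem plusRegion_cover {h : ℕ} {p : ℕ × ℕ} (hp : p ∈ plusRegion h) :
    p ∈ rect (h - 1) (h + 2) (h - 1) (h + 2) ∨
      ∃ a r i, r < 3 ∧ i < h - 1 ∧ p = armCell h a r i := by
  rw [mem_plusRegion] at hp
  rw [mem_rect]
  obtain ⟨x, y⟩ := p
  simp only at hp ⊢
  by_cases h0 : h + 2 ≤ x
  · exact Or.inr ⟨0, y - (h - 1), x - (h + 2), by omega, by omega, by
      simp only [armCell, Prod.mk.injEq]; omega⟩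
  by_cases h1 : x < h - 1
  · exact Or.inr ⟨1, y - (h - 1), h - 2 - x, by omega, by omega, by
      simp only [armCell, Prod.mk.injEq]; omega⟩
  by_cases h2 : h + 2 ≤ y
  · exact Or.inr ⟨2, x - (h - 1), y - (h + 2), by omega, by omega, by
      simp only [armCell, Prod.mk.injEq]; omega⟩
  by_cases h3 : y < h - 1
  · exact Or.inr ⟨3, x - (h - 1), h - 2 - y, by omega, by omega, by
      simp only [armCell, Prod.mk.injEq]; omega⟩
  · left; omega

/-- The arms in which the two ends of some transversal column have different colors. -/
def splitArms (h : ℕ) (χ : ℕ × ℕ → Bool) : Finset (Fin 4) :=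
  open Classical in
  Finset.univ.filter fun a => ∃ i < h - 1, χ (armCell h a 0 i) ≠ χ (armCell h a 2 i)

theorem mem_splitArms {h : ℕ} {χ : ℕ × ℕ → Bool} {a : Fin 4} : a ∈ splitArms h χ ↔
    ∃ i < h - 1, χ (armCell h a 0 i) ≠ χ (armCell h a 2 i) := by
  simp [splitArms]

/-- Exchanging the two colors preserves inequality of the ends of a column. This makes split arms
meaningful for unordered partitions. -/
theorem mem_splitArms_congr {h : ℕ} {χ χ' : ℕ × ℕ → Bool} {a : Fin 4}
    (hc : (∀ r i, r < 3 → i < h - 1 → χ (armCell h a r i) = χ' (armCell h a r i)) ∨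
      (∀ r i, r < 3 → i < h - 1 → χ (armCell h a r i) = !χ' (armCell h a r i))) :
    a ∈ splitArms h χ ↔ a ∈ splitArms h χ' := by
  rw [mem_splitArms, mem_splitArms]
  refine exists_congr fun i => and_congr_right fun hi => ?_
  rcases hc with hc | hc
  · rw [hc 0 i (by omega) hi, hc 2 i (by omega) hi]
  · rw [hc 0 i (by omega) hi, hc 2 i (by omega) hi]
    simp

/-- Every split arm contains a bichromatic outer edge, the arms are disjoint, and only two such
edges are available. -/
theorem card_splitArms_le {h : ℕ} (hh : 1 ≤ h) {χ : ℕ × ℕ → Bool}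
    (hχ : HasConnClasses (plusRegion h) χ) : (splitArms h χ).card ≤ 2 := by
  refine le_trans ?_ (card_outerCuts_le (isSimplyConn_plusRegion hh) hχ)
  have key : ∀ a ∈ splitArms h χ, ∃ r k r' k', r < 3 ∧ r' < 3 ∧ k < h - 1 ∧ k' < h - 1 ∧
      s(armCell h a r k, armCell h a r' k') ∈ outerCuts (plusRegion h) χ := by
    intro a ha
    obtain ⟨i, hi, hne⟩ := mem_splitArms.1 ha
    obtain ⟨r, k, r', k', h1, h2, -, -, h3, h4, h5⟩ :=
      (isStrip_armCell h a).exists_mem_outerCuts hi hne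
    exact ⟨r, k, r', k', h1, h2, h3, h4, h5⟩
  choose! R K R' K' h1 h2 h3 h4 h5 using key
  refine Finset.card_le_card_of_injOn
    (fun a => s(armCell h a (R a) (K a), armCell h a (R' a) (K' a))) h5 fun a ha b hb heq => ?_
  rw [Sym2.eq_iff] at heq
  rcases heq with ⟨e, -⟩ | ⟨e, -⟩
  · exact armCell_arm_eq (h1 a ha) (h3 a ha) (h1 b hb) (h3 b hb) e
  · exact armCell_arm_eq (h1 a ha) (h3 a ha) (h2 b hb) (h4 b hb) e

end Plus

/-! ### Vertical and horizontal walls in the plus, and the states between them -/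

section PlusBottleneck

variable {h : ℕ}

/-- A set of vertices of the plus between an open and a closed half-plane, described in rotated or
reflected coordinates `c` centered at the middle of the plus, is contiguous. -/
theorem isContiguous_halfPlus (hh : 1 ≤ h) (c : plusSet (2 * h + 1) → ℤ × ℤ)
    (hinj : Function.Injective c)
    (hsurj : ∀ s t : ℤ, -h ≤ s → s ≤ h → -h ≤ t → t ≤ h → ((-1 ≤ s ∧ s ≤ 1) ∨ (-1 ≤ t ∧ t ≤ 1)) →
      ∃ v, c v = (s, t))
    (hmem : ∀ v, (-h ≤ (c v).1 ∧ (c v).1 ≤ h) ∧ (-h ≤ (c v).2 ∧ (c v).2 ≤ h) ∧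
      ((-1 ≤ (c v).1 ∧ (c v).1 ≤ 1) ∨ (-1 ≤ (c v).2 ∧ (c v).2 ≤ 1)))
    (hadj : ∀ u w, ((c u).1 = (c w).1 ∧ ((c u).2 + 1 = (c w).2 ∨ (c w).2 + 1 = (c u).2)) ∨
      ((c u).2 = (c w).2 ∧ ((c u).1 + 1 = (c w).1 ∨ (c w).1 + 1 = (c u).1)) →
      (plusGraph (2 * h + 1)).Adj u w)
    {B : Set (plusSet (2 * h + 1))} (h0 : ∀ v ∈ B, 0 ≤ (c v).1) (h1 : ∀ v, 0 < (c v).1 → v ∈ B) :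
    IsContiguous (plusGraph (2 * h + 1)) B := by
  obtain ⟨o, ho⟩ := hsurj 1 0 (by omega) (by omega) (by omega) (by omega) (by omega)
  -- The rank is the distance to `(1, 0)`. Moving the first coordinate to `1` and then the second to
  -- `0` stays inside the plus and, after the first move, strictly inside the half-plane.
  refine isContiguous_of_rank o (fun v => (c v).2.natAbs + ((c v).1 - 1).natAbs) fun u hu => ?_
  have hm := hmem u
  have hu0 := h0 u hu
  have step : ∀ s t : ℤ, -h ≤ s → s ≤ h → -h ≤ t → t ≤ h →
      ((-1 ≤ s ∧ s ≤ 1) ∨ (-1 ≤ t ∧ t ≤ 1)) → 0 < s →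
      (((c u).1 = s ∧ ((c u).2 + 1 = t ∨ t + 1 = (c u).2)) ∨
        ((c u).2 = t ∧ ((c u).1 + 1 = s ∨ s + 1 = (c u).1))) →
      t.natAbs + (s - 1).natAbs < (c u).2.natAbs + ((c u).1 - 1).natAbs →
      ∃ w ∈ B, (plusGraph (2 * h + 1)).Adj u w ∧
        (c w).2.natAbs + ((c w).1 - 1).natAbs < (c u).2.natAbs + ((c u).1 - 1).natAbs := by
    intro s t a1 a2 a3 a4 a5 a6 a7 a8
    obtain ⟨w, hw⟩ := hsurj s t a1 a2 a3 a4 a5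
    refine ⟨w, h1 w (by rw [hw]; exact a6), hadj u w (by rw [hw]; exact a7), by rw [hw]; exact a8⟩
  rcases lt_trichotomy (c u).1 1 with hs | hs | hs
  · exact Or.inr (step 1 (c u).2 (by omega) (by omega) (by omega) (by omega) (by omega) (by omega)
      (by omega) (by omega))
  · rcases lt_trichotomy (c u).2 0 with ht | ht | ht
    · exact Or.inr (step 1 ((c u).2 + 1) (by omega) (by omega) (by omega) (by omega) (by omega)
        (by omega) (by omega) (by omega))
    · exact Or.inl (hinj (by rw [ho]; exact Prod.ext hs ht))
    · exact Or.inr (step 1 ((c u).2 - 1) (by omega) (by omega) (by omega) (by omega) (by omega)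
        (by omega) (by omega) (by omega))
  · exact Or.inr (step ((c u).1 - 1) (c u).2 (by omega) (by omega) (by omega) (by omega) (by omega)
      (by omega) (by omega) (by omega))

/-- The part of the plus to the left of the middle column, with a part of the middle column. -/
def leftSet (h : ℕ) (b : Finset (Fin (2 * h + 1))) : Set (plusSet (2 * h + 1)) :=
  {v | v.1.1.1 < h ∨ (v.1.1.1 = h ∧ v.1.2 ∈ b)}

/-- The part of the plus below the middle row, with a part of the middle row. -/
def lowerSet (h : ℕ) (b : Finset (Fin (2 * h + 1))) : Set (plusSet (2 * h + 1)) :=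
  {v | v.1.2.1 < h ∨ (v.1.2.1 = h ∧ v.1.1 ∈ b)}

theorem plusGraph_adj_iff {u v : plusSet (2 * h + 1)} : (plusGraph (2 * h + 1)).Adj u v ↔
    (u.1.1.1 = v.1.1.1 ∧ (u.1.2.1 + 1 = v.1.2.1 ∨ v.1.2.1 + 1 = u.1.2.1)) ∨
    (u.1.2.1 = v.1.2.1 ∧ (u.1.1.1 + 1 = v.1.1.1 ∨ v.1.1.1 + 1 = u.1.1.1)) := by
  rw [plusGraph, SimpleGraph.comap_adj]
  exact gridGraph_adj_iff

/-- The vertex of the plus with coordinates `x` and `y`. -/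
def plusVertex {x y : ℕ} (hx : x < 2 * h + 1) (hy : y < 2 * h + 1)
    (hxy : (h ≤ x + 1 ∧ x ≤ h + 1) ∨ (h ≤ y + 1 ∧ y ≤ h + 1)) : plusSet (2 * h + 1) :=
  ⟨(⟨x, hx⟩, ⟨y, hy⟩), mem_plusSet_iff.2 hxy⟩

theorem plusSet_ext {u v : plusSet (2 * h + 1)} (h1 : u.1.1.1 = v.1.1.1)
    (h2 : u.1.2.1 = v.1.2.1) : u = v :=
  Subtype.ext (Prod.ext (Fin.ext h1) (Fin.ext h2))

theorem isSplit_leftSet (hh : 1 ≤ h) (b : Finset (Fin (2 * h + 1))) :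
    IsSplit (plusGraph (2 * h + 1)) (leftSet h b) := by
  constructor
  · refine isContiguous_halfPlus hh (fun v => ((h : ℤ) - v.1.1.1, (v.1.2.1 : ℤ) - h)) ?_ ?_ ?_ ?_
      ?_ ?_
    · intro u v huv
      simp only [Prod.mk.injEq] at huv
      exact plusSet_ext (by omega) (by omega)
    · intro s t h1 h2 h3 h4 h5
      refine ⟨plusVertex (x := (h - s).toNat) (y := (t + h).toNat) (by omega) (by omega) (by omega),
        ?_⟩
      simp only [plusVertex, Prod.mk.injEq]
      omega
    · intro v
      have := mem_plusSet_iff.1 v.2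
      have := v.1.1.2
      have := v.1.2.2
      simp only
      omega
    · intro u w huw
      rw [plusGraph_adj_iff]
      simp only at huw
      omega
    · intro v hv
      simp only [leftSet, Set.mem_ofPred_eq] at hv
      simp only
      omega
    · intro v hv
      simp only at hv
      exact Or.inl (by omega)
  · refine isContiguous_halfPlus hh (fun v => ((v.1.1.1 : ℤ) - h, (v.1.2.1 : ℤ) - h)) ?_ ?_ ?_ ?_
      ?_ ?_
    · intro u v huv
      simp only [Prod.mk.injEq] at huv
      exact plusSet_ext (by omega) (by omega)
    · intro s t h1 h2 h3 h4 h5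
      refine ⟨plusVertex (x := (s + h).toNat) (y := (t + h).toNat) (by omega) (by omega) (by omega),
        ?_⟩
      simp only [plusVertex, Prod.mk.injEq]
      omega
    · intro v
      have := mem_plusSet_iff.1 v.2
      have := v.1.1.2
      have := v.1.2.2
      simp only
      omega
    · intro u w huw
      rw [plusGraph_adj_iff]
      simp only at huw
      omega
    · intro v hv
      simp only [leftSet, Set.mem_compl_iff, Set.mem_ofPred_eq, not_or] at hv
      simp only
      omega
    · intro v hv
      simp only at hv
      simp only [leftSet, Set.mem_compl_iff, Set.mem_ofPred_eq, not_or]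
      exact ⟨by omega, fun hc => by omega⟩

theorem isSplit_lowerSet (hh : 1 ≤ h) (b : Finset (Fin (2 * h + 1))) :
    IsSplit (plusGraph (2 * h + 1)) (lowerSet h b) := by
  constructor
  · refine isContiguous_halfPlus hh (fun v => ((h : ℤ) - v.1.2.1, (v.1.1.1 : ℤ) - h)) ?_ ?_ ?_ ?_
      ?_ ?_
    · intro u v huv
      simp only [Prod.mk.injEq] at huv
      exact plusSet_ext (by omega) (by omega)
    · intro s t h1 h2 h3 h4 h5
      refine ⟨plusVertex (x := (t + h).toNat) (y := (h - s).toNat) (by omega) (by omega) (by omega),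
        ?_⟩
      simp only [plusVertex, Prod.mk.injEq]
      omega
    · intro v
      have := mem_plusSet_iff.1 v.2
      have := v.1.1.2
      have := v.1.2.2
      simp only
      omega
    · intro u w huw
      rw [plusGraph_adj_iff]
      simp only at huw
      omega
    · intro v hv
      simp only [lowerSet, Set.mem_ofPred_eq] at hv
      simp only
      omega
    · intro v hv
      simp only at hv
      exact Or.inl (by omega)
  · refine isContiguous_halfPlus hh (fun v => ((v.1.2.1 : ℤ) - h, (v.1.1.1 : ℤ) - h)) ?_ ?_ ?_ ?_
      ?_ ?_
    · intro u v huv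
      simp only [Prod.mk.injEq] at huv
      exact plusSet_ext (by omega) (by omega)
    · intro s t h1 h2 h3 h4 h5
      refine ⟨plusVertex (x := (t + h).toNat) (y := (s + h).toNat) (by omega) (by omega) (by omega),
        ?_⟩
      simp only [plusVertex, Prod.mk.injEq]
      omega
    · intro v
      have := mem_plusSet_iff.1 v.2
      have := v.1.1.2
      have := v.1.2.2
      simp only
      omega
    · intro u w huw
      rw [plusGraph_adj_iff]
      simp only at huw
      omega
    · intro v hv
      simp only [lowerSet, Set.mem_compl_iff, Set.mem_ofPred_eq, not_or] at hv
      simp only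
      omega
    · intro v hv
      simp only at hv
      simp only [lowerSet, Set.mem_compl_iff, Set.mem_ofPred_eq, not_or]
      exact ⟨by omega, fun hc => by omega⟩

/-- The pieces of a state, as a coloring of lattice points. -/
def ContigTwoPartition.mark (p : ContigTwoPartition (plusGraph (2 * h + 1))) : ℕ × ℕ → Bool :=
  markSet plusPos p.piece

theorem ContigTwoPartition.hasConnClasses_mark (hh : 1 ≤ h)
    (p : ContigTwoPartition (plusGraph (2 * h + 1))) : HasConnClasses (plusRegion h) p.mark :=
  (isLatticeGraph_plusGraph hh).hasConnClasses p.isSplit_piece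

theorem markSet_eq_not (hh : 1 ≤ h) {A B : Set (plusSet (2 * h + 1))} {v : plusSet (2 * h + 1)}
    (hv : v ∈ A ↔ v ∉ B) : markSet plusPos A (plusPos v) = !markSet plusPos B (plusPos v) := by
  have hL := isLatticeGraph_plusGraph hh
  have e1 := hL.markSet_pos A v
  have e2 := hL.markSet_pos B v
  rw [hv, ← e2] at e1
  revert e1
  cases markSet plusPos A (plusPos v) <;> cases markSet plusPos B (plusPos v) <;> simp

theorem markSet_eq (hh : 1 ≤ h) {A B : Set (plusSet (2 * h + 1))} {v : plusSet (2 * h + 1)}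
    (hv : v ∈ A ↔ v ∈ B) : markSet plusPos A (plusPos v) = markSet plusPos B (plusPos v) := by
  have hL := isLatticeGraph_plusGraph hh
  rw [Bool.eq_iff_iff, hL.markSet_pos, hL.markSet_pos, hv]

/-- If two sets, or a set and the complement of the other, differ in at most one vertex, then they
split the same arms, with at most one exception. -/
theorem exists_forall_mem_splitArms_iff (hh : 1 ≤ h) {A B : Set (plusSet (2 * h + 1))}
    (v : plusSet (2 * h + 1)) (hAB : (∀ u, u ≠ v → (u ∈ A ↔ u ∈ B)) ∨
      (∀ u, u ≠ v → (u ∈ A ↔ u ∉ B))) :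
    ∃ a₀, ∀ a, a ≠ a₀ →
      (a ∈ splitArms h (markSet plusPos A) ↔ a ∈ splitArms h (markSet plusPos B)) := by
  have hL := isLatticeGraph_plusGraph hh
  -- The vertex `v` lies in at most one arm. If it lies in the central square, the exceptional arm
  -- is an arbitrary choice.
  obtain ⟨a₀, ha₀⟩ : ∃ a₀, ∀ a, a ≠ a₀ → ∀ r i, r < 3 → i < h - 1 → armCell h a r i ≠ plusPos v := by
    by_cases hex : ∃ a r i, r < 3 ∧ i < h - 1 ∧ armCell h a r i = plusPos v
    · obtain ⟨a₀, r₀, i₀, hr₀, hi₀, heq⟩ := hex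
      exact ⟨a₀, fun a ha r i hr hi h' => ha (armCell_arm_eq hr hi hr₀ hi₀ (h'.trans heq.symm))⟩
    · push Not at hex
      exact ⟨0, fun a _ => hex a⟩
  refine ⟨a₀, fun a ha => mem_splitArms_congr ?_⟩
  refine hAB.imp (fun hAB r i hr hi => ?_) (fun hAB r i hr hi => ?_) <;>
  · obtain ⟨u, hu⟩ := hL.surj _ ((isStrip_armCell h a).mem r i hr hi)
    have hne := ha₀ a ha r i hr hi
    rw [← hu] at hne ⊢
    have huv : u ≠ v := by rintro rfl; exact hne rfl
    first
    | exact markSet_eq hh (hAB u huv)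
    | exact markSet_eq_not hh (hAB u huv)

/-- The chosen piece is `A` or its complement, and split arms do not distinguish the two. -/
theorem splitArms_partitionOf (hh : 1 ≤ h) {A : Set (plusSet (2 * h + 1))}
    (hA : IsSplit (plusGraph (2 * h + 1)) A) :
    splitArms h (partitionOf _ A hA).mark = splitArms h (markSet plusPos A) := by
  have hL := isLatticeGraph_plusGraph hh
  have h1 := (partitionOf _ A hA).partitionOf_piece
  rw [partitionOf_eq_iff] at h1
  ext a
  refine mem_splitArms_congr (h1.imp (fun hP r i hr hi => ?_) (fun hP r i hr hi => ?_)) <;>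
  · obtain ⟨u, hu⟩ := hL.surj _ ((isStrip_armCell h a).mem r i hr hi)
    rw [← hu]
    first
    | exact markSet_eq hh (by rw [hP])
    | exact markSet_eq_not hh (by rw [hP]; rfl)

theorem mem_splitArms_of_mem (hh : 1 ≤ h) {A : Set (plusSet (2 * h + 1))} {a : Fin 4}
    (hm : 0 < h - 1) {u v : plusSet (2 * h + 1)} (hu : plusPos u = armCell h a 0 0)
    (hv : plusPos v = armCell h a 2 0) (huA : u ∈ A) (hvA : v ∉ A) :
    a ∈ splitArms h (markSet plusPos A) := by
  have hL := isLatticeGraph_plusGraph hh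
  refine mem_splitArms.2 ⟨0, hm, ?_⟩
  rw [← hu, ← hv]
  intro heq
  rw [Bool.eq_iff_iff, hL.markSet_pos, hL.markSet_pos] at heq
  exact hvA (heq.1 huA)

theorem splitArms_leftSet (hh : 2 ≤ h) (b : Finset (Fin (2 * h + 1))) :
    2 ∈ splitArms h (markSet plusPos (leftSet h b)) ∧
      3 ∈ splitArms h (markSet plusPos (leftSet h b)) := by
  constructor
  · refine mem_splitArms_of_mem (by omega) (by omega)
      (u := plusVertex (x := h - 1) (y := h + 2) (by omega) (by omega) (by omega))
      (v := plusVertex (x := h + 1) (y := h + 2) (by omega) (by omega) (by omega)) rfl ?_ ?_ ?_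
    · exact Prod.ext (show h + 1 = h - 1 + 2 by omega) rfl
    · exact Or.inl (show h - 1 < h by omega)
    · simp [leftSet, plusVertex]
  · refine mem_splitArms_of_mem (by omega) (by omega)
      (u := plusVertex (x := h - 1) (y := h - 2) (by omega) (by omega) (by omega))
      (v := plusVertex (x := h + 1) (y := h - 2) (by omega) (by omega) (by omega)) rfl ?_ ?_ ?_
    · exact Prod.ext (show h + 1 = h - 1 + 2 by omega) rfl
    · exact Or.inl (show h - 1 < h by omega)
    · simp [leftSet, plusVertex]

theorem splitArms_lowerSet (hh : 2 ≤ h) (b : Finset (Fin (2 * h + 1))) :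
    0 ∈ splitArms h (markSet plusPos (lowerSet h b)) ∧
      1 ∈ splitArms h (markSet plusPos (lowerSet h b)) := by
  constructor
  · refine mem_splitArms_of_mem (by omega) (by omega)
      (u := plusVertex (x := h + 2) (y := h - 1) (by omega) (by omega) (by omega))
      (v := plusVertex (x := h + 2) (y := h + 1) (by omega) (by omega) (by omega)) rfl ?_ ?_ ?_
    · exact Prod.ext rfl (show h + 1 = h - 1 + 2 by omega)
    · exact Or.inl (show h - 1 < h by omega)
    · simp [lowerSet, plusVertex]
  · refine mem_splitArms_of_mem (by omega) (by omega)
      (u := plusVertex (x := h - 2) (y := h - 1) (by omega) (by omega) (by omega))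
      (v := plusVertex (x := h - 2) (y := h + 1) (by omega) (by omega) (by omega)) rfl ?_ ?_ ?_
    · exact Prod.ext rfl (show h + 1 = h - 1 + 2 by omega)
    · exact Or.inl (show h - 1 < h by omega)
    · simp [lowerSet, plusVertex]

theorem partitionOf_leftSet_injective (hh : 1 ≤ h) : Function.Injective fun b =>
    partitionOf (plusGraph (2 * h + 1)) (leftSet h b) (isSplit_leftSet hh b) := by
  intro b b' heq
  rcases (partitionOf_eq_iff _ _).1 heq with heq | heq
  · ext j
    have := congrArg (plusVertex (x := h) (y := j.1) (by omega) j.2 (by omega) ∈ ·) heq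
    simpa [leftSet, plusVertex] using this
  -- The vertex left of the center belongs to both sets, so they are not complementary.
  · have := congrArg (plusVertex (x := h - 1) (y := h) (by omega) (by omega) (by omega) ∈ ·) heq
    simp [leftSet, plusVertex] at this
    omega

theorem partitionOf_lowerSet_injective (hh : 1 ≤ h) : Function.Injective fun b =>
    partitionOf (plusGraph (2 * h + 1)) (lowerSet h b) (isSplit_lowerSet hh b) := by
  intro b b' heq
  rcases (partitionOf_eq_iff _ _).1 heq with heq | heq
  · ext j
    have := congrArg (plusVertex (x := j.1) (y := h) j.2 (by omega) (by omega) ∈ ·) heq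
    simpa [lowerSet, plusVertex] using this
  · have := congrArg (plusVertex (x := h) (y := h - 1) (by omega) (by omega) (by omega) ∈ ·) heq
    simp [lowerSet, plusVertex] at this
    omega

/-- The states that split no arm other than `a`. -/
def oneArmStates (h : ℕ) (a : Fin 4) : Finset (ContigTwoPartition (plusGraph (2 * h + 1))) :=
  open Classical in Finset.univ.filter fun p => splitArms h p.mark ⊆ {a}

theorem eq_of_mark_eq (hh : 1 ≤ h) {p p' : ContigTwoPartition (plusGraph (2 * h + 1))}
    (heq : ∀ q ∈ plusRegion h, p.mark q = p'.mark q) : p = p' := by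
  have hL := isLatticeGraph_plusGraph hh
  have : p.piece = p'.piece := by
    ext v
    rw [← hL.markSet_pos, ← hL.markSet_pos]
    exact Bool.eq_iff_iff.1 (heq _ (hL.mem v))
  rw [← p.partitionOf_piece, ← p'.partitionOf_piece, partitionOf_eq_iff]
  exact Or.inl this

/-- A state is encoded by its colors on the nine central cells and the codes of the twelve arm rows.
Only the middle row of `a` can have an unbounded number of changes, and it contributes the
exponential factor. -/
theorem card_oneArmStates_le (hh : 1 ≤ h) (a : Fin 4) :
    (oneArmStates h a).card ≤ 2 ^ 9 * ((2 * h ^ 8) ^ 12 * 2 ^ (h - 1)) := by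
  let F : Fin 4 × Fin 3 → Finset (Bool × Finset ℕ) := fun q =>
    if (a, 1) = q then rowCodes (h - 1) (h - 1) else rowCodes (h - 1) 8
  have h1 : (oneArmStates h a).card ≤ ((rect (h - 1) (h + 2) (h - 1) (h + 2)).powerset ×ˢ
      Fintype.piFinset F).card := by
    refine Finset.card_le_card_of_injOn
      (fun p => ((rect (h - 1) (h + 2) (h - 1) (h + 2)).filter (fun q => p.mark q = true),
        fun q => rowCode (stripRow p.mark (armCell h q.1) q.2) (h - 1))) ?_ ?_
    · intro p hp
      simp only [oneArmStates, Finset.coe_filter, Finset.mem_univ, true_and,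
        Set.mem_ofPred_eq] at hp
      rw [Finset.mem_coe, Finset.mem_product, Finset.mem_powerset, Fintype.mem_piFinset]
      refine ⟨Finset.filter_subset _ _, ?_⟩
      rintro ⟨a', r⟩
      simp only [F]
      split_ifs with har
      · exact rowCode_mem_rowCodes_self _ _
      · have hs := isStrip_armCell h a'
        have hsc := isSimplyConn_plusRegion hh
        have hc := p.hasConnClasses_mark hh
        refine rowCode_mem_rowCodes ?_
        by_cases hr : r = 1
        · subst hr
          refine hs.card_changes_middle_le hsc hc fun i hi => ?_
          by_contra hne
          have := hp (mem_splitArms.2 ⟨i, hi, hne⟩)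
          rw [Finset.mem_singleton] at this
          exact har (by rw [this])
        · exact (hs.card_changes_outer_le hsc hc (by omega)).trans (by omega)
    · intro p _ p' _ heq
      simp only [Prod.mk.injEq] at heq
      refine eq_of_mark_eq hh fun q hq => ?_
      rcases plusRegion_cover hq with hq | ⟨a', r, i, hr, hi, rfl⟩
      · have := congrArg (q ∈ ·) heq.1
        simp only [Finset.mem_filter, hq, true_and] at this
        exact Bool.eq_iff_iff.2 (iff_of_eq this)
      · exact eq_of_rowCode_eq (congrFun heq.2 (a', ⟨r, hr⟩)) i hi
  have hcard : (rect (h - 1) (h + 2) (h - 1) (h + 2)).card = 9 := by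
    rw [rect, Finset.card_product, Nat.card_Ico]
    have : h + 2 - (h - 1) = 3 := by omega
    rw [this]
  rw [Finset.card_product, Finset.card_powerset, hcard, Fintype.card_piFinset] at h1
  refine h1.trans (Nat.mul_le_mul_left _ ?_)
  calc ∏ q, (F q).card ≤ ∏ q : Fin 4 × Fin 3, (2 * h ^ 8) * (if (a, 1) = q then 2 ^ (h - 1) else 1) := by
        refine Finset.prod_le_prod' fun q _ => ?_
        have hpos : 1 ≤ h ^ 8 := Nat.one_le_pow _ _ hh
        simp only [F]
        split_ifs
        · exact (card_rowCodes_self_le _).trans (Nat.mul_le_mul_right _ (by omega))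
        · rw [mul_one]
          refine (card_rowCodes_le _ _).trans ?_
          rw [Nat.sub_add_cancel hh]
    _ = (2 * h ^ 8) ^ 12 * 2 ^ (h - 1) := by
        rw [Finset.prod_mul_distrib, Finset.prod_const, Finset.card_univ, Finset.prod_ite_eq,
          if_pos (Finset.mem_univ _)]
        simp

/-- A set of two elements cannot turn into another one by a change of one membership. -/
theorem pair_subset_of_forall_mem_iff {α : Type*} [DecidableEq α] {T T' : Finset α} {x y a₀ : α}
    (hxy : x ≠ y) (hx : x ∈ T) (hy : y ∈ T) (hT : T.card ≤ 2) (hT' : ¬ T'.card ≤ 1)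
    (h : ∀ a, a ≠ a₀ → (a ∈ T ↔ a ∈ T')) : x ∈ T' ∧ y ∈ T' := by
  have : Nonempty α := ⟨x⟩
  have hT2 : T = {x, y} := (Finset.eq_of_subset_of_card_le
    (by simp [Finset.insert_subset_iff, hx, hy]) (by rwa [Finset.card_pair hxy])).symm
  -- If `u` is lost, then `u` is the exceptional element and no other membership changes, so `T'` is
  -- contained in `{v}`.
  have key : ∀ u v, T = {u, v} → u ∉ T' → False := by
    intro u v huv hu
    refine hT' (Finset.card_le_one_iff_subset_singleton.2 ⟨v, fun w hw => ?_⟩)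
    have hua : u = a₀ := by
      by_contra hne
      exact hu ((h u hne).1 (by simp [huv]))
    have hwu : w ≠ u := fun hwu => hu (hwu ▸ hw)
    have := (h w (hua ▸ hwu)).2 hw
    rw [huv] at this
    simpa [hwu] using this
  exact ⟨by_contra (key x y hT2), by_contra (key y x (by rw [hT2, Finset.pair_comm]))⟩

/-- The states that split the upper and the lower arm. -/
def verticalStates (h : ℕ) : Finset (ContigTwoPartition (plusGraph (2 * h + 1))) :=
  open Classical in
  Finset.univ.filter fun p => 2 ∈ splitArms h p.mark ∧ 3 ∈ splitArms h p.mark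

/-- The states that split at most one arm. -/
def bottleneckStates (h : ℕ) : Finset (ContigTwoPartition (plusGraph (2 * h + 1))) :=
  open Classical in Finset.univ.filter fun p => (splitArms h p.mark).card ≤ 1

theorem card_bottleneckStates_le (hh : 1 ≤ h) :
    (bottleneckStates h).card ≤ 2 ^ 23 * (2 * h + 1) ^ 96 * 2 ^ h := by
  classical
  have hsub : bottleneckStates h ⊆ Finset.univ.biUnion (oneArmStates h) := by
    intro p hp
    simp only [bottleneckStates, Finset.mem_filter, Finset.mem_univ, true_and] at hp
    rw [Finset.card_le_one_iff_subset_singleton] at hp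
    obtain ⟨a, ha⟩ := hp
    exact Finset.mem_biUnion.2 ⟨a, Finset.mem_univ a, by
      simpa [oneArmStates] using ha⟩
  calc (bottleneckStates h).card ≤ ∑ a, (oneArmStates h a).card :=
        (Finset.card_le_card hsub).trans Finset.card_biUnion_le
    _ ≤ ∑ _a : Fin 4, 2 ^ 9 * ((2 * h ^ 8) ^ 12 * 2 ^ (h - 1)) :=
        Finset.sum_le_sum fun a _ => card_oneArmStates_le hh a
    -- The constant is `4 * 2 ^ 9 * 2 ^ 12`: four choices of the arm, the center, and a factor two
    -- for each of the twelve rows.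
    _ = 2 ^ 23 * h ^ 96 * 2 ^ (h - 1) := by
        rw [Finset.sum_const, Finset.card_univ, Fintype.card_fin, smul_eq_mul]
        ring
    _ ≤ 2 ^ 23 * (2 * h + 1) ^ 96 * 2 ^ h := by
        gcongr <;> omega

/-- States outside the cut set split exactly two arms, so a vertical state cannot move directly to
another pair. The sets `leftSet` and `lowerSet` leave a full middle line of length `2 * h + 1` free.
-/
theorem hasBottleneck_partitionChain_plusGraph (hh : 2 ≤ h) :
    HasBottleneck (partitionChain (plusGraph (2 * h + 1))) (1 * 2 ^ (2 * h + 1))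
      (2 ^ 23 * ((2 * h + 1 : ℕ) : ℝ) ^ 96 * (2 : ℝ) ^ (((2 * h + 1 : ℕ) : ℝ) / 2)) := by
  classical
  have hh1 : 1 ≤ h := by omega
  have hcross : ∀ p ∈ verticalStates h, ∀ p' ∈ (verticalStates h ∪ bottleneckStates h)ᶜ,
      partitionChain (plusGraph (2 * h + 1)) p p' = 0 := by
    intro p hp p' hp'
    simp only [verticalStates, bottleneckStates, Finset.mem_compl, Finset.mem_union,
      Finset.mem_filter, Finset.mem_univ, true_and, not_or] at hp hp'
    by_contra hne
    rcases exists_of_partitionChain_ne_zero hne with rfl | ⟨v, hv⟩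
    · exact hp'.1 hp
    · obtain ⟨a₀, ha₀⟩ := exists_forall_mem_splitArms_iff hh1 v hv
      exact hp'.1 (pair_subset_of_forall_mem_iff (by decide) hp.1 hp.2
        (card_splitArms_le hh1 (p.hasConnClasses_mark hh1)) hp'.2 ha₀)
  refine ⟨verticalStates h, bottleneckStates h, ?_,
    fun p hp p' hp' => ⟨hcross p hp p' hp', ?_⟩, ?_, ?_, ?_⟩
  · refine Finset.disjoint_left.2 fun p h1 h2 => ?_
    simp only [verticalStates, bottleneckStates, Finset.mem_filter, Finset.mem_univ,
      true_and] at h1 h2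
    have := Finset.card_le_one.1 h2 _ h1.1 _ h1.2
    simp at this
  · exact (partitionChain_isSymm.apply p p').trans (hcross p hp p' hp')
  · rw [one_mul]
    have := two_pow_le_card_of_injective (verticalStates h) _ (partitionOf_leftSet_injective hh1)
      fun b => by
        simp only [verticalStates, Finset.mem_filter, Finset.mem_univ, true_and,
          splitArms_partitionOf hh1]
        exact splitArms_leftSet hh b
    exact_mod_cast this
  · rw [one_mul]
    have := two_pow_le_card_of_injective (verticalStates h ∪ bottleneckStates h)ᶜ _
      (partitionOf_lowerSet_injective hh1) fun b => by
        have hle := card_splitArms_le hh1 ((partitionOf _ _ (isSplit_lowerSet hh1 b)).hasConnClasses_mark hh1)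
        simp only [verticalStates, bottleneckStates, Finset.mem_compl, Finset.mem_union,
          Finset.mem_filter, Finset.mem_univ, true_and, not_or,
          splitArms_partitionOf hh1] at hle ⊢
        obtain ⟨h0, h1⟩ := splitArms_lowerSet hh b
        -- A set of at most two arms that contains `0` and `1` contains neither `2` nor `3`; this is
        -- checked over all subsets of the four arms.
        generalize splitArms h (markSet plusPos (lowerSet h b)) = T at *
        revert T
        decide
    exact_mod_cast this
  · have h1 : ((bottleneckStates h).card : ℝ) ≤ (2 ^ 23 * (2 * h + 1) ^ 96 * 2 ^ h : ℕ) := by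
      exact_mod_cast card_bottleneckStates_le hh1
    refine h1.trans ?_
    have h2 : ((2 : ℝ) ^ h) ≤ (2 : ℝ) ^ (((2 * h + 1 : ℕ) : ℝ) / 2) := by
      rw [← Real.rpow_natCast]
      refine Real.rpow_le_rpow_of_exponent_le (by norm_num) ?_
      push_cast
      linarith
    push_cast at h2 ⊢
    norm_num
    gcongr

end PlusBottleneck

/-! ### Bandwidth -/

section Bandwidth

/-- Injective labels in `ℕ` can be compressed to consecutive labels. -/
theorem bandwidth_le {V : Type*} [Fintype V] {G : SimpleGraph V} {L : V → ℕ}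
    (hL : Function.Injective L) {b : ℕ} (h : ∀ u v, G.Adj u v → L u ≤ L v → L v ≤ L u + b) :
    bandwidth G ≤ b := by
  classical
  -- Injectivity of `L` ensures that differences of ranks do not exceed differences of labels.
  let rank : V → ℕ := fun u => (Finset.univ.filter fun w => L w < L u).card
  have hlt : ∀ u, rank u < Fintype.card V := fun u =>
    Finset.card_lt_univ_of_notMem (x := u) (by simp)
  have hle : ∀ u v, L u ≤ L v → rank u ≤ rank v ∧ rank v ≤ rank u + (L v - L u) := by
    intro u v huv
    refine ⟨Finset.card_le_card fun w hw => ?_, ?_⟩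
    · simp only [Finset.mem_filter, Finset.mem_univ, true_and] at hw ⊢
      omega
    · have h1 : (Finset.univ.filter fun w => L w < L v) ⊆ (Finset.univ.filter fun w => L w < L u) ∪
          (Finset.univ.filter fun w => L u ≤ L w ∧ L w < L v) := by
        intro w hw
        simp only [Finset.mem_filter, Finset.mem_univ, true_and, Finset.mem_union] at hw ⊢
        omega
      have h2 : (Finset.univ.filter fun w => L u ≤ L w ∧ L w < L v).card
          ≤ (Finset.Ico (L u) (L v)).card :=
        Finset.card_le_card_of_injOn L (fun w hw => by simpa using hw) hL.injOn
      rw [Nat.card_Ico] at h2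
      exact (Finset.card_le_card h1).trans ((Finset.card_union_le _ _).trans
        (Nat.add_le_add_left h2 _))
  have hstrict : ∀ u v, L u < L v → rank u < rank v := fun u v huv =>
    Finset.card_lt_card ⟨fun w hw => by
      simp only [Finset.mem_filter, Finset.mem_univ, true_and] at hw ⊢
      omega, fun hsub => by
      have := hsub (Finset.mem_filter.2 ⟨Finset.mem_univ u, huv⟩)
      simp at this⟩
  have hinj : Function.Injective fun u => (⟨rank u, hlt u⟩ : Fin (Fintype.card V)) := by
    intro u v huv
    simp only [Fin.mk.injEq] at huv
    rcases lt_trichotomy (L u) (L v) with h1 | h1 | h1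
    · have := hstrict u v h1; omega
    · exact hL h1
    · have := hstrict v u h1; omega
  let σ : V ≃ Fin (Fintype.card V) := Equiv.ofBijective _
    ((Fintype.bijective_iff_injective_and_card _).2 ⟨hinj, by simp⟩)
  refine Nat.sInf_le ⟨σ, fun u v huv => ?_⟩
  change |((rank u : ℕ) : ℤ) - ((rank v : ℕ) : ℤ)| ≤ (b : ℤ)
  rw [abs_le]
  rcases le_total (L u) (L v) with h1 | h1
  · have := hle u v h1
    have := h u v huv h1
    omega
  · have := hle v u h1
    have := h v u huv.symm h1
    omega

/-- Only five integers have absolute value at most two, too few for six distinct values. -/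
theorem abs_corner_gt {a b c d k : ℤ} (ha : |a| ≤ 2) (hb : |b| ≤ 2) (hc : |c| ≤ 2) (hd : |d| ≤ 2)
    (hnd : [0, a, b, c, d, k].Nodup) : 2 < |k| := by
  by_contra! hk
  have hsub : [0, a, b, c, d, k].toFinset ⊆ Finset.Icc (-2 : ℤ) 2 := by
    intro x hx
    rw [abs_le] at *
    simp only [List.mem_toFinset, List.mem_cons, List.not_mem_nil, or_false] at hx
    rw [Finset.mem_Icc]
    omega
  have := Finset.card_le_card hsub
  rw [List.toFinset_card_of_nodup hnd] at this
  simp at this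

/-- If all differences were at most two, the center of a `3 × 3` block and its four neighbors would
occupy all labels within distance two of the center's, so the corners would lie farther away. -/
theorem three_le_bandwidth_gridGraph {ℓ : ℕ} (h : 3 ≤ ℓ) : 3 ≤ bandwidth (gridGraph 3 ℓ) := by
  have hne : {b : ℕ | ∃ σ : Fin 3 × Fin ℓ ≃ Fin (Fintype.card (Fin 3 × Fin ℓ)),
      ∀ u v, (gridGraph 3 ℓ).Adj u v → |((σ u : ℕ) : ℤ) - ((σ v : ℕ) : ℤ)| ≤ (b : ℤ)}.Nonempty := by
    refine ⟨Fintype.card (Fin 3 × Fin ℓ), Fintype.equivFin _, fun u v _ => ?_⟩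
    have h1 := (Fintype.equivFin (Fin 3 × Fin ℓ) u).2
    have h2 := (Fintype.equivFin (Fin 3 × Fin ℓ) v).2
    rw [abs_le]
    omega
  obtain ⟨σ, hσ⟩ := Nat.sInf_mem hne
  change ∀ u v, _ → _ ≤ ((bandwidth (gridGraph 3 ℓ) : ℕ) : ℤ) at hσ
  by_contra! hlt
  let p : Fin 3 → Fin 3 → Fin 3 × Fin ℓ := fun i j => (i, ⟨j, by omega⟩)
  let q : Fin 3 → Fin 3 → ℤ := fun i j => ((σ (p i j) : ℕ) : ℤ)
  have hq : ∀ i j i' j', q i j = q i' j' → i = i' ∧ j = j' := by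
    intro i j i' j' hij
    have h1 : p i j = p i' j' := σ.injective (Fin.ext (Nat.cast_injective (R := ℤ) hij))
    simp only [p, Prod.mk.injEq, Fin.mk.injEq] at h1
    exact ⟨h1.1, Fin.ext h1.2⟩
  have hadj : ∀ i j i' j' : Fin 3, (i.1 = i'.1 ∧ (j.1 + 1 = j'.1 ∨ j'.1 + 1 = j.1)) ∨
      (j.1 = j'.1 ∧ (i.1 + 1 = i'.1 ∨ i'.1 + 1 = i.1)) → |q i j - q i' j'| ≤ 2 := by
    intro i j i' j' hij
    have := hσ (p i j) (p i' j') (gridGraph_adj_iff.2 hij)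
    simp only [q]
    omega
  have hne : ∀ i j i' j', (i, j) ≠ (i', j') → q i j ≠ q i' j' := by
    intro i j i' j' h1 h2
    obtain ⟨rfl, rfl⟩ := hq i j i' j' h2
    exact h1 rfl
  have hcorner : ∀ i j : Fin 3, i ≠ 1 → j ≠ 1 → 2 < |q i j - q 1 1| := by
    intro i j hi hj
    refine abs_corner_gt (hadj 0 1 1 1 (by simp)) (hadj 1 0 1 1 (by simp)) (hadj 2 1 1 1 (by simp))
      (hadj 1 2 1 1 (by simp)) ?_
    have e1 := hne 0 1 1 1 (by simp)
    have e2 := hne 1 0 1 1 (by simp)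
    have e3 := hne 2 1 1 1 (by simp)
    have e4 := hne 1 2 1 1 (by simp)
    have e5 := hne i j 1 1 (by simp [hi])
    have e6 := hne 0 1 1 0 (by simp)
    have e7 := hne 0 1 2 1 (by simp)
    have e8 := hne 0 1 1 2 (by simp)
    have e9 := hne 1 0 2 1 (by simp)
    have e10 := hne 1 0 1 2 (by simp)
    have e11 := hne 2 1 1 2 (by simp)
    have e12 := hne i j 0 1 (by simp [hj])
    have e13 := hne i j 1 0 (by simp [hi])
    have e14 := hne i j 2 1 (by simp [hj])
    have e15 := hne i j 1 2 (by simp [hi])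
    simp only [List.nodup_cons, List.mem_cons, List.not_mem_nil, or_false, not_or,
      not_false_eq_true, List.nodup_nil, and_true]
    refine ⟨⟨?_, ?_, ?_, ?_, ?_⟩, ⟨?_, ?_, ?_, ?_⟩, ⟨?_, ?_, ?_⟩, ⟨?_, ?_⟩, ?_⟩ <;>
    · intro heq
      first
      | exact e1 (by linarith)
      | exact e2 (by linarith)
      | exact e3 (by linarith)
      | exact e4 (by linarith)
      | exact e5 (by linarith)
      | exact e6 (by linarith)
      | exact e7 (by linarith)
      | exact e8 (by linarith)
      | exact e9 (by linarith)
      | exact e10 (by linarith)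
      | exact e11 (by linarith)
      | exact e12 (by linarith)
      | exact e13 (by linarith)
      | exact e14 (by linarith)
      | exact e15 (by linarith)
  -- A corner more than two away from the center but within two of both its neighbors puts these on
  -- the same side of the center. The corners `(0, 0)` and `(2, 0)` share the neighbor `(1, 0)`, so
  -- three distinct labels would have to fit into two places.
  have c00 := hcorner 0 0 (by simp) (by simp)
  have c20 := hcorner 2 0 (by simp) (by simp)
  have a1 := hadj 0 0 0 1 (by simp)
  have a2 := hadj 0 0 1 0 (by simp)
  have a3 := hadj 2 0 1 0 (by simp)
  have a4 := hadj 2 0 2 1 (by simp)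
  have b1 := hadj 0 1 1 1 (by simp)
  have b2 := hadj 1 0 1 1 (by simp)
  have b3 := hadj 2 1 1 1 (by simp)
  have e1 := hne 0 1 1 1 (by simp)
  have e2 := hne 1 0 1 1 (by simp)
  have e3 := hne 2 1 1 1 (by simp)
  have e4 := hne 0 1 1 0 (by simp)
  have e5 := hne 0 1 2 1 (by simp)
  have e6 := hne 1 0 2 1 (by simp)
  rw [abs_le] at a1 a2 a3 a4 b1 b2 b3
  rw [lt_abs] at c00 c20
  generalize q 0 0 = q00 at *
  generalize q 0 1 = q01 at *
  generalize q 1 0 = q10 at *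
  generalize q 1 1 = q11 at *
  generalize q 2 0 = q20 at *
  generalize q 2 1 = q21 at *
  clear hcorner hadj hne hq hσ
  omega

theorem bandwidth_gridGraph {ℓ : ℕ} (h : 3 ≤ ℓ) : bandwidth (gridGraph 3 ℓ) = 3 := by
  refine le_antisymm ?_ (three_le_bandwidth_gridGraph h)
  refine bandwidth_le (L := fun v => 3 * v.2.1 + v.1.1) ?_ ?_
  · intro u v huv
    change 3 * u.2.1 + u.1.1 = 3 * v.2.1 + v.1.1 at huv
    have := u.1.2
    have := v.1.2
    exact Prod.ext (Fin.ext (by omega)) (Fin.ext (by omega))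
  · intro u v huv
    rw [gridGraph_adj_iff] at huv
    have := u.1.2
    have := v.1.2
    change _ → 3 * v.2.1 + v.1.1 ≤ 3 * u.2.1 + u.1.1 + 3
    omega

/-- Labels of the plus: first the center, then twelve labels for each layer of the four arms. -/
def plusLabel (h x y : ℕ) : ℕ :=
  if x + 1 < h then 9 + 12 * (h - 2 - x) + (y + 1 - h)
  else if h + 2 ≤ x then 12 + 12 * (x - (h + 2)) + (y + 1 - h)
  else if y + 1 < h then 15 + 12 * (h - 2 - y) + (x + 1 - h)
  else if h + 2 ≤ y then 18 + 12 * (y - (h + 2)) + (x + 1 - h)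
  else if y = h then x + 1 - h
  else if y < h then 3 + (x + 1 - h)
  else 6 + (x + 1 - h)

/-- With the layer `n` and the transversal offset `a` as variables, truncated subtraction disappears
and the labels become linear in each of the seven parts of the plus. -/
theorem plusLabel_spec {h x y : ℕ}
    (hxy : (h ≤ x + 1 ∧ x ≤ h + 1) ∨ (h ≤ y + 1 ∧ y ≤ h + 1)) :
    ∃ n a, a < 3 ∧
      ((x + n + 2 = h ∧ y + 1 = h + a ∧ plusLabel h x y = 9 + 12 * n + a) ∨
      (x = h + 2 + n ∧ y + 1 = h + a ∧ plusLabel h x y = 12 + 12 * n + a) ∨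
      (y + n + 2 = h ∧ x + 1 = h + a ∧ plusLabel h x y = 15 + 12 * n + a) ∨
      (y = h + 2 + n ∧ x + 1 = h + a ∧ plusLabel h x y = 18 + 12 * n + a) ∨
      (y = h ∧ x + 1 = h + a ∧ plusLabel h x y = a) ∨
      (y + 1 = h ∧ x + 1 = h + a ∧ plusLabel h x y = 3 + a) ∨
      (y = h + 1 ∧ x + 1 = h + a ∧ plusLabel h x y = 6 + a)) := by
  unfold plusLabel
  split_ifs with h1 h2 h3 h4 h5 h6
  · exact ⟨h - 2 - x, y + 1 - h, by omega, Or.inl (by omega)⟩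
  · exact ⟨x - (h + 2), y + 1 - h, by omega, Or.inr (Or.inl (by omega))⟩
  · exact ⟨h - 2 - y, x + 1 - h, by omega, Or.inr (Or.inr (Or.inl (by omega)))⟩
  · exact ⟨y - (h + 2), x + 1 - h, by omega, Or.inr (Or.inr (Or.inr (Or.inl (by omega))))⟩
  all_goals refine ⟨0, x + 1 - h, by omega, Or.inr (Or.inr (Or.inr (Or.inr ?_)))⟩
  · exact Or.inl (by omega)
  · exact Or.inr (Or.inl (by omega))
  · exact Or.inr (Or.inr (by omega))

theorem plusLabel_inj {h x y x' y' : ℕ}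
    (hxy : (h ≤ x + 1 ∧ x ≤ h + 1) ∨ (h ≤ y + 1 ∧ y ≤ h + 1))
    (hxy' : (h ≤ x' + 1 ∧ x' ≤ h + 1) ∨ (h ≤ y' + 1 ∧ y' ≤ h + 1))
    (heq : plusLabel h x y = plusLabel h x' y') : x = x' ∧ y = y' := by
  obtain ⟨n, a, ha, h1⟩ := plusLabel_spec hxy
  obtain ⟨n', a', ha', h2⟩ := plusLabel_spec hxy'
  rw [← heq] at h2
  clear hxy hxy' heq
  generalize plusLabel h x y = l at *
  rcases h1 with h1 | h1 | h1 | h1 | h1 | h1 | h1 <;>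
    rcases h2 with h2 | h2 | h2 | h2 | h2 | h2 | h2 <;> omega

/-- Consecutive layers of an arm are twelve labels apart. Labeling the middle row of the center
first keeps the upper and lower central rows at distance exactly twelve from the first layers of
their arms. -/
theorem plusLabel_le_add {h x y x' y' : ℕ}
    (hxy : (h ≤ x + 1 ∧ x ≤ h + 1) ∨ (h ≤ y + 1 ∧ y ≤ h + 1))
    (hxy' : (h ≤ x' + 1 ∧ x' ≤ h + 1) ∨ (h ≤ y' + 1 ∧ y' ≤ h + 1))
    (hadj : (x = x' ∧ (y + 1 = y' ∨ y' + 1 = y)) ∨ (y = y' ∧ (x + 1 = x' ∨ x' + 1 = x))) :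
    plusLabel h x' y' ≤ plusLabel h x y + 12 := by
  obtain ⟨n, a, ha, h1⟩ := plusLabel_spec hxy
  obtain ⟨n', a', ha', h2⟩ := plusLabel_spec hxy'
  clear hxy hxy'
  generalize plusLabel h x y = l at *
  generalize plusLabel h x' y' = l' at *
  rcases h1 with h1 | h1 | h1 | h1 | h1 | h1 | h1 <;>
    rcases h2 with h2 | h2 | h2 | h2 | h2 | h2 | h2 <;> omega

theorem bandwidth_plusGraph_le (h : ℕ) : bandwidth (plusGraph (2 * h + 1)) ≤ 12 := by
  refine bandwidth_le (L := fun v => plusLabel h v.1.1.1 v.1.2.1) ?_ ?_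
  · intro u v huv
    have key := plusLabel_inj (mem_plusSet_iff.1 u.2) (mem_plusSet_iff.1 v.2) huv
    exact plusSet_ext key.1 key.2
  · intro u v huv _
    rw [plusGraph_adj_iff] at huv
    exact plusLabel_le_add (mem_plusSet_iff.1 u.2) (mem_plusSet_iff.1 v.2) huv

end Bandwidth

/-! ### Mixing times -/

section Mixing

/-- Covering the plus by its two bars gives a crude bound, which suffices since it only affects the
constant in the exponent. -/
theorem card_plusSet_le (h : ℕ) : Fintype.card (plusSet (2 * h + 1)) ≤ 6 * (2 * h + 1) := by
  classical
  let f : plusSet (2 * h + 1) → Bool × Fin 3 × Fin (2 * h + 1) := fun v =>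
    if hx : h ≤ v.1.1.1 + 1 ∧ v.1.1.1 ≤ h + 1 then (false, ⟨v.1.1.1 + 1 - h, by omega⟩, v.1.2)
    else (true, ⟨v.1.2.1 + 1 - h, by have := mem_plusSet_iff.1 v.2; omega⟩, v.1.1)
  have hf : Function.Injective f := by
    intro u v huv
    have hu := mem_plusSet_iff.1 u.2
    have hv := mem_plusSet_iff.1 v.2
    simp only [f] at huv
    split_ifs at huv with h1 h2 h2
    · simp only [Prod.mk.injEq, Fin.mk.injEq, true_and] at huv
      exact plusSet_ext (by omega) (by rw [huv.2])
    · simp at huv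
    · simp at huv
    · simp only [Prod.mk.injEq, Fin.mk.injEq, true_and] at huv
      exact plusSet_ext (by rw [huv.2]) (by omega)
  have := Fintype.card_le_of_injective f hf
  simp only [Fintype.card_prod, Fintype.card_bool, Fintype.card_fin] at this
  omega

theorem two_rpow_eq_exp (x : ℝ) : (2 : ℝ) ^ x = Real.exp (Real.log 2 * x) :=
  Real.rpow_def_of_pos (by norm_num) x

theorem two_pow_eq_exp (n : ℕ) : (2 : ℝ) ^ n = Real.exp (Real.log 2 * n) := by
  rw [← Real.rpow_natCast, two_rpow_eq_exp]

theorem mixingTime_colorChain_gridGraph {δ : ℝ} (hδ : δ < 1 / 2) :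
    ∃ ℓ₀ : ℕ, ∀ ℓ : ℕ, ℓ₀ ≤ ℓ →
      ENNReal.ofReal (Real.exp (1 / 10 * (Fintype.card (Fin 3 × Fin ℓ) : ℝ))) ≤
        ((mixingTime (colorChain (gridGraph 3 ℓ) 2) (uniformDist _) δ : ℕ∞) : ℝ≥0∞) := by
  -- The rate `1 / 10` per vertex is `3 / 10` per column, below the rate `log 2` of the large
  -- regions.
  have hlog : (3 / 10 : ℝ) < Real.log 2 := by have := Real.log_two_gt_d9; linarith
  obtain ⟨n₀, hn⟩ := exists_forall_mul_pow_mul_exp_le (2 ^ 27) (1 / 2 - δ) (3 / 10) (Real.log 2) 24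
    (by linarith) hlog
  refine ⟨max n₀ 1, fun ℓ hℓ => ?_⟩
  have h1 : 1 ≤ ℓ := (le_max_right _ _).trans hℓ
  have h0 : (0 : ℝ) < ℓ := by exact_mod_cast h1
  have : Nonempty (Fin 3 × Fin ℓ) := ⟨(0, ⟨0, h1⟩)⟩
  refine (hasBottleneck_colorChain_gridGraph h1).le_mixingTime colorChain_mem_rowStochastic
    colorChain_isSymm (by positivity) (by positivity) ?_
  have h2 := hn ℓ ((le_max_left _ _).trans hℓ)
  simp only [Fintype.card_prod, Fintype.card_fin, Nat.cast_mul, Nat.cast_ofNat]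
  rw [one_mul, two_pow_eq_exp ℓ]
  refine le_trans (le_of_eq ?_) h2
  ring_nf

theorem mixingTime_partitionChain_plusGraph {δ : ℝ} (hδ : δ < 1 / 2) :
    ∃ ℓ₀ : ℕ, ∀ ℓ : ℕ, ℓ₀ ≤ ℓ → Odd ℓ →
      ENNReal.ofReal (Real.exp (1 / 20 * (Fintype.card (plusSet ℓ) : ℝ))) ≤
        ((mixingTime (partitionChain (plusGraph ℓ)) (uniformDist _) δ : ℕ∞) : ℝ≥0∞) := by
  -- The rate `1 / 20` per vertex is at most `3 / 10` per unit of `ℓ`. The exponential size of the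
  -- cut set adds `log 2 / 2`, so the requirement is `log 2 > 3 / 5`.
  have hlog : (3 / 10 : ℝ) + Real.log 2 / 2 < Real.log 2 := by
    have := Real.log_two_gt_d9; linarith
  obtain ⟨n₀, hn⟩ := exists_forall_mul_pow_mul_exp_le (2 ^ 23) (1 / 2 - δ)
    (3 / 10 + Real.log 2 / 2) (Real.log 2) 96 (by linarith) hlog
  refine ⟨max n₀ 5, ?_⟩
  rintro ℓ hℓ ⟨h, rfl⟩
  have h5 : 5 ≤ 2 * h + 1 := (le_max_right _ _).trans hℓ
  have h2 := hn (2 * h + 1) ((le_max_left _ _).trans hℓ)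
  have hc : ((Fintype.card (plusSet (2 * h + 1)) : ℕ) : ℝ) ≤ 6 * ((2 * h + 1 : ℕ) : ℝ) := by
    exact_mod_cast card_plusSet_le h
  refine (ENNReal.ofReal_le_ofReal (Real.exp_le_exp.2
    (show _ ≤ 3 / 10 * ((2 * h + 1 : ℕ) : ℝ) by linarith))).trans ?_
  have h0 : (0 : ℝ) < ((2 * h + 1 : ℕ) : ℝ) := by positivity
  refine (hasBottleneck_partitionChain_plusGraph (h := h) (by omega)).le_mixingTime
    partitionChain_mem_rowStochastic partitionChain_isSymm (by positivity) (by positivity) ?_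
  rw [one_mul, two_pow_eq_exp (2 * h + 1), two_rpow_eq_exp]
  refine le_trans (le_of_eq ?_) h2
  rw [add_mul, Real.exp_add]
  ring_nf

end Mixing

end ConnPart

/-! ### The main theorem -/

theorem mainTheorem5 :
    -- the color chain on the `3 × ℓ` grid
    ((∀ ℓ : ℕ, 3 ≤ ℓ → ConnPart.bandwidth (ConnPart.gridGraph 3 ℓ) = 3) ∧
      (∀ ℓ : ℕ, 1 ≤ ℓ →
        ConnPart.IsErgodicChain (ConnPart.colorChain (ConnPart.gridGraph 3 ℓ) 2)
          (ConnPart.uniformDist _)) ∧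
      (∃ c : ℝ, 0 < c ∧ ∀ δ : ℝ, 0 < δ → δ < 1 / 2 → ∃ ℓ₀ : ℕ, ∀ ℓ : ℕ, ℓ₀ ≤ ℓ →
        ENNReal.ofReal (Real.exp (c * (Fintype.card (Fin 3 × Fin ℓ) : ℝ))) ≤
          ((ConnPart.mixingTime (ConnPart.colorChain (ConnPart.gridGraph 3 ℓ) 2)
            (ConnPart.uniformDist _) δ : ℕ∞) : ENNReal)) ∧
      (∃ c K : ℝ, ∃ k ℓ₀ : ℕ, 0 < c ∧ ∀ ℓ : ℕ, ℓ₀ ≤ ℓ →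
        ConnPart.HasBottleneck (ConnPart.colorChain (ConnPart.gridGraph 3 ℓ) 2)
          (c * 2 ^ ℓ) (K * (ℓ : ℝ) ^ k))) ∧
    -- the partition chain on the plus-shaped graph
    ((∀ ℓ : ℕ, Odd ℓ → ConnPart.bandwidth (ConnPart.plusGraph ℓ) ≤ 12) ∧
      (∀ ℓ : ℕ, Odd ℓ →
        ConnPart.IsErgodicChain (ConnPart.partitionChain (ConnPart.plusGraph ℓ))
          (ConnPart.uniformDist _)) ∧
      (∃ c : ℝ, 0 < c ∧ ∀ δ : ℝ, 0 < δ → δ < 1 / 2 → ∃ ℓ₀ : ℕ, ∀ ℓ : ℕ, ℓ₀ ≤ ℓ → Odd ℓ →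
        ENNReal.ofReal (Real.exp (c * (Fintype.card (ConnPart.plusSet ℓ) : ℝ))) ≤
          ((ConnPart.mixingTime (ConnPart.partitionChain (ConnPart.plusGraph ℓ))
            (ConnPart.uniformDist _) δ : ℕ∞) : ENNReal)) ∧
      (∃ c K : ℝ, ∃ k ℓ₀ : ℕ, 0 < c ∧ ∀ ℓ : ℕ, ℓ₀ ≤ ℓ → Odd ℓ →
        ConnPart.HasBottleneck (ConnPart.partitionChain (ConnPart.plusGraph ℓ))
          (c * 2 ^ ℓ) (K * (ℓ : ℝ) ^ k * (2 : ℝ) ^ ((ℓ : ℝ) / 2)))) := by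
  refine ⟨⟨fun ℓ => ConnPart.bandwidth_gridGraph,
    fun ℓ => ConnPart.isErgodicChain_colorChain_gridGraph,
    ⟨1 / 10, by norm_num, fun δ _ hδ => ConnPart.mixingTime_colorChain_gridGraph hδ⟩,
    ⟨1, 2 ^ 27, 24, 1, one_pos, fun ℓ => ConnPart.hasBottleneck_colorChain_gridGraph⟩⟩, ?_, ?_,
    ⟨1 / 20, by norm_num, fun δ _ hδ => ConnPart.mixingTime_partitionChain_plusGraph hδ⟩,
    ⟨1, 2 ^ 23, 96, 5, one_pos, ?_⟩⟩
  · rintro ℓ ⟨h, rfl⟩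
    exact ConnPart.bandwidth_plusGraph_le h
  · rintro ℓ ⟨h, rfl⟩
    exact ConnPart.isErgodicChain_partitionChain_plusGraph h
  · rintro ℓ hℓ ⟨h, rfl⟩
    exact ConnPart.hasBottleneck_partitionChain_plusGraph (by omega)

end
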